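/- **Conventions.** For a valued field $(K,v)$, $vK$ is the value group and $Kv$ the residue field; $(K,v)$ has characteristic $(q,p)$ if $\operatorname{char}K=q$ and $\operatorname{char}Kv=p$. Its rank is the Krull dimension of its valuation ring. It is discretely valued if $vK\cong\mathbb Z$. It is *algebraically maximal* if it has no nontrivial immediate algebraic extension, where $(L|K,v)$ is *immediate* if the embeddings $vK\hookrightarrow vL$ and $Kv\hookrightarrow Lv$ are onto. An algebraic extension $L|K$ is *unibranched* if $v$ extends uniquely to $L$, and $(K,v)$ is *henselian* if every algebraic extension is unibranched. A finite unibranched extension $(L|K,v)$ has *defect* $d$ if $[L:K]=d\,(vL:vK)\,[Lv:Kv]$ (where $d$ is a power of the characteristic exponent of $Kv$). A henselian field $(K,v)$ is *defectless* (respectively *separably defectless*) if every finite (respectively finite separable) unibranched extension has defect $1$; this property of the finite separable unibranched extensions is also what "separably defectless" means below. A valued field is *inseparably defectless* if every finite purely inseparable extension has defect $1$. If $w$ is a valuation on $L$ and $v_0$ a valuation on $Lw$, then $w\circ v_0$ is the valuation on $L$ whose valuation ring consists of all $x$ with $wx\ge 0$ whose $w$-residue lies in the valuation ring of $v_0$.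 **Theorem 1.2.** Let $p$ be a prime and let $q\in\{p,0\}$. There are a field $L$, a valuation $w$ on $L$ and a valuation $v_0$ on the residue field $L_0=Lw$ such that: 1. $(L,w)$ is a henselian defectless discretely valued field; 2. $(L_0,v_0)$ is a discretely valued algebraically maximal field of characteristic $p$ that is not inseparably defectless and that admits a purely inseparable extension of degree $p$ which is not an algebraically maximal field; 3. with $v=w\circ v_0$, the valued field $(L,v)$ has characteristic $(q,p)$ and rank $2$, it is algebraically maximal, and it is not separably defectless; 4. there are a separable extension $L(a,b)|L$ of degree $p^2$ and an extension of $v$ to $L(a,b)$ such that $(L(a,b)|L,v)$ is unibranched with defect $p$, $[L(a):L]=[L(b):L]=p$, and neither $(L(a),v)$ nor $(L(b),v)$ is algebraically maximal. In particular, "algebraically maximal" does not imply "separably defectless", and it is not preserved under finite separable extensions. -/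

import Mathlib

/-!
Valued fields are modelled as pairs `(K, A)` with `A : ValuationSubring K`, that is, by a valuation
up to equivalence.  The value group is `A.ValueGroupˣ` (Mathlib's `A.ValueGroup` carries an
additional zero), the valuation is `A.valuation : K → A.ValueGroup`, and the residue field is
`IsLocalRing.ResidueField A`.  A valued field extension `(L|K, v)` is a field extension `L|K`
together with `B : ValuationSubring L`; the field `K` then carries the restricted valuation
`B.comap (algebraMap K L)`.
-/

namespace ValuedField

open IsLocalRing

section Composite

variable {L : Type*} [Field L]

/-- The composite `w ∘ v₀` of a valuation `w` on `L`, with valuation ring `W`, and a valuation `v₀`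
on its residue field, with valuation ring `A₀`: its valuation ring consists of the elements of `W`
whose residue lies in `A₀`. -/
def composite (W : ValuationSubring L) (A₀ : ValuationSubring (ResidueField W)) :
    ValuationSubring L :=
  { (A₀.toSubring.comap (residue W)).map W.subtype with
    mem_or_inv_mem' := by
      intro x
      have key : ∀ y : L, ∀ hy : y ∈ W, residue W ⟨y, hy⟩ ∈ A₀ →
          y ∈ (A₀.toSubring.comap (residue W)).map W.subtype :=
        fun y hy h => ⟨⟨y, hy⟩, h, rfl⟩
      by_cases hx : x ∈ W
      · by_cases hx' : x⁻¹ ∈ W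
        · by_cases h0 : x = 0
          · exact Or.inl (key x hx (by subst h0; exact (map_zero (residue W)) ▸ A₀.zero_mem))
          · have hmul : residue W ⟨x, hx⟩ * residue W ⟨x⁻¹, hx'⟩ = 1 := by
              rw [← map_mul, ← map_one (residue W)]
              exact congrArg _ (Subtype.ext (mul_inv_cancel₀ h0))
            rcases A₀.mem_or_inv_mem (residue W ⟨x, hx⟩) with h | h
            · exact Or.inl (key _ hx h)
            · exact Or.inr (key _ hx' (by rwa [← eq_inv_of_mul_eq_one_right hmul] at h))
        · refine Or.inl (key x hx ?_)
          have : residue W ⟨x, hx⟩ = 0 := by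
            rw [residue_eq_zero_iff, mem_maximalIdeal, mem_nonunits_iff]
            intro hu
            obtain ⟨y, hy⟩ := hu.exists_right_inv
            have hxy : x * (y : L) = 1 := congrArg Subtype.val hy
            exact hx' ((eq_inv_of_mul_eq_one_right hxy) ▸ y.2)
          rw [this]
          exact A₀.zero_mem
      · have hx' : x⁻¹ ∈ W := (W.mem_or_inv_mem x).resolve_left hx
        refine Or.inr (key _ hx' ?_)
        have : residue W ⟨x⁻¹, hx'⟩ = 0 := by
          rw [residue_eq_zero_iff, mem_maximalIdeal, mem_nonunits_iff]
          intro hu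
          obtain ⟨y, hy⟩ := hu.exists_right_inv
          have hxy : x⁻¹ * (y : L) = 1 := congrArg Subtype.val hy
          exact hx (by
            have := eq_inv_of_mul_eq_one_right hxy
            rw [inv_inv] at this
            exact this ▸ y.2)
        rw [this]
        exact A₀.zero_mem }

theorem mem_composite {W : ValuationSubring L} {A₀ : ValuationSubring (ResidueField W)} {x : L} :
    x ∈ composite W A₀ ↔ ∃ hx : x ∈ W, residue W ⟨x, hx⟩ ∈ A₀ := by
  constructor
  · rintro ⟨y, hy, rfl⟩
    exact ⟨y.2, hy⟩
  · rintro ⟨hx, h⟩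
    exact ⟨⟨x, hx⟩, h, rfl⟩

end Composite

section Extension

variable (K : Type*) {L : Type*} [Field K] [Field L] [Algebra K L]

/-- The restriction to `K` of the valuation on `L` with valuation ring `B`. -/
abbrev restrict (B : ValuationSubring L) : ValuationSubring K := B.comap (algebraMap K L)

/-- The value group `vK`, embedded in `vL`. -/
noncomputable def valueSubgroup (B : ValuationSubring L) : Subgroup B.ValueGroupˣ :=
  ((Units.map (B.valuation : L →* B.ValueGroup)).comp
    (Units.map (algebraMap K L : K →* L))).range

/-- The inclusion of the valuation ring of `K` into that of `L`. -/
def integerMap (B : ValuationSubring L) : restrict K B →+* B :=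
  ((algebraMap K L).comp (restrict K B).subtype).codRestrict B.toSubring fun x => x.2

instance (B : ValuationSubring L) : IsLocalHom (integerMap K B) where
  map_nonunit x hx := by
    obtain ⟨y, hy⟩ := hx.exists_right_inv
    have h : algebraMap K L x * (y : L) = 1 := congrArg Subtype.val hy
    have hx0 : (x : K) ≠ 0 := by
      intro h0
      rw [h0, map_zero, zero_mul] at h
      exact zero_ne_one h
    have hmem : (x : K)⁻¹ ∈ restrict K B := by
      change algebraMap K L (x : K)⁻¹ ∈ B
      rw [map_inv₀, ← eq_inv_of_mul_eq_one_right h]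
      exact y.2
    exact IsUnit.of_mul_eq_one ⟨(x : K)⁻¹, hmem⟩ (Subtype.ext (mul_inv_cancel₀ hx0))

/-- The embedding of the residue field `Kv` in `Lv`. -/
noncomputable def residueMap (B : ValuationSubring L) :
    ResidueField (restrict K B) →+* ResidueField B :=
  ResidueField.map (integerMap K B)

/-- The residue field `Kv`, embedded in `Lv`. -/
noncomputable def residueSubfield (B : ValuationSubring L) : Subfield (ResidueField B) :=
  (residueMap K B).fieldRange

/-- The ramification index `(vL : vK)`. -/
noncomputable def ramificationIndex (B : ValuationSubring L) : ℕ :=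
  (valueSubgroup K B).index

/-- The inertia degree `[Lv : Kv]`. -/
noncomputable def inertiaDegree (B : ValuationSubring L) : ℕ :=
  Module.finrank (residueSubfield K B) (ResidueField B)

/-- `(L|K, v)` is immediate: the embeddings of `vK` in `vL` and of `Kv` in `Lv` are onto. -/
def IsImmediate (B : ValuationSubring L) : Prop :=
  valueSubgroup K B = ⊤ ∧ residueSubfield K B = ⊤

variable {K} in
/-- The extension `L|K` is unibranched with respect to the valuation on `K` with valuation ring
`A`: this valuation has a unique extension to `L`. -/
def IsUnibranched (A : ValuationSubring K) (L : Type*) [Field L] [Algebra K L] : Prop :=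
  ∃! B : ValuationSubring L, restrict K B = A

/-- `(L|K, v)` is a finite unibranched extension of defect `d`: if `q` is the characteristic
exponent of `Kv`, then `d` is a power of `q` and `[L : K] = d * (vL : vK) * [Lv : Kv]`. -/
def HasDefect (B : ValuationSubring L) (d : ℕ) : Prop :=
  FiniteDimensional K L ∧ IsUnibranched (restrict K B) L ∧
    (∃ ν : ℕ, d = ringExpChar (ResidueField (restrict K B)) ^ ν) ∧
    Module.finrank K L = d * ramificationIndex K B * inertiaDegree K B

end Extension

section Properties

universe u

variable {K : Type u} [Field K] (A : ValuationSubring K)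

/-- `(K, v)` is algebraically maximal: every immediate algebraic extension is trivial.  (Algebraic
extensions of `K` have isomorphic copies in the universe of `K`.) -/
def IsAlgebraicallyMaximal : Prop :=
  ∀ (L : Type u) [Field L] [Algebra K L] (B : ValuationSubring L),
    Algebra.IsAlgebraic K L → restrict K B = A → IsImmediate K B →
      Function.Surjective (algebraMap K L)

/-- `(K, v)` is henselian: every algebraic extension is unibranched. -/
def IsHenselian : Prop :=
  ∀ (L : Type u) [Field L] [Algebra K L], Algebra.IsAlgebraic K L → IsUnibranched A L

/-- Every finite unibranched extension of `(K, v)` has defect `1`.  A henselian field with this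
property is a defectless field. -/
def IsDefectless : Prop :=
  ∀ (L : Type u) [Field L] [Algebra K L] (B : ValuationSubring L),
    FiniteDimensional K L → restrict K B = A → IsUnibranched A L → HasDefect K B 1

/-- Every finite unibranched separable extension of `(K, v)` has defect `1`.  A henselian field
with this property is a separably defectless field. -/
def IsSeparablyDefectless : Prop :=
  ∀ (L : Type u) [Field L] [Algebra K L] (B : ValuationSubring L),
    FiniteDimensional K L → Algebra.IsSeparable K L → restrict K B = A → IsUnibranched A L →
      HasDefect K B 1

/-- `(K, v)` is inseparably defectless: every finite purely inseparable extension has defect `1`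
(such extensions are always unibranched). -/
def IsInseparablyDefectless : Prop :=
  ∀ (L : Type u) [Field L] [Algebra K L] (B : ValuationSubring L),
    FiniteDimensional K L → IsPurelyInseparable K L → restrict K B = A → HasDefect K B 1

/-- `(K, v)` is discretely valued: its value group is isomorphic to `ℤ`, that is, its valuation
ring is a discrete valuation ring. -/
def IsDiscretelyValued : Prop :=
  IsDiscreteValuationRing A

/-- The rank of `(K, v)`, as the Krull dimension of the valuation ring (the convex subgroups of the
value group correspond to the prime ideals of the valuation ring). -/
noncomputable def rank : WithBot ℕ∞ :=
  ringKrullDim A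

end Properties

end ValuedField

/-!
The example rests on a discretely valued field `L₀` of characteristic `p` that is algebraically
maximal although it has a purely inseparable extension of degree `p ^ 2` with defect `p`.

Let `t` be a uniformizer of `E = F_p((X))`. Since the valuation ring of `E` is uncountable, there are
`r`, `s` in it such that `u = r ^ p + t * s ^ p` has the same value as `t`, the elements `t`, `u` are
algebraically independent over `F_p`, and `s` is transcendental over `F_p(t, u)`
(`exists_complement`). Let `L₀` be the separable closure of `F_p(t, u)` in `E`, so that
`L₀ = L₀ ^ p (t, u)`. It has two properties, which pull in opposite directions.

* `L₀` is relatively algebraically closed in `E`. It suffices that it is closed under `p`-th roots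
  in `E` (`IsGeneratedPair.mem_of_pow_mem`), and a new `p`-th root would force `s ^ p ∈ L₀`, against
  the choice of `s`. As `E` is complete, `L₀` is algebraically maximal
  (`isAlgebraicallyMaximal_of_isAlgebraicallyClosedIn`).
* `t` and `u` are `p`-independent in `L₀` (`IsGeneratedPair.eq_zero_of_sum`). So the extension of
  `L₀` by `t ^ (1 / p)` and `u ^ (1 / p)` has degree `p ^ 2`, but its value group has index `p`
  because `t` and `u` have the same value, and its residue field is still `F_p`. The defect is `p`,
  and `L₀(t ^ (1 / p))` has a nontrivial immediate extension
  (`IsUniformizerPair.exists_purelyInseparable`).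

The field `(L, w)` is complete and discretely valued with residue field `L₀`. For `q = p` it comes
from the completion of `L₀[X]` at `X`. For `q = 0`, let `S` be the `p`-adic completion of `ℤ((X))`, a
discrete valuation ring with residue field `E`; by Hensel's lemma, `L₀` is the quotient by `p` of the
ring of those elements of `S` that are algebraic over lifts of `t` and `u` (`exists_lift`), and
the `p`-adic completion of that ring is the valuation ring of `w`. A complete discrete valuation is
henselian (`isHenselian_of_isAdicComplete`) and defectless (`isDefectless_of_isAdicComplete`). An
immediate algebraic extension of `L` for the composite `v` of `w` with the valuation `v₀` of `L₀`
induces an immediate algebraic extension of `L₀`, which is trivial, so it is immediate for `w` and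
hence trivial itself (`isAlgebraicallyMaximal_composite`).

The inseparable extension of `L₀` lifts to a separable extension of `L`: for a uniformizer `π` of `w`
and lifts of `t` and `u` to `L`, again denoted `t` and `u`, adjoin roots `a` and `b` of
`X ^ p - π X - t` and `X ^ p - π X - u`. Their residues are `t ^ (1 / p)` and `u ^ (1 / p)`, so
`L(a, b)` has degree `p ^ 2` over `L`, all of it coming from the residue field of `w`, and the defect
`p` over `L₀` becomes the defect of `v` (`exists_separable_defect_extension`).
-/

/-! ### Valuation rings, restriction and composition -/

namespace ValuedField

open IsLocalRing

section Basic

variable {K L : Type*} [Field K] [Field L] [Algebra K L]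

theorem valuation_restrict_le_iff (B : ValuationSubring L) (x y : K) :
    (restrict K B).valuation x ≤ (restrict K B).valuation y ↔
      B.valuation (algebraMap K L x) ≤ B.valuation (algebraMap K L y) := by
  rcases eq_or_ne y 0 with rfl | hy
  · simp
  · have hy' : algebraMap K L y ≠ 0 := by simpa using hy
    have h1 : (restrict K B).valuation x ≤ (restrict K B).valuation y ↔
        (restrict K B).valuation (x / y) ≤ 1 := by
      rw [map_div₀, div_le_one₀]
      exact zero_lt_iff.2 (by simpa using hy)
    have h2 : B.valuation (algebraMap K L x) ≤ B.valuation (algebraMap K L y) ↔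
        B.valuation (algebraMap K L (x / y)) ≤ 1 := by
      rw [map_div₀ (algebraMap K L), map_div₀, div_le_one₀]
      exact zero_lt_iff.2 (by simpa using hy)
    rw [h1, h2, ValuationSubring.valuation_le_one_iff, ValuationSubring.valuation_le_one_iff,
      ValuationSubring.mem_comap]

theorem valuation_restrict_lt_iff (B : ValuationSubring L) (x y : K) :
    (restrict K B).valuation x < (restrict K B).valuation y ↔
      B.valuation (algebraMap K L x) < B.valuation (algebraMap K L y) := by
  rw [← not_le, ← not_le, valuation_restrict_le_iff]

theorem valuation_restrict_eq_iff (B : ValuationSubring L) (x y : K) :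
    (restrict K B).valuation x = (restrict K B).valuation y ↔
      B.valuation (algebraMap K L x) = B.valuation (algebraMap K L y) := by
  rw [le_antisymm_iff, le_antisymm_iff, valuation_restrict_le_iff, valuation_restrict_le_iff]

theorem valuation_restrict_lt_one_iff (B : ValuationSubring L) (x : K) :
    (restrict K B).valuation x < 1 ↔ B.valuation (algebraMap K L x) < 1 := by
  simpa using valuation_restrict_lt_iff B x 1

theorem mem_valueSubgroup_iff (B : ValuationSubring L) (g : B.ValueGroupˣ) :
    g ∈ valueSubgroup K B ↔ ∃ c : K, (g : B.ValueGroup) = B.valuation (algebraMap K L c) := by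
  constructor
  · rintro ⟨c, rfl⟩
    exact ⟨c, rfl⟩
  · rintro ⟨c, hc⟩
    have hc0 : c ≠ 0 := by
      rintro rfl
      simp at hc
    exact ⟨Units.mk0 c hc0, Units.ext hc.symm⟩

theorem exists_unit_valuation (B : ValuationSubring L) (g : B.ValueGroupˣ) :
    ∃ x : L, x ≠ 0 ∧ (g : B.ValueGroup) = B.valuation x := by
  obtain ⟨x, hx⟩ := B.valuation_surjective g
  refine ⟨x, ?_, hx.symm⟩
  rintro rfl
  exact g.ne_zero (by simpa using hx.symm)

theorem valueSubgroup_eq_top_iff (B : ValuationSubring L) :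
    valueSubgroup K B = ⊤ ↔
      ∀ x : L, x ≠ 0 → ∃ c : K, B.valuation x = B.valuation (algebraMap K L c) := by
  rw [Subgroup.eq_top_iff']
  constructor
  · intro h x hx
    exact (mem_valueSubgroup_iff B (Units.mk0 (B.valuation x) (by simpa using hx))).1 (h _)
  · intro h g
    obtain ⟨x, hx, hg⟩ := exists_unit_valuation B g
    obtain ⟨c, hc⟩ := h x hx
    exact (mem_valueSubgroup_iff B g).2 ⟨c, hg.trans hc⟩

theorem residue_eq_residue_iff (B : ValuationSubring L) (x y : B) :
    residue B x = residue B y ↔ B.valuation ((x : L) - y) < 1 := by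
  rw [← sub_eq_zero, ← map_sub, residue_eq_zero_iff, ValuationSubring.valuation_lt_one_iff]
  rfl

theorem residue_eq_zero_iff_valuation (B : ValuationSubring L) (x : B) :
    residue B x = 0 ↔ B.valuation (x : L) < 1 := by
  rw [residue_eq_zero_iff, ValuationSubring.valuation_lt_one_iff]

theorem mem_of_valuation_sub_lt_one (B : ValuationSubring L) {x y : L} (hx : x ∈ B)
    (h : B.valuation (x - y) < 1) : y ∈ B := by
  have := B.toSubring.sub_mem hx ((B.valuation_le_one_iff _).1 h.le)
  rwa [sub_sub_cancel] at this

theorem residueSubfield_eq_top_iff (B : ValuationSubring L) :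
    residueSubfield K B = ⊤ ↔
      ∀ x ∈ B, ∃ c : K, B.valuation (x - algebraMap K L c) < 1 := by
  constructor
  · intro h x hx
    have : residue B ⟨x, hx⟩ ∈ residueSubfield K B := h ▸ Subfield.mem_top _
    obtain ⟨y, hy⟩ := this
    obtain ⟨c, rfl⟩ := residue_surjective y
    refine ⟨c, ?_⟩
    rw [residueMap, ResidueField.map_residue] at hy
    exact (residue_eq_residue_iff B ⟨x, hx⟩ (integerMap K B c)).1 hy.symm
  · intro h
    rw [eq_top_iff]
    rintro y -
    obtain ⟨⟨x, hx⟩, rfl⟩ := residue_surjective y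
    obtain ⟨c, hc⟩ := h x hx
    refine ⟨residue _ ⟨c, mem_of_valuation_sub_lt_one B hx hc⟩, ?_⟩
    rw [residueMap, ResidueField.map_residue]
    exact ((residue_eq_residue_iff B ⟨x, hx⟩ (integerMap K B ⟨c, _⟩)).2 hc).symm

theorem isImmediate_iff (B : ValuationSubring L) :
    IsImmediate K B ↔
      (∀ x : L, x ≠ 0 → ∃ c : K, B.valuation x = B.valuation (algebraMap K L c)) ∧
      ∀ x ∈ B, ∃ c : K, B.valuation (x - algebraMap K L c) < 1 := by
  rw [IsImmediate, valueSubgroup_eq_top_iff, residueSubfield_eq_top_iff]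

theorem inertiaDegree_eq_one (B : ValuationSubring L)
    (h : ∀ x ∈ B, ∃ n : ℕ, B.valuation (x - n) < 1) : inertiaDegree K B = 1 := by
  have htop : residueSubfield K B = ⊤ := (residueSubfield_eq_top_iff B).2 fun x hx => by
    obtain ⟨n, hn⟩ := h x hx
    exact ⟨n, by simpa using hn⟩
  rw [inertiaDegree, htop]
  rw [finrank_eq_one_iff']
  exact ⟨1, one_ne_zero, fun w => ⟨⟨w, Subfield.mem_top _⟩, mul_one w⟩⟩

/-- If `vL` is generated over `vK` by one element whose `p`-th power lies in `vK`, but which does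
not lie in `vK` itself, then `(vL : vK) = p`. -/
theorem ramificationIndex_eq_prime (B : ValuationSubring L) {p : ℕ} (hp : p.Prime) {a : L}
    (ha : a ≠ 0) {c₀ : K} (hc₀ : B.valuation a ^ p = B.valuation (algebraMap K L c₀))
    (hgen : ∀ x : L, x ≠ 0 → ∃ (c : K) (n : ℤ),
      B.valuation x = B.valuation (algebraMap K L c) * B.valuation a ^ n)
    (hnot : ∀ c : K, B.valuation a ≠ B.valuation (algebraMap K L c)) :
    ramificationIndex K B = p := by
  have hva : B.valuation a ≠ 0 := by simpa using ha
  set g : B.ValueGroupˣ := Units.mk0 _ hva with hg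
  have hfact : Fact p.Prime := ⟨hp⟩
  have hord : orderOf (QuotientGroup.mk g : B.ValueGroupˣ ⧸ valueSubgroup K B) = p := by
    refine orderOf_eq_prime ?_ ?_
    · rw [← QuotientGroup.mk_pow, QuotientGroup.eq_one_iff, mem_valueSubgroup_iff]
      exact ⟨c₀, by simpa [hg] using hc₀⟩
    · rw [Ne, QuotientGroup.eq_one_iff, mem_valueSubgroup_iff]
      rintro ⟨c, hc⟩
      exact hnot c hc
  rw [ramificationIndex, Subgroup.index, ← hord]
  refine (orderOf_eq_card_of_forall_mem_zpowers fun y => ?_).symm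
  obtain ⟨y, rfl⟩ := QuotientGroup.mk_surjective y
  obtain ⟨x, hx, hyx⟩ := exists_unit_valuation B y
  obtain ⟨c, n, hcn⟩ := hgen x hx
  refine ⟨n, ?_⟩
  change (QuotientGroup.mk g : B.ValueGroupˣ ⧸ valueSubgroup K B) ^ n = _
  rw [← QuotientGroup.mk_zpow, QuotientGroup.eq, mem_valueSubgroup_iff]
  refine ⟨c, ?_⟩
  rw [Units.val_mul, hyx, hcn, ← zpow_neg, Units.val_zpow_eq_zpow_val, hg, Units.val_mk0,
    zpow_neg, mul_comm, mul_assoc, mul_inv_cancel₀ (zpow_ne_zero n hva), mul_one]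

/-- A valuation ring is a discrete valuation ring if the value of one element of value `< 1`
generates the value group. -/
theorem isDiscreteValuationRing_of_zpow (A : ValuationSubring K) {t : K} (ht : A.valuation t < 1)
    (ht0 : t ≠ 0) (h : ∀ x : K, x ≠ 0 → ∃ n : ℤ, A.valuation x = A.valuation t ^ n) :
    IsDiscreteValuationRing A := by
  have htA : t ∈ A := (A.valuation_le_one_iff t).1 ht.le
  refine IsDiscreteValuationRing.ofHasUnitMulPowIrreducibleFactorization ⟨⟨t, htA⟩, ?_, ?_⟩
  · have hvt : A.valuation t ≠ 0 := by simpa using ht0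
    refine irreducible_iff.2 ⟨?_, ?_⟩
    · rw [ValuationSubring.valuation_eq_one_iff]
      exact ht.ne
    · rintro ⟨x, hx⟩ ⟨y, hy⟩ hxy
      have hxy' : t = x * y := congrArg Subtype.val hxy
      have hx0 : x ≠ 0 := by rintro rfl; exact ht0 (by simpa using hxy')
      have hy0 : y ≠ 0 := by rintro rfl; exact ht0 (by simpa using hxy')
      obtain ⟨m, hm⟩ := h x hx0
      obtain ⟨n, hn⟩ := h y hy0
      have hpos : 0 < A.valuation t := zero_lt_iff.2 hvt
      have hm0 : 0 ≤ m := by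
        by_contra hneg
        have h1 : A.valuation x ≤ 1 := (A.valuation_le_one_iff x).2 hx
        rw [hm] at h1
        exact absurd h1 (not_le.2 (one_lt_zpow_of_neg₀ hpos ht (not_le.1 hneg)))
      have hn0 : 0 ≤ n := by
        by_contra hneg
        have h1 : A.valuation y ≤ 1 := (A.valuation_le_one_iff y).2 hy
        rw [hn] at h1
        exact absurd h1 (not_le.2 (one_lt_zpow_of_neg₀ hpos ht (not_le.1 hneg)))
      have hsum : A.valuation t ^ (1 : ℤ) = A.valuation t ^ (m + n) := by
        rw [zpow_add₀ hvt, ← hm, ← hn, ← map_mul, ← hxy', zpow_one]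
      have : (1 : ℤ) = m + n := (zpow_right_injective₀ hpos ht.ne) hsum
      rw [ValuationSubring.valuation_eq_one_iff, ValuationSubring.valuation_eq_one_iff]
      rcases (by omega : m = 0 ∨ n = 0) with rfl | rfl
      · left; simpa using hm
      · right; simpa using hn
  · rintro ⟨x, hx⟩ hx0
    have hx0' : x ≠ 0 := fun h0 => hx0 (Subtype.ext h0)
    obtain ⟨n, hn⟩ := h x hx0'
    have hvt : A.valuation t ≠ 0 := by simpa using ht0
    have hpos : 0 < A.valuation t := zero_lt_iff.2 hvt
    have hn0 : 0 ≤ n := by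
      by_contra hneg
      have h1 : A.valuation x ≤ 1 := (A.valuation_le_one_iff x).2 hx
      rw [hn] at h1
      exact absurd h1 (not_le.2 (one_lt_zpow_of_neg₀ hpos ht (not_le.1 hneg)))
    obtain ⟨k, rfl⟩ := Int.eq_ofNat_of_zero_le hn0
    refine ⟨k, ?_⟩
    rw [zpow_natCast, ← map_pow, ValuationSubring.valuation_eq_iff] at hn
    obtain ⟨w, hw⟩ := hn
    refine ⟨w, Subtype.ext ?_⟩
    rw [mul_comm]
    exact hw

end Basic

/-- Every valuation of `K` extends to every extension field of `K` (Chevalley). -/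
theorem exists_restrict_eq {K L : Type*} [Field K] [Field L] [Algebra K L]
    (A : ValuationSubring K) : ∃ B : ValuationSubring L, restrict K B = A := by
  obtain ⟨B, hB, hloc⟩ := IsLocalRing.exists_factor_valuationRing ((algebraMap K L).comp A.subtype)
  refine ⟨B, le_antisymm (fun x hx => ?_) fun x hx => hB ⟨x, hx⟩⟩
  rcases A.mem_or_inv_mem x with h | h
  · exact h
  rcases eq_or_ne x 0 with rfl | hx0
  · exact A.zero_mem
  have hu : IsUnit (((algebraMap K L).comp A.subtype).codRestrict B.toSubring hB ⟨x⁻¹, h⟩) := by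
    refine IsUnit.of_mul_eq_one ⟨algebraMap K L x, hx⟩ (Subtype.ext ?_)
    change algebraMap K L x⁻¹ * algebraMap K L x = 1
    rw [← map_mul, inv_mul_cancel₀ hx0, map_one]
  obtain ⟨y, hy⟩ := (hloc.map_nonunit _ hu).exists_right_inv
  have hxy : x⁻¹ * (y : K) = 1 := congrArg Subtype.val hy
  have : (y : K) = x := by rw [← inv_inv x]; exact eq_inv_of_mul_eq_one_right hxy
  exact this ▸ y.2

section Coarsening

variable {K L : Type*} [Field K] [Field L] [Algebra K L]

/-- The coarsening of the valuation with ring `B` on `L` that is obtained by inverting the elements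
of `K` that lie in `B` and are units of `W`.  If the valuation with ring `W` is a coarsening of the
restriction of `B` to `K`, this is the corresponding coarsening of `B`. -/
def coarsening (W : ValuationSubring K) (B : ValuationSubring L) : ValuationSubring L :=
  ValuationSubring.ofLE B
    { carrier := {x | ∃ c : K, c ≠ 0 ∧ algebraMap K L c ∈ B ∧ c⁻¹ ∈ W ∧ x * algebraMap K L c ∈ B}
      zero_mem' := ⟨1, by simp [B.one_mem, W.one_mem, B.zero_mem]⟩
      one_mem' := ⟨1, by simp [B.one_mem, W.one_mem]⟩
      mul_mem' := by
        rintro x y ⟨c, hc0, hc, hcW, hx⟩ ⟨d, hd0, hd, hdW, hy⟩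
        refine ⟨c * d, mul_ne_zero hc0 hd0, ?_, ?_, ?_⟩
        · rw [map_mul]; exact B.mul_mem _ _ hc hd
        · rw [mul_inv]; exact W.mul_mem _ _ hcW hdW
        · rw [map_mul, mul_mul_mul_comm]; exact B.mul_mem _ _ hx hy
      add_mem' := by
        rintro x y ⟨c, hc0, hc, hcW, hx⟩ ⟨d, hd0, hd, hdW, hy⟩
        refine ⟨c * d, mul_ne_zero hc0 hd0, ?_, ?_, ?_⟩
        · rw [map_mul]; exact B.mul_mem _ _ hc hd
        · rw [mul_inv]; exact W.mul_mem _ _ hcW hdW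
        · rw [map_mul]
          have : (x + y) * (algebraMap K L c * algebraMap K L d) =
            x * algebraMap K L c * algebraMap K L d + y * algebraMap K L d * algebraMap K L c := by
            ring
          rw [this]
          exact B.add_mem _ _ (B.mul_mem _ _ hx hd) (B.mul_mem _ _ hy hc)
      neg_mem' := by
        rintro x ⟨c, hc0, hc, hcW, hx⟩
        exact ⟨c, hc0, hc, hcW, by rw [neg_mul]; exact B.neg_mem _ hx⟩ }
    fun x hx => ⟨1, by simpa [B.one_mem, W.one_mem] using hx⟩

theorem mem_coarsening {W : ValuationSubring K} {B : ValuationSubring L} {x : L} :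
    x ∈ coarsening W B ↔
      ∃ c : K, c ≠ 0 ∧ algebraMap K L c ∈ B ∧ c⁻¹ ∈ W ∧ x * algebraMap K L c ∈ B :=
  Iff.rfl

theorem le_coarsening (W : ValuationSubring K) (B : ValuationSubring L) : B ≤ coarsening W B :=
  fun x hx => mem_coarsening.2 ⟨1, by simpa [B.one_mem, W.one_mem] using hx⟩

theorem restrict_coarsening {W : ValuationSubring K} {B : ValuationSubring L}
    (h : restrict K B ≤ W) : restrict K (coarsening W B) = W := by
  ext x
  rw [ValuationSubring.mem_comap, mem_coarsening]
  constructor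
  · rintro ⟨c, hc0, -, hcW, hx⟩
    rw [← map_mul] at hx
    have := W.mul_mem _ _ (h hx) hcW
    rwa [mul_assoc, mul_inv_cancel₀ hc0, mul_one] at this
  · intro hx
    rcases (restrict K B).mem_or_inv_mem x with hxB | hxB
    · exact ⟨1, one_ne_zero, by simp [B.one_mem], by simp [W.one_mem],
        by simpa using hxB⟩
    · rcases eq_or_ne x 0 with rfl | hx0
      · exact ⟨1, by simp [B.one_mem, W.one_mem, B.zero_mem]⟩
      · refine ⟨x⁻¹, inv_ne_zero hx0, hxB, by rwa [inv_inv], ?_⟩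
        rw [← map_mul, mul_inv_cancel₀ hx0, map_one]
        exact B.one_mem

end Coarsening

section Composite

variable {L : Type*} [Field L]

theorem valuation_lt_one_of_le {A W : ValuationSubring L} (h : A ≤ W) {x : L}
    (hx : W.valuation x < 1) : A.valuation x < 1 :=
  (ValuationSubring.nonunits_le_nonunits.2 h) hx

theorem valuation_lt_of_le {A W : ValuationSubring L} (h : A ≤ W) {x y : L}
    (hx : W.valuation x < W.valuation y) : A.valuation x < A.valuation y := by
  have hy : y ≠ 0 := by rintro rfl; simp at hx
  have hyW : 0 < W.valuation y := zero_lt_iff.2 (by simpa using hy)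
  have hyA : 0 < A.valuation y := zero_lt_iff.2 (by simpa using hy)
  have := valuation_lt_one_of_le h (x := x / y) (by rwa [map_div₀, div_lt_one₀ hyW])
  rwa [map_div₀, div_lt_one₀ hyA] at this

theorem valuation_eq_of_le {A W : ValuationSubring L} (h : A ≤ W) {x y : L}
    (hxy : A.valuation x = A.valuation y) : W.valuation x = W.valuation y := by
  refine le_antisymm ?_ ?_ <;> refine not_lt.1 fun hlt => ?_
  · exact (valuation_lt_of_le h hlt).ne' hxy
  · exact (valuation_lt_of_le h hlt).ne hxy

theorem composite_le (W : ValuationSubring L) (A₀ : ValuationSubring (ResidueField W)) :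
    composite W A₀ ≤ W := fun _ hx => (mem_composite.1 hx).1

theorem exists_inv_of_residue_ne_zero {W : ValuationSubring L} {y : W} (hy : residue W y ≠ 0) :
    ∃ h : (y : L)⁻¹ ∈ W, residue W ⟨(y : L)⁻¹, h⟩ = (residue W y)⁻¹ := by
  have hv : W.valuation (y : L) = 1 :=
    le_antisymm (W.valuation_le_one y)
      (not_lt.1 fun h => hy ((residue_eq_zero_iff_valuation W y).2 h))
  have hinv : (y : L)⁻¹ ∈ W := by
    rw [← ValuationSubring.valuation_le_one_iff, map_inv₀, hv, inv_one]
  have hy0 : (y : L) ≠ 0 := by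
    intro h0
    rw [h0, map_zero] at hv
    exact zero_ne_one hv
  refine ⟨hinv, eq_inv_of_mul_eq_one_right ?_⟩
  rw [← map_mul, ← map_one (residue W)]
  exact congrArg _ (Subtype.ext (mul_inv_cancel₀ hy0))

theorem composite_valuation_le_iff {W : ValuationSubring L}
    {A₀ : ValuationSubring (ResidueField W)} (x : W) {y : W} (hy : residue W y ≠ 0) :
    (composite W A₀).valuation (x : L) ≤ (composite W A₀).valuation (y : L) ↔
      A₀.valuation (residue W x) ≤ A₀.valuation (residue W y) := by
  have hy0 : (y : L) ≠ 0 := by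
    rintro h0
    exact hy (by rw [show y = 0 from Subtype.ext h0, map_zero])
  obtain ⟨hinv, hres⟩ := exists_inv_of_residue_ne_zero hy
  have hmul : residue W (x * ⟨(y : L)⁻¹, hinv⟩) = residue W x / residue W y := by
    rw [map_mul, hres, div_eq_mul_inv]
  rw [← div_le_one₀ (zero_lt_iff.2 (by simpa using hy0)), ← map_div₀,
    ← div_le_one₀ (a := A₀.valuation (residue W x)) (zero_lt_iff.2 (by simpa using hy)), ← map_div₀,
    ValuationSubring.valuation_le_one_iff, ValuationSubring.valuation_le_one_iff, mem_composite,
    ← hmul, div_eq_mul_inv]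
  exact ⟨fun ⟨_, h⟩ => h, fun h => ⟨(x * ⟨(y : L)⁻¹, hinv⟩).2, h⟩⟩

theorem composite_valuation_eq_iff {W : ValuationSubring L}
    {A₀ : ValuationSubring (ResidueField W)} {x y : W} (hx : residue W x ≠ 0)
    (hy : residue W y ≠ 0) :
    (composite W A₀).valuation (x : L) = (composite W A₀).valuation (y : L) ↔
      A₀.valuation (residue W x) = A₀.valuation (residue W y) := by
  rw [le_antisymm_iff, le_antisymm_iff, composite_valuation_le_iff x hy,
    composite_valuation_le_iff y hx]

theorem composite_valuation_lt_one_iff {W : ValuationSubring L}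
    {A₀ : ValuationSubring (ResidueField W)} (x : W) :
    (composite W A₀).valuation (x : L) < 1 ↔ A₀.valuation (residue W x) < 1 := by
  by_cases hx : residue W x = 0
  · rw [hx, map_zero]
    refine ⟨fun _ => zero_lt_one, fun _ => ?_⟩
    exact valuation_lt_one_of_le (composite_le W A₀) ((residue_eq_zero_iff_valuation W x).1 hx)
  · have := (composite_valuation_le_iff (A₀ := A₀) (1 : W) hx).not
    simpa using this

end Composite

end ValuedField

/-! ### Uniformizers -/

namespace ValuedField

open IsLocalRing

section Uniformizer

variable {K : Type*} [Field K]

/-- `ϖ` is a uniformizer: a nonzero element of value `< 1` whose powers represent all values. -/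
structure IsUniformizer (A : ValuationSubring K) (ϖ : K) : Prop where
  ne_zero : ϖ ≠ 0
  lt_one : A.valuation ϖ < 1
  exists_zpow : ∀ x : K, x ≠ 0 → ∃ n : ℤ, A.valuation x = A.valuation ϖ ^ n

namespace IsUniformizer

variable {A : ValuationSubring K} {ϖ : K} (h : IsUniformizer A ϖ)
include h

theorem mem : ϖ ∈ A := (A.valuation_le_one_iff ϖ).1 h.lt_one.le

theorem valuation_ne_zero : A.valuation ϖ ≠ 0 := by simpa using h.ne_zero

theorem valuation_pos : 0 < A.valuation ϖ := zero_lt_iff.2 h.valuation_ne_zero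

theorem le_of_lt_one {x : K} (hx : A.valuation x < 1) : A.valuation x ≤ A.valuation ϖ := by
  rcases eq_or_ne x 0 with rfl | hx0
  · simp
  obtain ⟨n, hn⟩ := h.exists_zpow x hx0
  have h1 : 1 ≤ n := by
    by_contra hlt
    rw [hn] at hx
    exact absurd hx (not_lt.2 (one_le_zpow_of_nonpos₀ h.valuation_pos h.lt_one.le (by omega)))
  calc A.valuation x = A.valuation ϖ ^ n := hn
    _ ≤ A.valuation ϖ ^ (1 : ℤ) := zpow_le_zpow_right_of_le_one₀ h.valuation_pos h.lt_one.le h1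
    _ = A.valuation ϖ := zpow_one _

theorem le_mul_of_lt {x y : K} (hy : y ≠ 0) (hxy : A.valuation x < A.valuation y) :
    A.valuation x ≤ A.valuation ϖ * A.valuation y := by
  have hy' : 0 < A.valuation y := zero_lt_iff.2 (by simpa using hy)
  rw [← div_le_iff₀ hy', ← map_div₀]
  exact h.le_of_lt_one (by rwa [map_div₀, div_lt_one₀ hy'])

theorem exists_pow {x : K} (hx : x ∈ A) (hx0 : x ≠ 0) :
    ∃ n : ℕ, A.valuation x = A.valuation ϖ ^ n := by
  obtain ⟨n, hn⟩ := h.exists_zpow x hx0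
  have hn0 : 0 ≤ n := by
    by_contra hneg
    have h1 : A.valuation x ≤ 1 := (A.valuation_le_one_iff x).2 hx
    rw [hn] at h1
    exact absurd h1 (not_le.2 (one_lt_zpow_of_neg₀ h.valuation_pos h.lt_one (not_le.1 hneg)))
  obtain ⟨k, rfl⟩ := Int.eq_ofNat_of_zero_le hn0
  exact ⟨k, by simpa using hn⟩

theorem isDiscreteValuationRing : IsDiscreteValuationRing A :=
  isDiscreteValuationRing_of_zpow A h.lt_one h.ne_zero h.exists_zpow

theorem mem_maximalIdeal_pow_iff (n : ℕ) (x : A) :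
    x ∈ maximalIdeal A ^ n ↔ A.valuation (x : K) ≤ A.valuation ϖ ^ n := by
  have hspan : maximalIdeal A = Ideal.span {(⟨ϖ, h.mem⟩ : A)} := by
    ext y
    rw [ValuationSubring.valuation_lt_one_iff, Ideal.mem_span_singleton']
    constructor
    · intro hy
      obtain ⟨a, ha⟩ := (A.valuation_le_iff _ _).1 (h.le_of_lt_one hy)
      exact ⟨a, Subtype.ext ha⟩
    · rintro ⟨a, rfl⟩
      have := mul_le_mul_left (A.valuation_le_one a) (A.valuation ϖ)
      calc A.valuation ((a * ⟨ϖ, h.mem⟩ : A) : K) = A.valuation (a : K) * A.valuation ϖ :=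
            map_mul _ _ _
        _ ≤ 1 * A.valuation ϖ := this
        _ < 1 := by rw [one_mul]; exact h.lt_one
  rw [hspan, Ideal.span_singleton_pow, Ideal.mem_span_singleton', ← map_pow,
    ValuationSubring.valuation_le_iff]
  exact exists_congr fun a => ⟨fun ha => congrArg Subtype.val ha, fun ha => Subtype.ext ha⟩

end IsUniformizer

theorem isUniformizer_of_irreducible (A : ValuationSubring K) [IsDiscreteValuationRing A] {ϖ : A}
    (hϖ : Irreducible ϖ) : IsUniformizer A (ϖ : K) := by
  have hlt : A.valuation (ϖ : K) < 1 :=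
    (A.valuation_lt_one_iff ϖ).1 ((mem_maximalIdeal _).2 hϖ.not_isUnit)
  have key : ∀ x : A, x ≠ 0 → ∃ n : ℕ, A.valuation (x : K) = A.valuation (ϖ : K) ^ n := by
    intro x hx
    obtain ⟨n, u, hu⟩ := IsDiscreteValuationRing.eq_unit_mul_pow_irreducible hx hϖ
    refine ⟨n, ?_⟩
    rw [hu, ← map_pow, ValuationSubring.valuation_eq_iff]
    exact ⟨u, rfl⟩
  refine ⟨fun h0 => hϖ.ne_zero (Subtype.ext h0), hlt, fun x hx => ?_⟩
  rcases A.mem_or_inv_mem x with h | h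
  · obtain ⟨n, hn⟩ := key ⟨x, h⟩ (fun h0 => hx (congrArg Subtype.val h0))
    exact ⟨n, by simpa using hn⟩
  · obtain ⟨n, hn⟩ := key ⟨x⁻¹, h⟩ (fun h0 => inv_ne_zero hx (congrArg Subtype.val h0))
    refine ⟨-n, ?_⟩
    rw [zpow_neg, zpow_natCast, ← hn]
    simp

theorem exists_isUniformizer (A : ValuationSubring K) [IsDiscreteValuationRing A] :
    ∃ ϖ : K, IsUniformizer A ϖ := by
  obtain ⟨ϖ, hϖ⟩ := IsDiscreteValuationRing.exists_irreducible A
  exact ⟨ϖ, isUniformizer_of_irreducible A hϖ⟩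

end Uniformizer

section Scaling

variable {K L : Type*} [Field K] [Field L] [Algebra K L]

/-- A nonzero finite family of scalars can be divided by one of its members so that the quotients
are integral. -/
theorem exists_max_valuation (A : ValuationSubring K) {ι : Type*} (s : Finset ι) (g : ι → K)
    (hg : ∃ i ∈ s, g i ≠ 0) : ∃ i₀ ∈ s, g i₀ ≠ 0 ∧ ∀ i ∈ s, g i / g i₀ ∈ A := by
  obtain ⟨j, hj, hj0⟩ := hg
  obtain ⟨i₀, hi₀, hmax⟩ := s.exists_max_image (fun i => A.valuation (g i)) ⟨j, hj⟩
  have hpos : 0 < A.valuation (g i₀) :=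
    lt_of_lt_of_le (zero_lt_iff.2 (by simpa using hj0)) (hmax j hj)
  refine ⟨i₀, hi₀, fun h0 => hpos.ne' (by simp [h0]), fun i hi => ?_⟩
  rw [← ValuationSubring.valuation_le_one_iff, map_div₀, div_le_one₀ hpos]
  exact hmax i hi

/-- A nonzero element that is algebraic over `K` is bounded below by an element of `K`. -/
theorem exists_valuation_le (B : ValuationSubring L) {x : L} (hx : x ≠ 0)
    (halg : IsAlgebraic K x) :
    ∃ c : K, c ≠ 0 ∧ B.valuation (algebraMap K L c) ≤ B.valuation x := by
  by_contra! hcon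
  have hx1 : B.valuation x ≤ 1 := by simpa using (hcon 1 one_ne_zero).le
  set f := minpoly K x with hf
  have hint : IsIntegral K x := halg.isIntegral
  have h0 : f.coeff 0 ≠ 0 := minpoly.coeff_zero_ne_zero hint hx
  have h00 : B.valuation (algebraMap K L (f.coeff 0)) ≠ 0 := by simpa using h0
  have hsum : Polynomial.aeval x f = 0 := minpoly.aeval K x
  rw [Polynomial.aeval_eq_sum_range, Finset.sum_range_succ', pow_zero,
    ← Algebra.algebraMap_eq_smul_one, add_eq_zero_iff_eq_neg'] at hsum
  have hlt : B.valuation (∑ k ∈ Finset.range f.natDegree, f.coeff (k + 1) • x ^ (k + 1)) <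
      B.valuation (algebraMap K L (f.coeff 0)) := by
    refine B.valuation.map_sum_lt h00 fun k _ => ?_
    rcases eq_or_ne (f.coeff (k + 1)) 0 with hk | hk
    · rw [hk, zero_smul, map_zero]
      exact zero_lt_iff.2 h00
    · have hlt := hcon (f.coeff 0 / f.coeff (k + 1)) (div_ne_zero h0 hk)
      have hk' : 0 < B.valuation (algebraMap K L (f.coeff (k + 1))) :=
        zero_lt_iff.2 (by simpa using hk)
      rw [map_div₀, map_div₀, lt_div_iff₀ hk'] at hlt
      rw [Algebra.smul_def, map_mul, map_pow, mul_comm]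
      refine lt_of_le_of_lt ?_ hlt
      refine mul_le_mul_left ?_ _
      rw [pow_succ]
      exact mul_le_of_le_one_left' (pow_le_one₀ zero_le hx1)
  rw [hsum, Valuation.map_neg] at hlt
  exact lt_irrefl _ hlt

end Scaling

theorem isPrecomplete_pi {R ι : Type*} [CommRing R] [Finite ι] (I : Ideal R)
    [IsPrecomplete I R] : IsPrecomplete I (ι → R) := by
  cases nonempty_fintype ι
  classical
  refine ⟨fun f hf => ?_⟩
  have hcomp : ∀ i, ∃ l : R, ∀ n, f n i ≡ l [SMOD (I ^ n • ⊤ : Submodule R R)] := by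
    intro i
    refine IsPrecomplete.prec inferInstance (f := fun n => f n i) fun {m n} hmn => ?_
    have := hf hmn
    rw [SModEq.sub_mem] at this ⊢
    exact Submodule.smul_top_le_comap_smul_top (I ^ m) (LinearMap.proj i : (ι → R) →ₗ[R] R) this
  choose l hl using hcomp
  refine ⟨l, fun n => ?_⟩
  rw [SModEq.sub_mem]
  have : f n - l = ∑ i, (f n i - l i) • (Pi.single i 1 : ι → R) :=
    pi_eq_sum_univ' (f n - l)
  rw [this]
  refine Submodule.sum_mem _ fun i _ => Submodule.smul_mem_smul ?_ Submodule.mem_top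
  have := hl i n
  rwa [SModEq.sub_mem, smul_eq_mul, Ideal.mul_top] at this

end ValuedField

/-! ### Complete discrete valuations are henselian -/

namespace ValuedField

open IsLocalRing

section Complete

variable {K L : Type*} [Field K] [Field L] [Algebra K L]

/-- The valuation ring of `L` as an algebra over that of `K`. -/
noncomputable abbrev integerAlgebra (B : ValuationSubring L) : Algebra (restrict K B) B :=
  (integerMap K B).toAlgebra

theorem eq_zero_of_forall_valuation_le (B : ValuationSubring L) {ϖ : K}
    (hϖ : IsUniformizer (restrict K B) ϖ) {x : L} (halg : IsAlgebraic K x)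
    (h : ∀ n : ℕ, B.valuation x ≤ B.valuation (algebraMap K L ϖ) ^ n) : x = 0 := by
  by_contra hx
  obtain ⟨c, hc0, hc⟩ := exists_valuation_le B hx halg
  have hcB : c ∈ restrict K B := by
    rw [ValuationSubring.mem_comap, ← ValuationSubring.valuation_le_one_iff]
    exact hc.trans (by simpa using h 0)
  obtain ⟨n, hn⟩ := hϖ.exists_pow hcB hc0
  have h1 := hc.trans (h (n + 1))
  rw [← map_pow, ← map_pow, ← valuation_restrict_le_iff, hn, map_pow, pow_succ] at h1
  have hpos : 0 < (restrict K B).valuation ϖ ^ n := pow_pos hϖ.valuation_pos n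
  exact absurd h1 (not_le.2 (mul_lt_of_lt_one_right hpos hϖ.lt_one))

/-- Over a complete discrete valuation ring, finitely many elements which generate modulo the
uniformizer generate. -/
theorem exists_eq_sum_of_approx (B : ValuationSubring L) {ϖ : K}
    (hϖ : IsUniformizer (restrict K B) ϖ)
    [IsAdicComplete (maximalIdeal (restrict K B)) (restrict K B)]
    [Algebra.IsAlgebraic K L] {ι : Type*} [Fintype ι] {y : ι → L} (hy : ∀ i, y i ∈ B)
    (h : ∀ b ∈ B, ∃ c : ι → K, (∀ i, algebraMap K L (c i) ∈ B) ∧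
      B.valuation (b - ∑ i, algebraMap K L (c i) * y i) ≤ B.valuation (algebraMap K L ϖ))
    {b : L} (hb : b ∈ B) :
    ∃ c : ι → K, (∀ i, algebraMap K L (c i) ∈ B) ∧ b = ∑ i, algebraMap K L (c i) * y i := by
  let := integerAlgebra (K := K) B
  have := isPrecomplete_pi (ι := ι) (maximalIdeal (restrict K B))
  let f : (ι → restrict K B) →ₗ[restrict K B] B :=
    Fintype.linearCombination (restrict K B) fun i => ⟨y i, hy i⟩
  have hf : ∀ c : ι → restrict K B,
      ((f c : B) : L) = ∑ i, algebraMap K L (c i) * y i := by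
    intro c
    rw [Fintype.linearCombination_apply, ← B.subtype_apply, map_sum]
    rfl
  have hH : IsHausdorff (maximalIdeal (restrict K B)) B := by
    refine ⟨fun x hx => Subtype.ext (eq_zero_of_forall_valuation_le B hϖ
      (Algebra.IsAlgebraic.isAlgebraic (x : L)) fun n => ?_)⟩
    have hx' := hx n
    rw [SModEq.zero] at hx'
    refine Submodule.smul_induction_on hx' (fun r hr z _ => ?_) fun z w hz hw => ?_
    · have hz : ((r • z : B) : L) = algebraMap K L r * z := rfl
      rw [hϖ.mem_maximalIdeal_pow_iff, ← map_pow, valuation_restrict_le_iff, map_pow,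
        map_pow] at hr
      rw [hz, map_mul]
      calc _ ≤ B.valuation (algebraMap K L ϖ) ^ n * 1 :=
            mul_le_mul' hr (B.valuation_le_one z)
        _ = _ := mul_one _
    · exact (B.valuation.map_add _ _).trans (max_le hz hw)
  have hsurj : Function.Surjective f := by
    refine surjective_of_mkQ_comp_surjective (I := maximalIdeal (restrict K B)) fun q => ?_
    obtain ⟨b, rfl⟩ := Submodule.mkQ_surjective _ q
    obtain ⟨c, hc, hcb⟩ := h b b.2
    refine ⟨fun i => ⟨c i, hc i⟩, ?_⟩
    rw [LinearMap.comp_apply, Submodule.mkQ_apply, Submodule.mkQ_apply, eq_comm,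
      Submodule.Quotient.eq]
    obtain ⟨a, ha⟩ := (B.valuation_le_iff _ _).1 hcb
    have : b - f (fun i => ⟨c i, hc i⟩) = (⟨ϖ, hϖ.mem⟩ : restrict K B) • a := by
      refine Subtype.ext ?_
      change (b : L) - ((f fun i => ⟨c i, hc i⟩ : B) : L) = algebraMap K L ϖ * a
      rw [hf, ← ha, mul_comm]
    rw [this]
    refine Submodule.smul_mem_smul ?_ Submodule.mem_top
    rw [ValuationSubring.valuation_lt_one_iff]
    exact hϖ.lt_one
  obtain ⟨c, hc⟩ := hsurj ⟨b, hb⟩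
  exact ⟨fun i => c i, fun i => (c i).2, by rw [← hf, hc]⟩

/-- Lifts of elements which are linearly independent modulo the uniformizer are linearly
independent. -/
theorem linearIndependent_of_forall_valuation (B : ValuationSubring L) {ι : Type*} [Fintype ι]
    {y : ι → L}
    (h : ∀ c : ι → K, (∀ i, algebraMap K L (c i) ∈ B) → ∑ i, algebraMap K L (c i) * y i = 0 →
      ∀ i, B.valuation (algebraMap K L (c i)) < 1) : LinearIndependent K y := by
  rw [Fintype.linearIndependent_iff]
  intro g hg
  by_contra! hne
  obtain ⟨j, hj⟩ := hne
  obtain ⟨i₀, -, hi₀, hdiv⟩ := exists_max_valuation (restrict K B) Finset.univ g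
    ⟨j, Finset.mem_univ j, hj⟩
  have := h (fun i => g i / g i₀) (fun i => hdiv i (Finset.mem_univ i)) ?_ i₀
  · simp [hi₀] at this
  · have h1 : ∀ i, algebraMap K L (g i / g i₀) * y i =
        algebraMap K L (g i₀)⁻¹ * (g i • y i) := by
      intro i
      rw [Algebra.smul_def, ← mul_assoc, ← map_mul, div_eq_inv_mul]
    rw [Finset.sum_congr rfl fun i _ => h1 i, ← Finset.mul_sum, hg, mul_zero]

/-- The valuation ring of a finite extension of a complete discretely valued field is generated by
finitely many elements as a module. -/
theorem exists_finite_generators (B : ValuationSubring L)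
    [IsDiscreteValuationRing (restrict K B)]
    [IsAdicComplete (maximalIdeal (restrict K B)) (restrict K B)]
    [FiniteDimensional K L] :
    ∃ (k : ℕ) (y : Fin k → L), (∀ i, y i ∈ B) ∧ ∀ b ∈ B, ∃ c : Fin k → K,
      (∀ i, algebraMap K L (c i) ∈ B) ∧ b = ∑ i, algebraMap K L (c i) * y i := by
  obtain ⟨ϖ, hϖ⟩ := exists_isUniformizer (restrict K B)
  -- A family of maximal length among those which are linearly independent modulo `ϖ`.
  let P : ℕ → Prop := fun k => ∃ y : Fin k → L, (∀ i, y i ∈ B) ∧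
    ∀ c : Fin k → K, (∀ i, algebraMap K L (c i) ∈ B) →
      B.valuation (∑ i, algebraMap K L (c i) * y i) ≤ B.valuation (algebraMap K L ϖ) →
      ∀ i, B.valuation (algebraMap K L (c i)) < 1
  have hP0 : P 0 := ⟨Fin.elim0, fun i => i.elim0, fun _ _ _ i => i.elim0⟩
  have hbound : ∀ k, P k → k ≤ Module.finrank K L := by
    rintro k ⟨y, hyB, hy⟩
    have := (linearIndependent_of_forall_valuation (K := K) B (y := y) fun c hc h0 =>
      hy c hc (by rw [h0, map_zero]; exact zero_le)).fintype_card_le_finrank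
    simpa using this
  obtain ⟨k, hk, hk1⟩ : ∃ k, P k ∧ ¬ P (k + 1) := by
    by_contra! hcon
    have hall : ∀ k, P k := fun k => Nat.rec hP0 (fun n hn => hcon n hn) k
    have := hbound _ (hall (Module.finrank K L + 1))
    omega
  obtain ⟨y, hyB, hy⟩ := hk
  refine ⟨k, y, hyB, fun b hb => exists_eq_sum_of_approx B hϖ hyB (fun b hb => ?_) hb⟩
  have hnot : ¬ ∀ c : Fin (k + 1) → K, (∀ i, algebraMap K L (c i) ∈ B) →
      B.valuation (∑ i, algebraMap K L (c i) * (Fin.cons b y : Fin (k + 1) → L) i) ≤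
        B.valuation (algebraMap K L ϖ) →
      ∀ i, B.valuation (algebraMap K L (c i)) < 1 := fun hall =>
    hk1 ⟨Fin.cons b y, fun i => Fin.cases hb hyB i, hall⟩
  push Not at hnot
  obtain ⟨c, hc, hsum, i, hi⟩ := hnot
  simp only [Fin.sum_univ_succ, Fin.cons_zero, Fin.cons_succ] at hsum
  -- By maximality the enlarged family `b, y` is dependent modulo `ϖ`; the independence of `y`
  -- makes the coefficient of `b` a unit, so that `b` can be solved for modulo `ϖ`.
  have hc0 : B.valuation (algebraMap K L (c 0)) = 1 := by
    refine le_antisymm ((B.valuation_le_one_iff _).2 (hc 0)) (not_lt.1 fun hlt => ?_)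
    have hlt' : B.valuation (algebraMap K L (c 0)) ≤ B.valuation (algebraMap K L ϖ) := by
      rw [← valuation_restrict_le_iff]
      exact hϖ.le_of_lt_one ((valuation_restrict_lt_one_iff B _).2 hlt)
    have h1 : B.valuation (algebraMap K L (c 0) * b) ≤ B.valuation (algebraMap K L ϖ) := by
      rw [map_mul]
      exact (mul_le_of_le_one_right' ((B.valuation_le_one_iff b).2 hb)).trans hlt'
    have h2 := hy (fun i => c i.succ) (fun i => hc _) (by
      have := (B.valuation.map_sub _ _).trans (max_le hsum h1)
      rwa [add_sub_cancel_left] at this)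
    refine absurd hi (not_le.2 ?_)
    exact Fin.cases hlt h2 i
  have hc0' : algebraMap K L (c 0) ≠ 0 := by
    intro h0
    rw [h0, map_zero] at hc0
    exact zero_ne_one hc0
  refine ⟨fun i => -(c i.succ / c 0), fun i => ?_, ?_⟩
  · rw [map_neg, map_div₀]
    refine B.neg_mem _ ?_
    rw [← ValuationSubring.valuation_le_one_iff, map_div₀, hc0, div_one,
      ValuationSubring.valuation_le_one_iff]
    exact hc _
  · have hrw : b - ∑ i : Fin k, algebraMap K L (-(c i.succ / c 0)) * y i =
        (algebraMap K L (c 0))⁻¹ *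
          (algebraMap K L (c 0) * b + ∑ i : Fin k, algebraMap K L (c i.succ) * y i) := by
      rw [mul_add, inv_mul_cancel_left₀ hc0', Finset.mul_sum, sub_eq_add_neg,
        ← Finset.sum_neg_distrib]
      congr 1
      refine Finset.sum_congr rfl fun i _ => ?_
      rw [map_neg, map_div₀]
      ring
    rw [hrw, map_mul, map_inv₀, hc0, inv_one, one_mul]
    exact hsum

theorem module_finite_integer (B : ValuationSubring L)
    [IsDiscreteValuationRing (restrict K B)]
    [IsAdicComplete (maximalIdeal (restrict K B)) (restrict K B)]
    [FiniteDimensional K L] :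
    letI := integerAlgebra (K := K) B
    Module.Finite (restrict K B) B := by
  let := integerAlgebra (K := K) B
  obtain ⟨k, y, hy, h⟩ := exists_finite_generators (K := K) B
  refine Module.Finite.of_surjective
    (Fintype.linearCombination (restrict K B) fun i : Fin k => (⟨y i, hy i⟩ : B)) fun b => ?_
  obtain ⟨c, hc, hb⟩ := h b b.2
  refine ⟨fun i => ⟨c i, hc i⟩, Subtype.ext ?_⟩
  rw [hb, Fintype.linearCombination_apply, ← B.subtype_apply, map_sum]
  rfl

theorem mem_of_isIntegralElem (B : ValuationSubring L) {x : L}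
    (hx : ((algebraMap K L).comp (restrict K B).subtype).IsIntegralElem x) : x ∈ B := by
  obtain ⟨f, hf, hfx⟩ := hx
  have hint : IsIntegral B x := by
    refine ⟨f.map (integerMap K B), hf.map _, ?_⟩
    rw [Polynomial.eval₂_map]
    exact hfx
  obtain ⟨y, rfl⟩ := IsIntegrallyClosed.isIntegral_iff.1 hint
  exact y.2

/-- The valuation ring of an algebraic extension of a complete discretely valued field is integral
over that of the base field. -/
theorem isIntegralElem_of_mem (B : ValuationSubring L)
    [IsDiscreteValuationRing (restrict K B)]
    [IsAdicComplete (maximalIdeal (restrict K B)) (restrict K B)]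
    [Algebra.IsAlgebraic K L] {x : L} (hx : x ∈ B) :
    ((algebraMap K L).comp (restrict K B).subtype).IsIntegralElem x := by
  have hfin : FiniteDimensional K (IntermediateField.adjoin K {x}) :=
    IntermediateField.adjoin.finiteDimensional (Algebra.IsAlgebraic.isAlgebraic x).isIntegral
  -- The integrality of the valuation ring is known for finite extensions, so pass to `K(x)`.
  let F := IntermediateField.adjoin K {x}
  let B' : ValuationSubring F := restrict F B
  have hDVR : IsDiscreteValuationRing (restrict K B') := ‹IsDiscreteValuationRing (restrict K B)›
  have hcomp : IsAdicComplete (maximalIdeal (restrict K B')) (restrict K B') :=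
    ‹IsAdicComplete (maximalIdeal (restrict K B)) (restrict K B)›
  let := integerAlgebra (K := K) B'
  have hMF : Module.Finite (restrict K B') B' := module_finite_integer B'
  have hxF : x ∈ F := IntermediateField.mem_adjoin_simple_self K x
  obtain ⟨f, hf, hfx⟩ := Algebra.IsIntegral.isIntegral (R := restrict K B') (⟨⟨x, hxF⟩, hx⟩ : B')
  refine ⟨f, hf, ?_⟩
  have := congrArg ((algebraMap F L).comp B'.subtype) hfx
  rw [Polynomial.hom_eval₂, map_zero] at this
  exact this

/-- A complete discrete valuation extends uniquely to algebraic extensions: the ring of every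
extension is the integral closure of the valuation ring of the base field. -/
theorem isUnibranched_of_isAdicComplete (A : ValuationSubring K) [IsDiscreteValuationRing A]
    [IsAdicComplete (maximalIdeal A) A] (L : Type*) [Field L] [Algebra K L]
    [Algebra.IsAlgebraic K L] : IsUnibranched A L := by
  obtain ⟨B, hB⟩ := exists_restrict_eq (L := L) A
  subst hB
  refine ⟨B, rfl, fun B' hB' => ?_⟩
  have h1 : IsDiscreteValuationRing (restrict K B') := by rw [hB']; infer_instance
  have h2 : IsAdicComplete (maximalIdeal (restrict K B')) (restrict K B') := by
    rw [hB']; infer_instance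
  refine le_antisymm (fun x hx => mem_of_isIntegralElem (K := K) B ?_)
    fun x hx => mem_of_isIntegralElem (K := K) B' ?_
  · rw [← hB']
    exact isIntegralElem_of_mem B' hx
  · rw [hB']
    exact isIntegralElem_of_mem B hx

theorem isHenselian_of_isAdicComplete {K : Type*} [Field K] (A : ValuationSubring K)
    [IsDiscreteValuationRing A] [IsAdicComplete (maximalIdeal A) A] : IsHenselian A :=
  fun L _ _ _ => isUnibranched_of_isAdicComplete A L

end Complete

end ValuedField

/-! ### Complete discrete valuations are defectless -/

namespace ValuedField

open IsLocalRing

section Fundamental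

variable {K L : Type*} [Field K] [Field L] [Algebra K L]

/-- A combination of elements with linearly independent residues has the value of one of its largest
coefficients. -/
theorem exists_valuation_sum_eq (B : ValuationSubring L) {ι : Type*} {u : ι → B}
    (hu : LinearIndependent (residueSubfield K B) fun i => residue B (u i)) (s : Finset ι)
    (c : ι → K) (hc : ∃ i ∈ s, c i ≠ 0) :
    ∃ d : K, d ≠ 0 ∧ B.valuation (∑ i ∈ s, algebraMap K L (c i) * u i) =
      B.valuation (algebraMap K L d) := by
  classical
  obtain ⟨i₀, hi₀, hne, hdiv⟩ := exists_max_valuation (restrict K B) s c hc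
  refine ⟨c i₀, hne, ?_⟩
  let a : ι → restrict K B := fun i => if h : i ∈ s then ⟨c i / c i₀, hdiv i h⟩ else 0
  have ha : ∀ i ∈ s, ((a i : restrict K B) : K) = c i / c i₀ := by
    intro i hi
    simp only [a, dif_pos hi]
  let z : B := ∑ i ∈ s, integerMap K B (a i) * u i
  have hz : ∑ i ∈ s, algebraMap K L (c i) * u i = algebraMap K L (c i₀) * z := by
    rw [← B.subtype_apply z, map_sum, Finset.mul_sum]
    refine Finset.sum_congr rfl fun i hi => ?_
    change _ = algebraMap K L (c i₀) * (algebraMap K L (a i) * u i)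
    rw [ha i hi, ← mul_assoc, ← map_mul, mul_div_cancel₀ _ hne]
  suffices h1 : B.valuation (z : L) = 1 by rw [hz, map_mul, h1, mul_one]
  refine le_antisymm (B.valuation_le_one z) (not_lt.1 fun hlt => ?_)
  rw [← residue_eq_zero_iff_valuation, map_sum] at hlt
  let f : ι → residueSubfield K B := fun i => ⟨residueMap K B (residue _ (a i)), ⟨_, rfl⟩⟩
  have hsum : ∑ i ∈ s, f i • residue B (u i) = 0 := by
    rw [← hlt]
    refine Finset.sum_congr rfl fun i _ => ?_
    rw [map_mul, ← ResidueField.map_residue]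
    rfl
  have h0 := congrArg Subtype.val (linearIndependent_iff'.1 hu s f hsum i₀ hi₀)
  have h1 : a i₀ = 1 := Subtype.ext (by rw [ha i₀ hi₀, div_self hne]; rfl)
  change residueMap K B (residue _ (a i₀)) = 0 at h0
  rw [h1, map_one, map_one] at h0
  exact one_ne_zero h0

/-- Products of lifts of a residue basis with representatives of the cosets of the value group are
linearly independent. -/
theorem linearIndependent_mul (B : ValuationSubring L) {ι Q : Type*} {u : ι → B}
    (hu : LinearIndependent (residueSubfield K B) fun i => residue B (u i)) {g : Q → L}
    (hg0 : ∀ q, g q ≠ 0)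
    (hg : ∀ (q q' : Q) (c c' : K), c ≠ 0 → c' ≠ 0 → B.valuation (algebraMap K L c) *
      B.valuation (g q) = B.valuation (algebraMap K L c') * B.valuation (g q') → q = q') :
    LinearIndependent K fun x : Q × ι => g x.1 * (u x.2 : L) := by
  classical
  rw [linearIndependent_iff']
  intro s c hsum
  by_contra! hne
  obtain ⟨⟨q₁, i₁⟩, hx, hcx⟩ := hne
  let c' : Q → ι → K := fun q i => if (q, i) ∈ s then c (q, i) else 0
  let s₁ := s.image Prod.fst
  let s₂ := s.image Prod.snd
  let y : Q → L := fun q => ∑ i ∈ s₂, algebraMap K L (c' q i) * u i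
  have hzero : ∑ q ∈ s₁, g q * y q = 0 := by
    rw [← hsum]
    simp only [y, Finset.mul_sum]
    rw [← Finset.sum_product']
    have hsub : s ⊆ s₁ ×ˢ s₂ := fun x hx =>
      Finset.mem_product.2 ⟨Finset.mem_image_of_mem _ hx, Finset.mem_image_of_mem _ hx⟩
    symm
    rw [← Finset.sum_subset hsub]
    · refine Finset.sum_congr rfl fun x hx => ?_
      simp only [c', Prod.mk.eta, if_pos hx, Algebra.smul_def]
      ring
    · intro x _ hx
      simp only [c', if_neg hx]
      simp
  have hval : ∀ q, y q ≠ 0 → ∃ d : K, d ≠ 0 ∧ B.valuation (y q) =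
      B.valuation (algebraMap K L d) := by
    intro q hq
    refine exists_valuation_sum_eq B hu s₂ (c' q) ?_
    by_contra! hall
    exact hq (Finset.sum_eq_zero fun i hi => by rw [hall i hi, map_zero, zero_mul])
  have hq₁s : q₁ ∈ s₁ := Finset.mem_image.2 ⟨_, hx, rfl⟩
  have hy₁ : y q₁ ≠ 0 := by
    obtain ⟨d, hd, hdv⟩ := exists_valuation_sum_eq B hu s₂ (c' q₁)
      ⟨i₁, Finset.mem_image.2 ⟨_, hx, rfl⟩, by simpa only [c', if_pos hx] using hcx⟩
    intro h0
    change B.valuation (y q₁) = _ at hdv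
    rw [h0, map_zero, eq_comm] at hdv
    exact hd (by simpa using hdv)
  obtain ⟨q₀, hq₀, hmax⟩ := s₁.exists_max_image (fun q => B.valuation (g q * y q)) ⟨q₁, hq₁s⟩
  have hpos : 0 < B.valuation (g q₀ * y q₀) :=
    lt_of_lt_of_le (zero_lt_iff.2 (by simpa using ⟨hg0 q₁, hy₁⟩)) (hmax q₁ hq₁s)
  have hy₀ : y q₀ ≠ 0 := by
    intro h0
    simp [h0] at hpos
  have hlt : ∀ q ∈ s₁ \ {q₀}, B.valuation (g q * y q) < B.valuation (g q₀ * y q₀) := by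
    intro q hq
    rw [Finset.mem_sdiff, Finset.mem_singleton] at hq
    rcases eq_or_ne (y q) 0 with h0 | h0
    · rw [h0, mul_zero, map_zero]
      exact hpos
    · refine lt_of_le_of_ne (hmax q hq.1) fun heq => hq.2 ?_
      obtain ⟨d, hd, hdv⟩ := hval q h0
      obtain ⟨d', hd', hdv'⟩ := hval q₀ hy₀
      refine hg q q₀ d d' hd hd' ?_
      rw [← hdv, ← hdv', mul_comm, ← map_mul, heq, mul_comm, map_mul]
  have := B.valuation.map_sum_eq_of_lt hq₀ hlt
  rw [hzero, map_zero] at this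
  exact hpos.ne this

/-- The fundamental equality `[L : K] = (vL : vK) [Lv : Kv]` for finite extensions of complete
discretely valued fields. -/
theorem finrank_eq_ramificationIndex_mul_inertiaDegree (B : ValuationSubring L)
    [IsDiscreteValuationRing (restrict K B)]
    [IsAdicComplete (maximalIdeal (restrict K B)) (restrict K B)]
    [FiniteDimensional K L] :
    Module.finrank K L = ramificationIndex K B * inertiaDegree K B := by
  let Q := B.ValueGroupˣ ⧸ valueSubgroup K B
  have hgex : ∀ q : Q, ∃ x : L, x ≠ 0 ∧ ((q.out : B.ValueGroupˣ) : B.ValueGroup) =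
    B.valuation x := fun q => exists_unit_valuation B q.out
  choose g hg0 hgv using hgex
  let b := Module.Basis.ofVectorSpace (residueSubfield K B) (ResidueField B)
  let ι := Module.Basis.ofVectorSpaceIndex (residueSubfield K B) (ResidueField B)
  choose u hu using fun i : ι => residue_surjective (R := B) (b i)
  have hLIu : LinearIndependent (residueSubfield K B) fun i => residue B (u i) := by
    simp only [hu]
    exact b.linearIndependent
  -- `g` represents the cosets of the value group of `K`, and `u` lifts a basis of the residue
  -- field extension; the products `g q * u i` are linearly independent over `K`.
  have hdisj : ∀ (q q' : Q) (c c' : K), c ≠ 0 → c' ≠ 0 → B.valuation (algebraMap K L c) *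
      B.valuation (g q) = B.valuation (algebraMap K L c') * B.valuation (g q') → q = q' := by
    intro q q' c c' hc hc' h
    rw [← Quotient.out_eq' q, ← Quotient.out_eq' q']
    refine QuotientGroup.eq.2 ((mem_valueSubgroup_iff B _).2 ⟨c / c', ?_⟩)
    have hvc' : B.valuation (algebraMap K L c') ≠ 0 := by simpa using hc'
    have hvg : B.valuation (g q) ≠ 0 := by simpa using hg0 q
    rw [Units.val_mul, Units.val_inv_eq_inv_val, hgv, hgv, map_div₀, map_div₀, eq_div_iff hvc',
      mul_assoc, mul_comm (B.valuation (g q')), ← h, mul_comm (B.valuation (algebraMap K L c)),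
      inv_mul_cancel_left₀ hvg]
  have hclass : ∀ x : L, x ≠ 0 → ∃ (q : Q) (c : K),
      B.valuation x = B.valuation (algebraMap K L c) * B.valuation (g q) := by
    intro x hx
    let w : B.ValueGroupˣ := Units.mk0 (B.valuation x) (by simpa using hx)
    refine ⟨QuotientGroup.mk w, ?_⟩
    have h1 : (QuotientGroup.mk (Quotient.out (QuotientGroup.mk w : Q)) : Q) =
      QuotientGroup.mk w := Quotient.out_eq' _
    obtain ⟨c, hc⟩ := (mem_valueSubgroup_iff B _).1 (QuotientGroup.eq.1 h1)
    refine ⟨c, ?_⟩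
    rw [← hc, Units.val_mul, Units.val_inv_eq_inv_val, hgv, mul_comm, mul_inv_cancel_left₀]
    · rfl
    · simpa using hg0 _
  have hLI := linearIndependent_mul B hLIu hg0 hdisj
  have : Finite (Q × ι) := hLI.finite
  have : Fintype (Q × ι) := Fintype.ofFinite _
  -- The span of these products contains approximations of every element.
  let P : Submodule K L := Submodule.span K (Set.range fun x : Q × ι => g x.1 * (u x.2 : L))
  have happrox : ∀ x : L, x ≠ 0 → ∃ z ∈ P, B.valuation (x - z) < B.valuation x := by
    intro x hx
    obtain ⟨q, c, hqc⟩ := hclass x hx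
    have hvx : B.valuation x ≠ 0 := by simpa using hx
    have hc0 : algebraMap K L c ≠ 0 := by
      intro h0
      rw [h0, map_zero, zero_mul] at hqc
      exact hvx hqc
    have hcg : algebraMap K L c * g q ≠ 0 := mul_ne_zero hc0 (hg0 q)
    have hmem : x / (algebraMap K L c * g q) ∈ B := by
      rw [← ValuationSubring.valuation_le_one_iff, map_div₀, map_mul, ← hqc, div_self hvx]
    -- `x / (c * g q)` is a unit; approximate it by expanding its residue in the basis `b`.
    have hspan := b.mem_span (residue B ⟨_, hmem⟩)
    rw [← Finsupp.range_linearCombination] at hspan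
    obtain ⟨l, hl⟩ := hspan
    have hlift : ∀ i, ∃ d : restrict K B, residue B (integerMap K B d) = (l i : ResidueField B) := by
      intro i
      obtain ⟨y, hy⟩ := (l i).2
      obtain ⟨d, rfl⟩ := residue_surjective y
      exact ⟨d, by rw [← hy, residueMap, ResidueField.map_residue]⟩
    choose d hd using hlift
    let z : B := l.support.sum fun i => integerMap K B (d i) * u i
    have hres : residue B ⟨_, hmem⟩ = residue B z := by
      rw [← hl, Finsupp.linearCombination_apply, Finsupp.sum, map_sum]
      refine Finset.sum_congr rfl fun i _ => ?_
      rw [map_mul, hd, hu]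
      rfl
    refine ⟨algebraMap K L c * g q * z, ?_, ?_⟩
    · have hz : algebraMap K L c * g q * z = l.support.sum fun i =>
          (c * (d i : K)) • (g q * (u i : L)) := by
        rw [← B.subtype_apply z, map_sum, Finset.mul_sum]
        refine Finset.sum_congr rfl fun i _ => ?_
        change algebraMap K L c * g q * (algebraMap K L (d i) * u i) = _
        rw [Algebra.smul_def, map_mul]
        ring
      rw [hz]
      exact Submodule.sum_mem _ fun i _ => Submodule.smul_mem _ _
        (Submodule.subset_span ⟨(q, i), rfl⟩)
    · have hlt := (residue_eq_residue_iff B _ _).1 hres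
      have h1 : x - algebraMap K L c * g q * z =
          algebraMap K L c * g q * (x / (algebraMap K L c * g q) - z) := by
        rw [mul_sub, mul_div_cancel₀ _ hcg]
      rw [h1, map_mul, map_mul, ← hqc]
      exact mul_lt_of_lt_one_right (zero_lt_iff.2 hvx) hlt
  -- Hence it is everything, by Nakayama's lemma.
  let := integerAlgebra (K := K) B
  have hMF : Module.Finite (restrict K B) B := module_finite_integer B
  have hnoeth : IsNoetherianRing B := IsNoetherianRing.of_finite (restrict K B) B
  obtain ⟨ϖ, hϖ⟩ := exists_isUniformizer (restrict K B)
  have hϖB : algebraMap K L ϖ ∈ B := hϖ.mem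
  have hϖlt : B.valuation (algebraMap K L ϖ) < 1 :=
    (valuation_restrict_lt_one_iff B ϖ).1 hϖ.lt_one
  have hϖ0 : algebraMap K L ϖ ≠ 0 := by simpa using hϖ.ne_zero
  have hDVR : IsDiscreteValuationRing B :=
    { toIsPrincipalIdealRing := inferInstance
      toIsLocalRing := inferInstance
      not_a_field' := fun hbot => by
        have : (⟨_, hϖB⟩ : B) ∈ maximalIdeal B := (B.valuation_lt_one_iff _).2 hϖlt
        rw [hbot, Ideal.mem_bot] at this
        exact hϖ0 (congrArg Subtype.val this) }
  obtain ⟨τ, hτ⟩ := exists_isUniformizer B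
  have hstep : ∀ (n : ℕ) (x : L), x ∈ B → ∃ z ∈ P, z ∈ B ∧ B.valuation (x - z) ≤
      B.valuation τ ^ n := by
    intro n
    induction n with
    | zero =>
      intro x hx
      exact ⟨0, P.zero_mem, B.zero_mem, by simpa using (B.valuation_le_one_iff x).2 hx⟩
    | succ n ih =>
      intro x hx
      obtain ⟨z, hzP, hzB, hz⟩ := ih x hx
      rcases eq_or_ne (x - z) 0 with h0 | h0
      · exact ⟨z, hzP, hzB, by rw [h0, map_zero]; exact zero_le⟩
      · obtain ⟨z', hz'P, hz'⟩ := happrox (x - z) h0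
        have hxz : x - z ∈ B := B.toSubring.sub_mem hx hzB
        have hz'B : z' ∈ B := by
          have h1 : x - z - z' ∈ B := (B.valuation_le_one_iff _).1
            (hz'.le.trans ((B.valuation_le_one_iff _).2 hxz))
          have := B.toSubring.sub_mem hxz h1
          rwa [sub_sub_cancel] at this
        refine ⟨z + z', P.add_mem hzP hz'P, B.add_mem _ _ hzB hz'B, ?_⟩
        rw [← sub_sub, pow_succ']
        exact (hτ.le_mul_of_lt h0 hz').trans (mul_le_mul_right hz _)
  -- For Nakayama an approximation modulo `ϖ` is needed, and `ϖ` is a unit times `τ ^ e`.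
  obtain ⟨e, he⟩ := hτ.exists_pow hϖB hϖ0
  let PB : Submodule (restrict K B) B :=
    { carrier := {x | (x : L) ∈ P}
      zero_mem' := P.zero_mem
      add_mem' := fun hx hy => P.add_mem hx hy
      smul_mem' := fun r x hx => by
        change algebraMap K L r * (x : L) ∈ P
        rw [← Algebra.smul_def]
        exact P.smul_mem _ hx }
  have hle : (⊤ : Submodule (restrict K B) B) ≤ PB := by
    refine Submodule.le_of_le_smul_of_le_jacobson_bot (I := maximalIdeal (restrict K B))
      hMF.fg_top (jacobson_eq_maximalIdeal _ bot_ne_top).ge fun x _ => ?_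
    obtain ⟨z, hzP, hzB, hz⟩ := hstep e x x.2
    rw [← he] at hz
    obtain ⟨a, ha⟩ := (B.valuation_le_iff _ _).1 hz
    have hx : x = ⟨z, hzB⟩ + (⟨ϖ, hϖ.mem⟩ : restrict K B) • a := by
      refine Subtype.ext ?_
      change (x : L) = z + algebraMap K L ϖ * a
      rw [mul_comm, ha, add_sub_cancel]
    rw [hx]
    refine Submodule.add_mem_sup hzP (Submodule.smul_mem_smul ?_ Submodule.mem_top)
    rw [ValuationSubring.valuation_lt_one_iff]
    exact hϖ.lt_one
  have htop : ⊤ ≤ P := by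
    intro x _
    rcases B.mem_or_inv_mem x with hx | hx
    · exact hle (x := ⟨x, hx⟩) Submodule.mem_top
    · rcases eq_or_ne x 0 with rfl | hx0
      · exact P.zero_mem
      obtain ⟨c, hc0, hc⟩ := exists_valuation_le B (inv_ne_zero hx0)
        (Algebra.IsAlgebraic.isAlgebraic (R := K) x⁻¹)
      have hmem : algebraMap K L c * x ∈ B := by
        rw [← ValuationSubring.valuation_le_one_iff, map_mul]
        rw [map_inv₀, ← one_div, le_div_iff₀ (zero_lt_iff.2 (by simpa using hx0))] at hc
        exact hc
      have h1 : algebraMap K L c * x ∈ P := hle (x := ⟨_, hmem⟩) Submodule.mem_top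
      have h2 := P.smul_mem c⁻¹ h1
      rwa [Algebra.smul_def, ← mul_assoc, ← map_mul, inv_mul_cancel₀ hc0, map_one, one_mul] at h2
  have hcard := Module.finrank_eq_nat_card_basis (Module.Basis.mk hLI htop)
  rw [hcard, Nat.card_prod, ramificationIndex, Subgroup.index, inertiaDegree,
    Module.finrank_eq_nat_card_basis b]

theorem isDefectless_of_isAdicComplete {K : Type*} [Field K] (A : ValuationSubring K)
    [IsDiscreteValuationRing A] [IsAdicComplete (maximalIdeal A) A] : IsDefectless A := by
  intro L _ _ B hfin hB huni
  subst hB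
  exact ⟨hfin, huni, ⟨0, (pow_zero _).symm⟩, by
    rw [one_mul]; exact finrank_eq_ramificationIndex_mul_inertiaDegree B⟩

end Fundamental

end ValuedField

/-! ### Purely inseparable extensions of degree `p` with defect -/

namespace ValuedField

open IsLocalRing

section Roots

universe u

open IntermediateField

/-- Two polynomials have roots in an extension generated by these roots. -/
theorem exists_adjoin_roots {K : Type u} [Field K] (f g : Polynomial K) (hf : f.degree ≠ 0)
    (hg : g.degree ≠ 0) : ∃ (N : Type u) (_ : Field N) (_ : Algebra K N) (a b : N),
      Polynomial.aeval a f = 0 ∧ Polynomial.aeval b g = 0 ∧ adjoin K {a, b} = ⊤ := by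
  obtain ⟨a, ha⟩ := IsAlgClosed.exists_aeval_eq_zero (AlgebraicClosure K) f hf
  obtain ⟨b, hb⟩ := IsAlgClosed.exists_aeval_eq_zero (AlgebraicClosure K) g hg
  let N := adjoin K {a, b}
  have haN : a ∈ N := subset_adjoin K _ (by simp)
  have hbN : b ∈ N := subset_adjoin K _ (by simp)
  refine ⟨N, inferInstance, inferInstance, ⟨a, haN⟩, ⟨b, hbN⟩, ?_, ?_, ?_⟩
  · refine Subtype.ext ?_
    have := Polynomial.aeval_algebraMap_apply (AlgebraicClosure K) (⟨a, haN⟩ : N) f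
    exact this.symm.trans ha
  · refine Subtype.ext ?_
    have := Polynomial.aeval_algebraMap_apply (AlgebraicClosure K) (⟨b, hbN⟩ : N) g
    exact this.symm.trans hb
  · apply IntermediateField.map_injective N.val
    rw [adjoin_map, ← AlgHom.fieldRange_eq_map, fieldRange_val, Set.image_pair]
    rfl

variable {K N : Type*} [Field K] [Field N] [Algebra K N]

theorem finrank_adjoin_root_le {f : Polynomial K} (hf : f.Monic) {a : N}
    (ha : Polynomial.aeval a f = 0) : IsIntegral K a ∧ Module.finrank K (adjoin K {a}) ≤
      f.natDegree := by
  have hint : IsIntegral K a := ⟨f, hf, ha⟩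
  refine ⟨hint, ?_⟩
  rw [adjoin.finrank hint]
  exact Polynomial.natDegree_le_of_dvd (minpoly.dvd K a ha) hf.ne_zero

/-- If `a` and `b` are roots of monic polynomials of degree `p` and the `p ^ 2` products
`a ^ i * b ^ j` are linearly independent, then `K(a, b)` has degree `p ^ 2` over `K`. -/
theorem finrank_of_linearIndependent {p : ℕ} (hp : 0 < p) {f g : Polynomial K} (hf : f.Monic)
    (hg : g.Monic) (hfp : f.natDegree = p) (hgp : g.natDegree = p) {a b : N}
    (ha : Polynomial.aeval a f = 0) (hb : Polynomial.aeval b g = 0) (htop : adjoin K {a, b} = ⊤)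
    (hLI : LinearIndependent K fun x : Fin p × Fin p => a ^ (x.1 : ℕ) * b ^ (x.2 : ℕ)) :
    FiniteDimensional K N ∧ Module.finrank K N = p ^ 2 ∧ Module.finrank K (adjoin K {a}) = p ∧
      Module.finrank K (adjoin K {b}) = p ∧
      ∀ x : N, ∃ c : Fin p × Fin p → K,
        x = ∑ i, algebraMap K N (c i) * (a ^ (i.1 : ℕ) * b ^ (i.2 : ℕ)) := by
  obtain ⟨hai, hale⟩ := finrank_adjoin_root_le hf ha
  obtain ⟨hbi, hble⟩ := finrank_adjoin_root_le hg hb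
  rw [hfp] at hale
  rw [hgp] at hble
  have hsup : adjoin K {a} ⊔ adjoin K {b} = (⊤ : IntermediateField K N) := by
    rw [← htop, ← adjoin_union]
    rfl
  have hfa : FiniteDimensional K (adjoin K {a}) := adjoin.finiteDimensional hai
  have hfb : FiniteDimensional K (adjoin K {b}) := adjoin.finiteDimensional hbi
  have hle : Module.finrank K N ≤
      Module.finrank K (adjoin K {a}) * Module.finrank K (adjoin K {b}) := by
    have := IntermediateField.finrank_sup_le (adjoin K {a}) (adjoin K {b})
    rwa [hsup, finrank_top'] at this
  have hfin : FiniteDimensional K N := by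
    have : FiniteDimensional K (⊤ : IntermediateField K N) := by
      rw [← hsup]
      infer_instance
    exact (topEquiv (F := K) (E := N)).toLinearEquiv.finiteDimensional
  have hge := hLI.fintype_card_le_finrank
  rw [Fintype.card_prod, Fintype.card_fin] at hge
  have hpp : p * p ≤ Module.finrank K (adjoin K {a}) * Module.finrank K (adjoin K {b}) :=
    hge.trans hle
  have h1 : Module.finrank K (adjoin K {a}) = p := by
    refine le_antisymm hale (Nat.le_of_mul_le_mul_right ?_ hp)
    exact hpp.trans (Nat.mul_le_mul_left _ hble)
  have h2 : Module.finrank K (adjoin K {b}) = p := by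
    refine le_antisymm hble (Nat.le_of_mul_le_mul_left ?_ hp)
    exact hpp.trans (Nat.mul_le_mul_right _ hale)
  rw [h1, h2] at hle
  have hN : Module.finrank K N = p * p := le_antisymm hle hge
  refine ⟨hfin, by rw [hN, sq], h1, h2, fun x => ?_⟩
  have hne : Nonempty (Fin p × Fin p) := ⟨(⟨0, hp⟩, ⟨0, hp⟩)⟩
  have hcard : Fintype.card (Fin p × Fin p) = Module.finrank K N := by
    rw [Fintype.card_prod, Fintype.card_fin, hN]
  let bas := basisOfLinearIndependentOfCardEqFinrank hLI hcard
  refine ⟨fun i => bas.repr x i, ?_⟩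
  conv_lhs => rw [← bas.sum_repr x]
  refine Finset.sum_congr rfl fun i _ => ?_
  rw [coe_basisOfLinearIndependentOfCardEqFinrank, Algebra.smul_def]

end Roots

section Maximal

universe u

/-- A nontrivial algebraic extension with `vL = vK` all of whose residues are represented by
natural numbers shows that `K` is not algebraically maximal. -/
theorem not_isAlgebraicallyMaximal {K L : Type u} [Field K] [Field L] [Algebra K L]
    [Algebra.IsAlgebraic K L] (B : ValuationSubring L)
    (hval : ∀ x : L, x ≠ 0 → ∃ c : K, B.valuation x = B.valuation (algebraMap K L c))
    (hres : ∀ x ∈ B, ∃ n : ℕ, B.valuation (x - n) < 1)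
    (hsurj : ¬ Function.Surjective (algebraMap K L)) :
    ¬ IsAlgebraicallyMaximal (restrict K B) := fun h =>
  hsurj (h L B inferInstance rfl ((isImmediate_iff B).2 ⟨hval, fun x hx => by
    obtain ⟨n, hn⟩ := hres x hx
    exact ⟨n, by simpa using hn⟩⟩))

theorem not_isAlgebraicallyMaximal_intermediateField {K L : Type u} [Field K] [Field L]
    [Algebra K L] [Algebra.IsAlgebraic K L] (B : ValuationSubring L) (F : IntermediateField K L)
    (hval : ∀ x : L, x ≠ 0 → ∃ c ∈ F, B.valuation x = B.valuation c)
    (hres : ∀ x ∈ B, ∃ n : ℕ, B.valuation (x - n) < 1)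
    (hrank : Module.finrank K F ≠ Module.finrank K L) :
    ¬ IsAlgebraicallyMaximal (restrict F B) := by
  refine not_isAlgebraicallyMaximal B (fun x hx => ?_) hres fun hsurj => hrank ?_
  · obtain ⟨c, hc, h⟩ := hval x hx
    exact ⟨⟨c, hc⟩, h⟩
  · have : F = ⊤ := by
      rw [eq_top_iff]
      rintro x -
      obtain ⟨y, rfl⟩ := hsurj x
      exact y.2
    rw [this, IntermediateField.finrank_top']

end Maximal

/-- A discrete valuation with residue field `𝔽_p` on a field of characteristic `p`, together with
two uniformizers `t` and `u` which are `p`-independent. -/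
structure IsUniformizerPair (p : ℕ) {k : Type*} [Field k] (A : ValuationSubring k) (t u : k) :
    Prop where
  isUniformizer : IsUniformizer A t
  valuation_eq : A.valuation u = A.valuation t
  exists_natCast : ∀ x ∈ A, ∃ n : ℕ, A.valuation (x - n) < 1
  eq_zero_of_sum : ∀ c : Fin p × Fin p → k,
    ∑ i, c i ^ p * (t ^ (i.1 : ℕ) * u ^ (i.2 : ℕ)) = 0 → ∀ i, c i = 0

section PthPowers

variable {p : ℕ} {k k' : Type*} [Field k] [Field k'] [Algebra k k']
  {C : ValuationSubring k'} {t u : k}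

theorem valuation_natCast_pow_sub (hp : p.Prime) [CharP k' p] {x : k'} {z : k}
    (hx : x ^ p = algebraMap k k' z) (n : ℕ) :
    C.valuation (x - n) ^ p = C.valuation (algebraMap k k' (z - n)) := by
  have := Fact.mk hp
  rw [← map_pow, sub_pow_char, hx, map_sub (algebraMap k k'), map_natCast]
  congr 2
  exact map_natCast (frobenius k' p) n

theorem exists_natCast_of_pow_mem [CharP k p] (hp : p.Prime)
    (h : IsUniformizerPair p (restrict k C) t u)
    (hpow : ∀ x : k', ∃ z : k, x ^ p = algebraMap k k' z) {x : k'} (hx : x ∈ C) :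
    ∃ n : ℕ, C.valuation (x - n) < 1 := by
  have : CharP k' p := charP_of_injective_ringHom (algebraMap k k').injective p
  obtain ⟨z, hz⟩ := hpow x
  have hzA : z ∈ restrict k C := by
    rw [ValuationSubring.mem_comap, ← hz]
    exact C.toSubring.pow_mem hx p
  obtain ⟨n, hn⟩ := h.exists_natCast z hzA
  refine ⟨n, ?_⟩
  rw [valuation_restrict_lt_one_iff, ← valuation_natCast_pow_sub hp hz] at hn
  exact lt_of_not_ge fun hge => absurd hn (not_lt.2 (one_le_pow₀ hge))

theorem exists_zpow_of_pow_mem (hp : p.Prime) (h : IsUniformizerPair p (restrict k C) t u)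
    (hpow : ∀ x : k', ∃ z : k, x ^ p = algebraMap k k' z) {α : k'}
    (hα : C.valuation α ^ p = C.valuation (algebraMap k k' t)) {x : k'} (hx : x ≠ 0) :
    ∃ n : ℤ, C.valuation x = C.valuation α ^ n := by
  obtain ⟨z, hz⟩ := hpow x
  have hz0 : z ≠ 0 := by
    rintro rfl
    rw [map_zero] at hz
    exact hx (pow_eq_zero_iff hp.ne_zero |>.1 hz)
  obtain ⟨n, hn⟩ := h.isUniformizer.exists_zpow z hz0
  refine ⟨n, (pow_left_inj₀ zero_le zero_le hp.ne_zero).1 ?_⟩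
  rw [← map_zpow₀, valuation_restrict_eq_iff, map_zpow₀, map_zpow₀] at hn
  rw [← map_pow, hz, hn, ← hα, ← zpow_natCast, ← zpow_natCast, ← zpow_mul, ← zpow_mul, mul_comm]

theorem valuation_ne_of_pow (hp : p.Prime) (h : IsUniformizerPair p (restrict k C) t u) {α : k'}
    (hα : C.valuation α ^ p = C.valuation (algebraMap k k' t)) (z : k) :
    C.valuation α ≠ C.valuation (algebraMap k k' z) := by
  intro heq
  rw [heq, ← map_pow, ← map_pow, ← valuation_restrict_eq_iff, map_pow] at hα
  have hz0 : z ≠ 0 := by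
    rintro rfl
    rw [map_zero, zero_pow hp.ne_zero, eq_comm] at hα
    exact h.isUniformizer.valuation_ne_zero hα
  obtain ⟨n, hn⟩ := h.isUniformizer.exists_zpow z hz0
  rw [hn, ← zpow_natCast, ← zpow_mul] at hα
  have h1 : n * (p : ℤ) = 1 := by
    refine zpow_right_injective₀ h.isUniformizer.valuation_pos h.isUniformizer.lt_one.ne ?_
    simpa using hα
  have h2 : (p : ℤ) ∣ 1 := ⟨n, by rw [mul_comm, h1]⟩
  have h3 : p ∣ 1 := by exact_mod_cast h2
  exact hp.one_lt.ne' (Nat.dvd_one.1 h3)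

end PthPowers

section Inseparable

universe u

open Polynomial IntermediateField

variable {p : ℕ} {k : Type u} [Field k] [CharP k p] {A : ValuationSubring k} {t u : k}

/-- The extension `k(α, β)` with `α ^ p = t` and `β ^ p = u` has degree `p ^ 2` and defect `p`; it is
immediate over `k(α)`, which is therefore not algebraically maximal. -/
theorem IsUniformizerPair.exists_purelyInseparable (hp : p.Prime) (h : IsUniformizerPair p A t u) :
    (∃ (E : Type u) (_ : Field E) (_ : Algebra k E) (C : ValuationSubring E),
      IsPurelyInseparable k E ∧ Module.finrank k E = p ∧ restrict k C = A ∧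
        ¬ IsAlgebraicallyMaximal C) ∧ ¬ IsInseparablyDefectless A := by
  have hmt : (X ^ p - Polynomial.C t).Monic := monic_X_pow_sub_C t hp.ne_zero
  have hmu : (X ^ p - Polynomial.C u).Monic := monic_X_pow_sub_C u hp.ne_zero
  have hdt : (X ^ p - Polynomial.C t).natDegree = p := natDegree_X_pow_sub_C
  have hdu : (X ^ p - Polynomial.C u).natDegree = p := natDegree_X_pow_sub_C
  obtain ⟨N, _, _, α, β, hα, hβ, htop⟩ := exists_adjoin_roots (X ^ p - Polynomial.C t)
    (X ^ p - Polynomial.C u)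
    (by rw [degree_eq_natDegree hmt.ne_zero, hdt]; exact_mod_cast hp.ne_zero)
    (by rw [degree_eq_natDegree hmu.ne_zero, hdu]; exact_mod_cast hp.ne_zero)
  have hα' : α ^ p = algebraMap k N t := by simpa [sub_eq_zero] using hα
  have hβ' : β ^ p = algebraMap k N u := by simpa [sub_eq_zero] using hβ
  have : CharP N p := charP_of_injective_ringHom (algebraMap k N).injective p
  have := Fact.mk hp
  have hsum : ∀ c : Fin p × Fin p → k,
      (∑ i, algebraMap k N (c i) * (α ^ (i.1 : ℕ) * β ^ (i.2 : ℕ))) ^ p =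
        algebraMap k N (∑ i, c i ^ p * (t ^ (i.1 : ℕ) * u ^ (i.2 : ℕ))) := by
    intro c
    rw [sum_pow_char, map_sum]
    refine Finset.sum_congr rfl fun i _ => ?_
    rw [mul_pow, mul_pow, ← pow_mul, mul_comm (i.1 : ℕ), pow_mul, hα', ← pow_mul,
      mul_comm (i.2 : ℕ), pow_mul, hβ', map_mul, map_mul, map_pow, map_pow, map_pow]
  have hLI : LinearIndependent k fun x : Fin p × Fin p => α ^ (x.1 : ℕ) * β ^ (x.2 : ℕ) := by
    rw [Fintype.linearIndependent_iff]
    intro c hc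
    refine h.eq_zero_of_sum c ((algebraMap k N).injective ?_)
    rw [map_zero, ← hsum]
    simp only [Algebra.smul_def] at hc
    rw [hc, zero_pow hp.ne_zero]
  -- The `p`-th powers of the products `α ^ i * β ^ j` are the elements `t ^ i * u ^ j`, which are
  -- independent over the field of `p`-th powers.
  obtain ⟨hfin, hN, hNa, hNb, hspan⟩ :=
    finrank_of_linearIndependent hp.pos hmt hmu hdt hdu hα hβ htop hLI
  have hpow : ∀ x : N, ∃ z : k, x ^ p = algebraMap k N z := by
    intro x
    obtain ⟨c, rfl⟩ := hspan x
    exact ⟨_, hsum c⟩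
  obtain ⟨C, rfl⟩ := exists_restrict_eq (L := N) A
  have hvα : C.valuation α ^ p = C.valuation (algebraMap k N t) := by rw [← map_pow, hα']
  have hα0 : α ≠ 0 := by
    rintro rfl
    rw [zero_pow hp.ne_zero, eq_comm, map_eq_zero] at hα'
    exact h.isUniformizer.ne_zero hα'
  have hpi : IsPurelyInseparable k N := by
    rw [isPurelyInseparable_iff_pow_mem k p]
    intro x
    obtain ⟨z, hz⟩ := hpow x
    exact ⟨1, z, by rw [pow_one, hz]⟩
  have hpp : p ≠ p ^ 2 := by
    intro hpp
    have : p * 1 = p * p := by rw [mul_one, ← sq, ← hpp]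
    exact hp.one_lt.ne (Nat.eq_of_mul_eq_mul_left hp.pos this)
  refine ⟨⟨adjoin k {α}, inferInstance, inferInstance, restrict (adjoin k {α}) C, inferInstance,
    hNa, rfl, ?_⟩, fun hdef => ?_⟩
  · refine not_isAlgebraicallyMaximal_intermediateField C _ (fun x hx => ?_)
      (fun x hx => exists_natCast_of_pow_mem hp h hpow hx) (by rw [hNa, hN]; exact hpp)
    -- Every value of `k(α, β)` is the value of a power of `α`, and the residue field is prime.
    obtain ⟨n, hn⟩ := exists_zpow_of_pow_mem hp h hpow hvα hx
    exact ⟨α ^ n, zpow_mem (mem_adjoin_simple_self k α) n, by rw [hn, map_zpow₀]⟩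
  · obtain ⟨-, -, -, heq⟩ := hdef N C hfin hpi rfl
    rw [inertiaDegree_eq_one C fun x hx => exists_natCast_of_pow_mem hp h hpow hx,
      ramificationIndex_eq_prime C hp hα0 hvα (fun x hx => ?_) (valuation_ne_of_pow hp h hvα), hN,
      one_mul, mul_one] at heq
    · exact hpp heq.symm
    · obtain ⟨n, hn⟩ := exists_zpow_of_pow_mem hp h hpow hvα hx
      exact ⟨1, n, by simpa using hn⟩

end Inseparable

end ValuedField

/-! ### Polynomials of Artin-Schreier type -/

namespace ValuedField

open IsLocalRing

theorem charP_residueField_composite {p : ℕ} (hp : p.Prime) {L : Type*} [Field L]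
    (W : ValuationSubring L) (A₀ : ValuationSubring (ResidueField W))
    [CharP (ResidueField W) p] : CharP (ResidueField (composite W A₀)) p := by
  rw [CharP.charP_iff_prime_eq_zero hp, ← map_natCast (residue (composite W A₀)),
    residue_eq_zero_iff_valuation]
  have := (composite_valuation_lt_one_iff (A₀ := A₀) (p : W)).2 (by
    rw [map_natCast, CharP.cast_eq_zero, map_zero]
    exact zero_lt_one)
  simpa using this

section ArtinSchreier

open Polynomial in
/-- The polynomial `X ^ p - c X - d`, a separable deformation of `X ^ p - d`, has degree `p`. -/
theorem monic_X_pow_sub_mul_X_sub_C {K : Type*} [Field K] {p : ℕ} (hp : 1 < p) (c d : K) :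
    (X ^ p - (C c * X + C d)).Monic ∧ (X ^ p - (C c * X + C d)).natDegree = p := by
  have hd : (C c * X + C d : K[X]).degree < (p : ℕ) :=
    lt_of_le_of_lt degree_linear_le (by exact_mod_cast hp)
  refine ⟨monic_X_pow_sub hd, ?_⟩
  have : (X ^ p - (C c * X + C d)).degree = (p : WithBot ℕ) := by
    rw [degree_sub_eq_left_of_degree_lt] <;> rw [degree_X_pow]
    exact hd
  exact natDegree_eq_of_degree_eq_some this

open Polynomial in
theorem isSeparable_of_pow_sub_mul_sub {K N : Type*} [Field K] [Field N] [Algebra K N] {p : ℕ}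
    (hp : 1 < p) {c d : K} (hc : c ≠ 0) {a : N}
    (ha : aeval a (X ^ p - (C c * X + C d)) = 0)
    (hrank : Module.finrank K (IntermediateField.adjoin K {a}) = p) : IsSeparable K a := by
  obtain ⟨hm, hdeg⟩ := monic_X_pow_sub_mul_X_sub_C hp c d
  have hint : IsIntegral K a := ⟨_, hm, ha⟩
  rw [IntermediateField.adjoin.finrank hint] at hrank
  have heq : minpoly K a = X ^ p - (C c * X + C d) :=
    (eq_of_monic_of_dvd_of_natDegree_le (minpoly.monic hint) hm (minpoly.dvd K a ha)
      (by rw [hdeg, hrank])).symm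
  have hirr := minpoly.irreducible hint
  rw [IsSeparable, separable_iff_derivative_ne_zero hirr, heq]
  intro h0
  have := congrArg (fun f => coeff f 0) h0
  simp only [coeff_derivative, coeff_sub, coeff_X_pow, coeff_add, coeff_C_mul, coeff_X,
    coeff_C] at this
  have hp1 : (0 + 1 : ℕ) ≠ p := by omega
  simp [hp1] at this
  exact hc this

end ArtinSchreier

section Lift

variable {p : ℕ} {L M : Type*} [Field L] [Field M] [Algebra L M]
  {V : ValuationSubring M} {π : L} {tt uu : restrict L V} {a b : M}

/-- The data of the extension `M = L(a, b)`: here `a` and `b` are roots of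
`X ^ p - π X - tt` and `X ^ p - π X - uu`, whose residues generate the purely inseparable extension
given by the `p`-th roots of the residues of `tt` and `uu`. -/
structure IsRootPair (p : ℕ) (V : ValuationSubring M) (π : L) (tt uu : restrict L V) (a b : M) :
    Prop where
  isUniformizer : IsUniformizer (restrict L V) π
  pow_left : a ^ p = algebraMap L M π * a + algebraMap L M tt
  pow_right : b ^ p = algebraMap L M π * b + algebraMap L M uu

theorem mem_of_pow_eq (hp : 1 < p) {π d : L} (hπ : V.valuation (algebraMap L M π) ≤ 1)
    (hd : V.valuation (algebraMap L M d) ≤ 1) {a : M}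
    (ha : a ^ p = algebraMap L M π * a + algebraMap L M d) : a ∈ V := by
  rw [← ValuationSubring.valuation_le_one_iff]
  by_contra! hlt
  have h1 : V.valuation a ^ p ≤ V.valuation a := by
    rw [← map_pow, ha]
    refine (V.valuation.map_add _ _).trans (max_le ?_ (hd.trans hlt.le))
    rw [map_mul]
    exact mul_le_of_le_one_left' hπ
  have h2 : V.valuation a < V.valuation a ^ p := by
    simpa using pow_lt_pow_right₀ hlt hp
  exact absurd h1 (not_le.2 h2)

namespace IsRootPair

variable (h : IsRootPair p V π tt uu a b)
include h

theorem val_lt_one : V.valuation (algebraMap L M π) < 1 :=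
  (valuation_restrict_lt_one_iff V π).1 h.isUniformizer.lt_one

theorem left_mem (hp : 1 < p) : a ∈ V :=
  mem_of_pow_eq hp h.val_lt_one.le ((V.valuation_le_one_iff _).2 tt.2) h.pow_left

theorem right_mem (hp : 1 < p) : b ∈ V :=
  mem_of_pow_eq hp h.val_lt_one.le ((V.valuation_le_one_iff _).2 uu.2) h.pow_right

theorem residue_left_pow (hp : 1 < p) :
    residue V ⟨a, h.left_mem hp⟩ ^ p = residueMap L V (residue _ tt) := by
  rw [residueMap, ResidueField.map_residue, ← map_pow, residue_eq_residue_iff]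
  change V.valuation (a ^ p - algebraMap L M tt) < 1
  rw [h.pow_left, add_sub_cancel_right, map_mul]
  exact mul_lt_one_of_lt_of_le h.val_lt_one ((V.valuation_le_one_iff a).2 (h.left_mem hp))

theorem residue_right_pow (hp : 1 < p) :
    residue V ⟨b, h.right_mem hp⟩ ^ p = residueMap L V (residue _ uu) := by
  rw [residueMap, ResidueField.map_residue, ← map_pow, residue_eq_residue_iff]
  change V.valuation (b ^ p - algebraMap L M uu) < 1
  rw [h.pow_right, add_sub_cancel_right, map_mul]
  exact mul_lt_one_of_lt_of_le h.val_lt_one ((V.valuation_le_one_iff b).2 (h.right_mem hp))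

theorem sum_mem (hp : 1 < p) (c : Fin p × Fin p → restrict L V) :
    ∑ i, algebraMap L M (c i) * (a ^ (i.1 : ℕ) * b ^ (i.2 : ℕ)) ∈ V :=
  V.toSubring.sum_mem fun i _ => V.mul_mem _ _ (c i).2 (V.mul_mem _ _
    (V.toSubring.pow_mem (h.left_mem hp) _) (V.toSubring.pow_mem (h.right_mem hp) _))

/-- The `p`-th power of a residue lies in the residue field of `L`. -/
theorem residue_sum_pow (hp : p.Prime) [CharP (ResidueField (restrict L V)) p]
    (c : Fin p × Fin p → restrict L V) :
    residue V ⟨_, h.sum_mem hp.one_lt c⟩ ^ p = residueMap L V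
      (∑ i, residue _ (c i) ^ p * (residue _ tt ^ (i.1 : ℕ) * residue _ uu ^ (i.2 : ℕ))) := by
  have : CharP (ResidueField V) p := charP_of_injective_ringHom (residueMap L V).injective p
  have := Fact.mk hp
  have h1 : (⟨_, h.sum_mem hp.one_lt c⟩ : V) = ∑ i, integerMap L V (c i) *
      (⟨a, h.left_mem hp.one_lt⟩ ^ (i.1 : ℕ) * ⟨b, h.right_mem hp.one_lt⟩ ^ (i.2 : ℕ)) := by
    refine Subtype.ext ?_
    rw [← V.subtype_apply (∑ i, _), map_sum]
    rfl
  rw [h1, map_sum, sum_pow_char, map_sum]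
  refine Finset.sum_congr rfl fun i _ => ?_
  rw [map_mul, map_mul, map_pow, map_pow, mul_pow, mul_pow, ← pow_mul, mul_comm (i.1 : ℕ), pow_mul,
    h.residue_left_pow hp.one_lt, ← pow_mul, mul_comm (i.2 : ℕ), pow_mul,
    h.residue_right_pow hp.one_lt, map_mul, map_mul, map_pow, map_pow, map_pow]
  simp only [residueMap, ResidueField.map_residue]

variable {A₀ : ValuationSubring (ResidueField (restrict L V))}

theorem valuation_lt_one_of_sum (hp : p.Prime) [CharP (ResidueField (restrict L V)) p]
    (hA : IsUniformizerPair p A₀ (residue _ tt) (residue _ uu)) (c : Fin p × Fin p → restrict L V)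
    (hc : V.valuation (∑ i, algebraMap L M (c i) * (a ^ (i.1 : ℕ) * b ^ (i.2 : ℕ))) < 1)
    (i : Fin p × Fin p) : V.valuation (algebraMap L M (c i)) < 1 := by
  have h0 : residue V ⟨_, h.sum_mem hp.one_lt c⟩ = 0 :=
    (residue_eq_zero_iff_valuation V _).2 hc
  have h1 := h.residue_sum_pow hp c
  rw [h0, zero_pow hp.ne_zero, eq_comm, map_eq_zero] at h1
  have h2 := hA.eq_zero_of_sum (fun i => residue _ (c i)) h1 i
  rw [residue_eq_zero_iff_valuation] at h2
  exact (valuation_restrict_lt_one_iff V _).1 h2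

theorem linearIndependent (hp : p.Prime) [CharP (ResidueField (restrict L V)) p]
    (hA : IsUniformizerPair p A₀ (residue _ tt) (residue _ uu)) :
    LinearIndependent L fun x : Fin p × Fin p => a ^ (x.1 : ℕ) * b ^ (x.2 : ℕ) := by
  refine linearIndependent_of_forall_valuation V fun c hc h0 i => ?_
  exact h.valuation_lt_one_of_sum hp hA (fun i => ⟨c i, hc i⟩)
    (by rw [h0, map_zero]; exact zero_lt_one) i

/-- Every element of `M` is a power of `π` times a unit of the form `∑ c_ij a ^ i b ^ j` with
integral coefficients. -/
theorem exists_eq_zpow_mul (hp : p.Prime) [CharP (ResidueField (restrict L V)) p]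
    (hA : IsUniformizerPair p A₀ (residue _ tt) (residue _ uu))
    (hspan : ∀ x : M, ∃ c : Fin p × Fin p → L,
      x = ∑ i, algebraMap L M (c i) * (a ^ (i.1 : ℕ) * b ^ (i.2 : ℕ))) {x : M} (hx : x ≠ 0) :
    ∃ (m : ℤ) (c : Fin p × Fin p → restrict L V),
      x = algebraMap L M π ^ m *
        ∑ i, algebraMap L M (c i) * (a ^ (i.1 : ℕ) * b ^ (i.2 : ℕ)) ∧
      V.valuation (∑ i, algebraMap L M (c i) * (a ^ (i.1 : ℕ) * b ^ (i.2 : ℕ))) = 1 := by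
  obtain ⟨c, rfl⟩ := hspan x
  have hne : ∃ i ∈ Finset.univ, c i ≠ 0 := by
    by_contra! hall
    exact hx (Finset.sum_eq_zero fun i hi => by rw [hall i hi, map_zero, zero_mul])
  obtain ⟨i₀, -, hi₀, hdiv⟩ := exists_max_valuation (restrict L V) Finset.univ c hne
  obtain ⟨m, hm⟩ := h.isUniformizer.exists_zpow (c i₀) hi₀
  have hπm : π ^ m ≠ 0 := zpow_ne_zero m h.isUniformizer.ne_zero
  have hmem : ∀ i, c i / π ^ m ∈ restrict L V := by
    intro i
    have := (ValuationSubring.valuation_le_one_iff _ _).2 (hdiv i (Finset.mem_univ i))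
    rwa [map_div₀, hm, ← map_zpow₀, ← map_div₀, ValuationSubring.valuation_le_one_iff] at this
  refine ⟨m, fun i => ⟨c i / π ^ m, hmem i⟩, ?_, ?_⟩
  · rw [Finset.mul_sum]
    refine Finset.sum_congr rfl fun i _ => ?_
    change _ = _ * (algebraMap L M (c i / π ^ m) * _)
    rw [← mul_assoc (algebraMap L M π ^ m), ← map_zpow₀, ← map_mul, mul_div_cancel₀ _ hπm]
  · refine le_antisymm ((V.valuation_le_one_iff _).2 (h.sum_mem hp.one_lt _))
      (not_lt.1 fun hlt => ?_)
    have := h.valuation_lt_one_of_sum hp hA _ hlt i₀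
    rw [← valuation_restrict_lt_one_iff, map_div₀, hm, ← map_zpow₀, div_self] at this
    · exact lt_irrefl _ this
    · exact (Valuation.ne_zero_iff _).2 hπm

theorem exists_residue_pow_eq (hp : p.Prime) [CharP (ResidueField (restrict L V)) p]
    (hA : IsUniformizerPair p A₀ (residue _ tt) (residue _ uu))
    (hspan : ∀ x : M, ∃ c : Fin p × Fin p → L,
      x = ∑ i, algebraMap L M (c i) * (a ^ (i.1 : ℕ) * b ^ (i.2 : ℕ))) (x : ResidueField V) :
    ∃ z, x ^ p = residueMap L V z := by
  obtain ⟨⟨y, hy⟩, rfl⟩ := residue_surjective x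
  by_cases h0 : residue V ⟨y, hy⟩ = 0
  · exact ⟨0, by rw [h0, zero_pow hp.ne_zero, map_zero]⟩
  have hy1 : V.valuation y = 1 :=
    le_antisymm ((V.valuation_le_one_iff y).2 hy)
      (not_lt.1 fun hlt => h0 ((residue_eq_zero_iff_valuation V _).2 hlt))
  have hy0 : y ≠ 0 := by
    rintro rfl
    rw [map_zero] at hy1
    exact zero_ne_one hy1
  obtain ⟨m, c, hyc, hc⟩ := h.exists_eq_zpow_mul hp hA hspan hy0
  have hm : m = 0 := by
    have h1 : V.valuation (algebraMap L M π) ^ m = V.valuation (algebraMap L M π) ^ (0 : ℤ) := by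
      rw [hyc, map_mul, hc, mul_one, map_zpow₀] at hy1
      rw [hy1, zpow_zero]
    refine zpow_right_injective₀ ?_ h.val_lt_one.ne h1
    exact zero_lt_iff.2 (by simpa using h.isUniformizer.ne_zero)
  rw [hm, zpow_zero, one_mul] at hyc
  subst hyc
  exact ⟨_, h.residue_sum_pow hp c⟩

end IsRootPair

end Lift

end ValuedField

/-! ### The separable extension with defect -/

namespace ValuedField

open IsLocalRing

section CompositeExtension

variable {L M : Type*} [Field L] [Field M] [Algebra L M] {V : ValuationSubring M}

theorem restrict_composite (B₀ : ValuationSubring (ResidueField V)) :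
    restrict L (composite V B₀) = composite (restrict L V) (B₀.comap (residueMap L V)) := by
  ext x
  rw [ValuationSubring.mem_comap, mem_composite, mem_composite]
  refine exists_congr fun hx => ?_
  rw [ValuationSubring.mem_comap, residueMap, ResidueField.map_residue]
  rfl

theorem composite_valuation_eq_zpow {B₀ : ValuationSubring (ResidueField V)} {y α : V}
    (hy : residue V y ≠ 0) (hα : residue V α ≠ 0) {n : ℤ}
    (h : B₀.valuation (residue V y) = B₀.valuation (residue V α) ^ n) :
    (composite V B₀).valuation (y : M) = (composite V B₀).valuation (α : M) ^ n := by
  have hvα : B₀.valuation (residue V α) ≠ 0 := by simpa using hα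
  have hα0 : (α : M) ≠ 0 := fun h0 => hα (by rw [show α = 0 from Subtype.ext h0, map_zero])
  have hvα' : (composite V B₀).valuation (α : M) ≠ 0 := by simpa using hα0
  obtain ⟨k, rfl | rfl⟩ := Int.eq_nat_or_neg n
  · rw [zpow_natCast, ← map_pow, ← map_pow, ← composite_valuation_eq_iff hy] at h
    · rw [zpow_natCast, ← map_pow]
      exact h
    · rw [map_pow]
      exact pow_ne_zero k hα
  · rw [zpow_neg, zpow_natCast, ← mul_eq_one_iff_eq_inv₀ (pow_ne_zero k hvα), ← map_pow, ← map_mul,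
      ← map_pow, ← map_mul, ← map_one B₀.valuation, ← map_one (residue V),
      ← composite_valuation_eq_iff] at h
    · rw [zpow_neg, zpow_natCast, ← mul_eq_one_iff_eq_inv₀ (pow_ne_zero k hvα'), ← map_pow,
        ← map_mul]
      simpa using h
    · rw [map_mul, map_pow]
      exact mul_ne_zero hy (pow_ne_zero k hα)
    · simp

/-- If every `p`-th power in the residue field of `V` comes from the residue field of `L`, then
the composites with `V` are determined by their restrictions to `L`. -/
theorem mem_iff_of_restrict_eq {p : ℕ} (hp : p ≠ 0)
    {A₀ : ValuationSubring (ResidueField (restrict L V))}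
    (hpow : ∀ x : ResidueField V, ∃ z, x ^ p = residueMap L V z) {B : ValuationSubring M}
    (hBV : B ≤ V) (hB : restrict L B = composite (restrict L V) A₀) (x : M) :
    x ∈ B ↔ ∃ hx : x ∈ V, ∃ z ∈ A₀, residue V ⟨x, hx⟩ ^ p = residueMap L V z := by
  have key : ∀ (x : V) (c : restrict L V), residue V x ^ p = residueMap L V (residue _ c) →
      B.valuation ((x : M) ^ p - algebraMap L M c) < 1 := by
    intro x c h
    rw [residueMap, ResidueField.map_residue, ← map_pow, residue_eq_residue_iff] at h
    exact valuation_lt_one_of_le hBV h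
  constructor
  · intro hx
    obtain ⟨z, hz⟩ := hpow (residue V ⟨x, hBV hx⟩)
    obtain ⟨c, rfl⟩ := residue_surjective z
    refine ⟨hBV hx, _, ?_, hz⟩
    have h1 : algebraMap L M c ∈ B :=
      mem_of_valuation_sub_lt_one B (B.toSubring.pow_mem hx p) (key _ c hz)
    have h2 : (c : L) ∈ composite (restrict L V) A₀ := hB ▸ h1
    exact (mem_composite.1 h2).2
  · rintro ⟨hx, z, hz, hxz⟩
    obtain ⟨c, rfl⟩ := residue_surjective z
    have h2 : (c : L) ∈ restrict L B := by
      rw [hB]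
      exact mem_composite.2 ⟨c.2, hz⟩
    have h1 := B.add_mem _ _ ((B.valuation_le_one_iff _).1 (key _ c hxz).le) h2
    rw [sub_add_cancel, ← ValuationSubring.valuation_le_one_iff, map_pow] at h1
    rw [← ValuationSubring.valuation_le_one_iff]
    exact (pow_le_one_iff hp).1 h1

theorem isUnibranched_composite {p : ℕ} (hp : p ≠ 0) [Algebra.IsAlgebraic L M]
    [IsDiscreteValuationRing (restrict L V)]
    [IsAdicComplete (maximalIdeal (restrict L V)) (restrict L V)]
    (hpow : ∀ x : ResidueField V, ∃ z, x ^ p = residueMap L V z)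
    {B : ValuationSubring M} (hBV : B ≤ V)
    {A₀ : ValuationSubring (ResidueField (restrict L V))}
    (hB : restrict L B = composite (restrict L V) A₀) : IsUnibranched (restrict L B) M := by
  refine ⟨B, rfl, fun B' hB' => ?_⟩
  have hle : restrict L B' ≤ restrict L V := by
    rw [hB', hB]
    exact composite_le _ _
  have hV : coarsening (restrict L V) B' = V :=
    (isUnibranched_of_isAdicComplete (restrict L V) M).unique (restrict_coarsening hle) rfl
  have hB'V : B' ≤ V := (le_coarsening (restrict L V) B').trans_eq hV
  ext x
  rw [mem_iff_of_restrict_eq hp hpow hB'V (hB'.trans hB), mem_iff_of_restrict_eq hp hpow hBV hB]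

end CompositeExtension

section Values

variable {p : ℕ} {L M : Type*} [Field L] [Field M] [Algebra L M]
  {V : ValuationSubring M} {B₀ : ValuationSubring (ResidueField V)} {t u : ResidueField (restrict L V)}

theorem exists_natCast_composite (hp : p.Prime) [CharP (ResidueField (restrict L V)) p]
    (hA : IsUniformizerPair p (B₀.comap (residueMap L V)) t u)
    (hpow : ∀ x : ResidueField V, ∃ z, x ^ p = residueMap L V z) {x : M}
    (hx : x ∈ composite V B₀) : ∃ n : ℕ, (composite V B₀).valuation (x - n) < 1 := by
  let := (residueMap L V).toAlgebra
  obtain ⟨hxV, hx₀⟩ := mem_composite.1 hx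
  obtain ⟨n, hn⟩ := exists_natCast_of_pow_mem (k := ResidueField (restrict L V)) hp hA hpow hx₀
  refine ⟨n, (composite_valuation_lt_one_iff (⟨x, hxV⟩ - (n : V))).2 ?_⟩
  rwa [map_sub, map_natCast]

theorem ne_zero_of_residue_pow {α : V}
    (hA : IsUniformizerPair p (B₀.comap (residueMap L V)) t u)
    (hα : B₀.valuation (residue V α) ^ p = B₀.valuation (residueMap L V t)) (hp : p ≠ 0) :
    residue V α ≠ 0 := by
  intro h0
  rw [h0, map_zero, zero_pow hp, eq_comm] at hα
  exact hA.isUniformizer.ne_zero (by simpa using hα)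

theorem exists_composite_valuation_eq (hp : p.Prime)
    (hA : IsUniformizerPair p (B₀.comap (residueMap L V)) t u)
    (hpow : ∀ x : ResidueField V, ∃ z, x ^ p = residueMap L V z) {π : L}
    (hπ : ∀ x : M, x ≠ 0 → ∃ (m : ℤ) (y : M), x = algebraMap L M π ^ m * y ∧ V.valuation y = 1)
    {α : V} (hα : B₀.valuation (residue V α) ^ p = B₀.valuation (residueMap L V t))
    {x : M} (hx : x ≠ 0) : ∃ m n : ℤ, (composite V B₀).valuation x =
      (composite V B₀).valuation (algebraMap L M π ^ m * (α : M) ^ n) := by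
  let := (residueMap L V).toAlgebra
  obtain ⟨m, y, rfl, hy⟩ := hπ x hx
  have hyV : y ∈ V := (V.valuation_le_one_iff y).1 hy.le
  have hy0 : residue V ⟨y, hyV⟩ ≠ 0 := by
    rw [Ne, residue_eq_zero_iff_valuation]
    exact hy.not_lt
  obtain ⟨n, hn⟩ := exists_zpow_of_pow_mem (k := ResidueField (restrict L V)) hp hA hpow hα hy0
  refine ⟨m, n, ?_⟩
  rw [map_mul, map_mul, map_zpow₀ _ (α : M),
    ← composite_valuation_eq_zpow hy0 (ne_zero_of_residue_pow hA hα hp.ne_zero) hn]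

theorem composite_valuation_ne (hp : p.Prime)
    (hA : IsUniformizerPair p (B₀.comap (residueMap L V)) t u)
    {α : V} (hα : B₀.valuation (residue V α) ^ p = B₀.valuation (residueMap L V t)) (c : L) :
    (composite V B₀).valuation (α : M) ≠ (composite V B₀).valuation (algebraMap L M c) := by
  let := (residueMap L V).toAlgebra
  intro heq
  have hα0 := ne_zero_of_residue_pow hA hα hp.ne_zero
  have hVα : V.valuation (α : M) = 1 :=
    le_antisymm (V.valuation_le_one α)
      (not_lt.1 fun hlt => hα0 ((residue_eq_zero_iff_valuation V _).2 hlt))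
  have hVc : V.valuation (algebraMap L M c) = 1 := by
    rw [← valuation_eq_of_le (composite_le V B₀) heq, hVα]
  have hcV : c ∈ restrict L V := (V.valuation_le_one_iff _).1 hVc.le
  have hc0 : residue V (integerMap L V ⟨c, hcV⟩) ≠ 0 := by
    rw [Ne, residue_eq_zero_iff_valuation]
    exact hVc.not_lt
  have h1 := (composite_valuation_eq_iff (A₀ := B₀) hα0 hc0).1 heq
  rw [← ResidueField.map_residue] at h1
  exact valuation_ne_of_pow (k := ResidueField (restrict L V)) hp hA hα _ h1

end Values

universe w

/-- Over a complete discretely valued field `(L, w)` whose residue field carries a discrete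
valuation with a pair of `p`-independent uniformizers, the roots of `X ^ p - π X - t` and
`X ^ p - π X - u` generate a separable extension of degree `p ^ 2` and defect `p`. -/
theorem exists_separable_defect_extension {p : ℕ} (hp : p.Prime) {L : Type w} [Field L]
    (W : ValuationSubring L) [IsDiscreteValuationRing W] [IsAdicComplete (maximalIdeal W) W]
    [CharP (ResidueField W) p] {A₀ : ValuationSubring (ResidueField W)} {t u : ResidueField W}
    (hA : IsUniformizerPair p A₀ t u) :
    ∃ (M : Type w) (_ : Field M) (_ : Algebra L M) (B : ValuationSubring M) (a b : M),
      restrict L B = composite W A₀ ∧ IntermediateField.adjoin L {a, b} = ⊤ ∧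
      Algebra.IsSeparable L M ∧ Module.finrank L M = p ^ 2 ∧ HasDefect L B p ∧
      Module.finrank L (IntermediateField.adjoin L {a}) = p ∧
      Module.finrank L (IntermediateField.adjoin L {b}) = p ∧
      ¬ IsAlgebraicallyMaximal (restrict (IntermediateField.adjoin L {a}) B) ∧
      ¬ IsAlgebraicallyMaximal (restrict (IntermediateField.adjoin L {b}) B) := by
  obtain ⟨π, hπ⟩ := exists_isUniformizer W
  obtain ⟨tt, rfl⟩ := residue_surjective t
  obtain ⟨uu, rfl⟩ := residue_surjective u
  obtain ⟨hmt, hdt⟩ := monic_X_pow_sub_mul_X_sub_C hp.one_lt π (tt : L)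
  obtain ⟨hmu, hdu⟩ := monic_X_pow_sub_mul_X_sub_C hp.one_lt π (uu : L)
  obtain ⟨M, _, _, a, b, ha, hb, htop⟩ := exists_adjoin_roots _ _
    (by rw [Polynomial.degree_eq_natDegree hmt.ne_zero, hdt]; exact_mod_cast hp.ne_zero)
    (by rw [Polynomial.degree_eq_natDegree hmu.ne_zero, hdu]; exact_mod_cast hp.ne_zero)
  obtain ⟨V, hV⟩ := exists_restrict_eq (L := M) W
  subst hV
  have hroot : IsRootPair p V π tt uu a b := by
    refine ⟨hπ, ?_, ?_⟩
    · simpa [sub_eq_zero] using ha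
    · simpa [sub_eq_zero] using hb
  have hp1 := hp.one_lt
  obtain ⟨hfin, hM, hMa, hMb, hspan⟩ := finrank_of_linearIndependent hp.pos hmt hmu hdt hdu ha hb
    htop (hroot.linearIndependent hp hA)
  -- The residue field of `M` is generated by the `p`-th roots of `t` and `u`, so its `p`-th powers
  -- lie in the residue field of `L`; this determines the extension `B₀` of the valuation `A₀`.
  have hpow := hroot.exists_residue_pow_eq hp hA hspan
  have hval : ∀ x : M, x ≠ 0 → ∃ (m : ℤ) (y : M),
      x = algebraMap L M π ^ m * y ∧ V.valuation y = 1 := by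
    intro x hx
    obtain ⟨m, c, h1, h2⟩ := hroot.exists_eq_zpow_mul hp hA hspan hx
    exact ⟨m, _, h1, h2⟩
  obtain ⟨B₀, rfl⟩ : ∃ B₀ : ValuationSubring (ResidueField V),
      B₀.comap (residueMap L V) = A₀ := by
    let := (residueMap L V).toAlgebra
    exact exists_restrict_eq (L := ResidueField V) A₀
  -- Both roots have residues of the same value, since `t` and `u` have the same value; hence the
  -- value of either one generates the values over `L`.
  have hα : B₀.valuation (residue V ⟨a, hroot.left_mem hp1⟩) ^ p =
      B₀.valuation (residueMap L V (residue _ tt)) := by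
    rw [← map_pow, hroot.residue_left_pow hp1]
  have hβ : B₀.valuation (residue V ⟨b, hroot.right_mem hp1⟩) ^ p =
      B₀.valuation (residueMap L V (residue _ tt)) := by
    rw [← map_pow, hroot.residue_right_pow hp1]
    let := (residueMap L V).toAlgebra
    exact (valuation_restrict_eq_iff (K := ResidueField (restrict L V)) B₀ _ _).1 hA.valuation_eq
  have hα0 := ne_zero_of_residue_pow hA hα hp.ne_zero
  have hgena := fun (x : M) (hx : x ≠ 0) => exists_composite_valuation_eq hp hA hpow hval hα hx
  have hgenb := fun (x : M) (hx : x ≠ 0) => exists_composite_valuation_eq hp hA hpow hval hβ hx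
  have hres := fun (x : M) (hx : x ∈ composite V B₀) => exists_natCast_composite hp hA hpow hx
  have hrestr := restrict_composite (L := L) B₀
  have hpp : p ≠ p ^ 2 := by
    intro hpp
    have : p * 1 = p * p := by rw [mul_one, ← sq, ← hpp]
    exact hp1.ne (Nat.eq_of_mul_eq_mul_left hp.pos this)
  refine ⟨M, inferInstance, inferInstance, composite V B₀, a, b, hrestr, htop, ?_, hM, ?_, hMa,
    hMb, ?_, ?_⟩
  · have hsep : Algebra.IsSeparable L (IntermediateField.adjoin L {a, b}) := by
      rw [IntermediateField.isSeparable_adjoin_iff_isSeparable]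
      rintro x (rfl | rfl)
      · exact isSeparable_of_pow_sub_mul_sub hp1 hπ.ne_zero ha hMa
      · exact isSeparable_of_pow_sub_mul_sub hp1 hπ.ne_zero hb hMb
    rw [htop] at hsep
    exact Algebra.IsSeparable.of_algHom L (⊤ : IntermediateField L M)
      (IntermediateField.topEquiv (F := L) (E := M)).symm.toAlgHom
  · refine ⟨hfin, isUnibranched_composite hp.ne_zero hpow (composite_le V B₀) hrestr, ⟨1, ?_⟩, ?_⟩
    · have : CharP (ResidueField (restrict L (composite V B₀))) p := by
        rw [hrestr]
        exact charP_residueField_composite hp _ _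
      have : ExpChar (ResidueField (restrict L (composite V B₀))) p := ExpChar.prime hp
      rw [pow_one, ringExpChar.eq (ResidueField (restrict L (composite V B₀))) p]
    · have hram : ramificationIndex L (composite V B₀) = p := by
        refine ramificationIndex_eq_prime (a := a) (c₀ := tt) (composite V B₀) hp ?_ ?_
          (fun x hx => ?_) (composite_valuation_ne hp hA hα)
        · rintro rfl
          exact hα0 (map_zero _)
        · have hpow0 : residue V (⟨a, hroot.left_mem hp1⟩ ^ p) ≠ 0 := by
            rw [map_pow]
            exact pow_ne_zero p hα0
          have h1 : residue V (⟨a, hroot.left_mem hp1⟩ ^ p) = residue V (integerMap L V tt) := by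
            rw [map_pow, hroot.residue_left_pow hp1, residueMap, ResidueField.map_residue]
          rw [← map_pow]
          exact (composite_valuation_eq_iff hpow0 (h1 ▸ hpow0)).2 (by rw [h1])
        · obtain ⟨m, n, hmn⟩ := hgena x hx
          exact ⟨π ^ m, n, by rw [hmn, map_mul, map_zpow₀ (algebraMap L M), map_zpow₀ _ a]⟩
      rw [hM, hram, inertiaDegree_eq_one _ hres, mul_one, sq]
  · refine not_isAlgebraicallyMaximal_intermediateField _ _ (fun x hx => ?_) hres
      (by rw [hMa, hM]; exact hpp)
    obtain ⟨m, n, hmn⟩ := hgena x hx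
    exact ⟨_, mul_mem (zpow_mem (IntermediateField.algebraMap_mem _ π) m)
      (zpow_mem (IntermediateField.mem_adjoin_simple_self L a) n), hmn⟩
  · refine not_isAlgebraicallyMaximal_intermediateField _ _ (fun x hx => ?_) hres
      (by rw [hMb, hM]; exact hpp)
    obtain ⟨m, n, hmn⟩ := hgenb x hx
    exact ⟨_, mul_mem (zpow_mem (IntermediateField.algebraMap_mem _ π) m)
      (zpow_mem (IntermediateField.mem_adjoin_simple_self L b) n), hmn⟩

end ValuedField

/-! ### Algebraic maximality and rank of composites -/

namespace ValuedField

open IsLocalRing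

section Image

variable {N : Type*} [Field N]

/-- The valuation induced on the residue field of a coarsening `V` of `B`. -/
noncomputable def residueImage (B V : ValuationSubring N) (_ : B ≤ V) :
    ValuationSubring (ResidueField V) :=
  { (B.toSubring.comap V.subtype).map (residue V) with
    mem_or_inv_mem' := by
      intro x
      obtain ⟨y, rfl⟩ := residue_surjective x
      by_cases hy : residue V y = 0
      · exact Or.inl ⟨0, B.zero_mem, by rw [hy, map_zero]⟩
      · obtain ⟨hinv, hres⟩ := exists_inv_of_residue_ne_zero hy
        rcases B.mem_or_inv_mem (y : N) with hB | hB
        · exact Or.inl ⟨y, hB, rfl⟩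
        · exact Or.inr ⟨⟨_, hinv⟩, hB, hres⟩ }

theorem composite_residueImage {B V : ValuationSubring N} (h : B ≤ V) :
    composite V (residueImage B V h) = B := by
  ext x
  rw [mem_composite]
  constructor
  · rintro ⟨hx, y, hy, hxy⟩
    have h1 := valuation_lt_one_of_le h ((residue_eq_residue_iff V _ _).1 hxy)
    exact mem_of_valuation_sub_lt_one B hy h1
  · intro hx
    exact ⟨h hx, ⟨x, h hx⟩, hx, rfl⟩

end Image

section AlgebraicallyMaximal

universe u

variable {L N : Type u} [Field L] [Field N] [Algebra L N]

theorem composite_injective {W : ValuationSubring L} {A₀ A₁ : ValuationSubring (ResidueField W)}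
    (h : composite W A₀ = composite W A₁) : A₀ = A₁ := by
  ext x
  obtain ⟨y, rfl⟩ := residue_surjective x
  have h1 : ∀ A : ValuationSubring (ResidueField W), residue W y ∈ A ↔ (y : L) ∈ composite W A :=
    fun A => by
      rw [mem_composite]
      exact ⟨fun h => ⟨y.2, h⟩, fun ⟨_, h⟩ => h⟩
  rw [h1, h1, h]

/-- If `(N|L, v)` is immediate and `w` is a coarsening of `v` on `N`, then the residue field
extension of `w` is immediate for the valuations induced by `v`. -/
theorem isImmediate_residueField {V : ValuationSubring N} {B₀ : ValuationSubring (ResidueField V)}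
    (h : IsImmediate L (composite V B₀)) :
    letI := (residueMap L V).toAlgebra
    IsImmediate (ResidueField (restrict L V)) B₀ := by
  let := (residueMap L V).toAlgebra
  rw [isImmediate_iff] at h ⊢
  refine ⟨fun x hx => ?_, fun x hx => ?_⟩
  · obtain ⟨y, rfl⟩ := residue_surjective x
    have hy0 : (y : N) ≠ 0 := fun h0 => hx (by rw [show y = 0 from Subtype.ext h0, map_zero])
    obtain ⟨c, hc⟩ := h.1 y hy0
    have hVc := valuation_eq_of_le (composite_le V B₀) hc
    have hVy : V.valuation (y : N) = 1 :=
      le_antisymm (V.valuation_le_one y)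
        (not_lt.1 fun hlt => hx ((residue_eq_zero_iff_valuation V _).2 hlt))
    rw [hVy] at hVc
    have hcV : c ∈ restrict L V := (V.valuation_le_one_iff _).1 hVc.symm.le
    have hc0 : residue V (integerMap L V ⟨c, hcV⟩) ≠ 0 := by
      rw [Ne, residue_eq_zero_iff_valuation]
      exact hVc.le.not_gt
    refine ⟨residue _ ⟨c, hcV⟩, ?_⟩
    have h1 := (composite_valuation_eq_iff (A₀ := B₀) hx hc0).1 hc
    rw [← ResidueField.map_residue] at h1
    exact h1
  · obtain ⟨y, rfl⟩ := residue_surjective x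
    obtain ⟨c, hc⟩ := h.2 y (mem_composite.2 ⟨y.2, hx⟩)
    have hcB : algebraMap L N c ∈ composite V B₀ :=
      mem_of_valuation_sub_lt_one _ (mem_composite.2 ⟨y.2, hx⟩) hc
    have hcV : c ∈ restrict L V := composite_le V B₀ hcB
    refine ⟨residue _ ⟨c, hcV⟩, ?_⟩
    have h1 := (composite_valuation_lt_one_iff (A₀ := B₀) (y - integerMap L V ⟨c, hcV⟩)).1 hc
    rw [map_sub, ← ResidueField.map_residue] at h1
    exact h1

/-- A complete discretely valued field has no nontrivial immediate algebraic extensions. -/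
theorem surjective_of_isImmediate (V : ValuationSubring N)
    [IsAdicComplete (maximalIdeal (restrict L V)) (restrict L V)]
    [IsDiscreteValuationRing (restrict L V)] [Algebra.IsAlgebraic L N]
    (h : IsImmediate L V) : Function.Surjective (algebraMap L N) := by
  obtain ⟨ϖ, hϖ⟩ := exists_isUniformizer (restrict L V)
  rw [isImmediate_iff] at h
  have hV : ∀ x ∈ V, ∃ c : L, x = algebraMap L N c := by
    intro x hx
    have happ : ∀ b ∈ V, ∃ c : Unit → L, (∀ i, algebraMap L N (c i) ∈ V) ∧
        V.valuation (b - ∑ i, algebraMap L N (c i) * (fun _ => (1 : N)) i) ≤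
          V.valuation (algebraMap L N ϖ) := by
      intro b hb
      obtain ⟨c, hc⟩ := h.2 b hb
      refine ⟨fun _ => c, fun _ => mem_of_valuation_sub_lt_one V hb hc, ?_⟩
      simp only [Finset.univ_unique, Finset.sum_singleton, mul_one]
      rcases eq_or_ne (b - algebraMap L N c) 0 with h0 | h0
      · rw [h0, map_zero]
        exact zero_le
      · obtain ⟨d, hd⟩ := h.1 _ h0
        rw [hd, ← valuation_restrict_le_iff]
        refine hϖ.le_of_lt_one ((valuation_restrict_lt_one_iff V d).2 ?_)
        rwa [← hd]
    obtain ⟨c, -, hc⟩ := exists_eq_sum_of_approx (ι := Unit) V hϖ (y := fun _ => 1)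
      (fun _ => V.one_mem) happ hx
    exact ⟨c (), by simpa using hc⟩
  intro x
  rcases V.mem_or_inv_mem x with hx | hx
  · obtain ⟨c, hc⟩ := hV x hx
    exact ⟨c, hc.symm⟩
  · obtain ⟨c, hc⟩ := hV _ hx
    exact ⟨c⁻¹, by rw [map_inv₀, ← hc, inv_inv]⟩

theorem surjective_of_isImmediate_composite {V : ValuationSubring N}
    [IsAdicComplete (maximalIdeal (restrict L V)) (restrict L V)]
    [IsDiscreteValuationRing (restrict L V)] [Algebra.IsAlgebraic L N]
    {B₀ : ValuationSubring (ResidueField V)} (h : IsImmediate L (composite V B₀))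
    (hmax : IsAlgebraicallyMaximal (B₀.comap (residueMap L V))) :
    Function.Surjective (algebraMap L N) := by
  let := (residueMap L V).toAlgebra
  have halg : Algebra.IsAlgebraic (ResidueField (restrict L V)) (ResidueField V) := by
    refine ⟨fun x => ?_⟩
    obtain ⟨y, rfl⟩ := residue_surjective x
    obtain ⟨f, hf, hfy⟩ := isIntegralElem_of_mem (K := L) V y.2
    refine IsIntegral.isAlgebraic (R := ResidueField (restrict L V)) ?_
    refine ⟨f.map (residue _), hf.map _, ?_⟩
    have h1 : Polynomial.eval₂ (integerMap L V) y f = 0 := by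
      refine Subtype.ext ?_
      change V.subtype (Polynomial.eval₂ (integerMap L V) y f) = 0
      rw [Polynomial.hom_eval₂]
      exact hfy
    have h2 := congrArg (residue V) h1
    rw [Polynomial.hom_eval₂, map_zero] at h2
    rw [Polynomial.eval₂_map]
    exact h2
  have hsurj : Function.Surjective (residueMap L V) :=
    hmax (ResidueField V) B₀ halg rfl (isImmediate_residueField h)
  have himm := (isImmediate_iff (K := L) _).1 h
  refine surjective_of_isImmediate V ((isImmediate_iff V).2 ⟨fun x hx => ?_, fun x hx => ?_⟩)
  · obtain ⟨c, hc⟩ := himm.1 x hx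
    exact ⟨c, valuation_eq_of_le (composite_le V B₀) hc⟩
  · obtain ⟨z, hz⟩ := hsurj (residue V ⟨x, hx⟩)
    obtain ⟨c, rfl⟩ := residue_surjective z
    refine ⟨c, ?_⟩
    rw [residueMap, ResidueField.map_residue] at hz
    exact (residue_eq_residue_iff V ⟨x, hx⟩ (integerMap L V c)).1 hz.symm

/-- The composite of a complete discrete valuation with an algebraically maximal valuation of its
residue field is algebraically maximal. -/
theorem isAlgebraicallyMaximal_composite (W : ValuationSubring L)
    [IsDiscreteValuationRing W] [IsAdicComplete (maximalIdeal W) W]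
    {A₀ : ValuationSubring (ResidueField W)} (hmax : IsAlgebraicallyMaximal A₀) :
    IsAlgebraicallyMaximal (composite W A₀) := by
  intro N _ _ B halg hB himm
  have hle : restrict L B ≤ W := hB ▸ composite_le W A₀
  have hV : restrict L (coarsening W B) = W := restrict_coarsening hle
  have hBV := le_coarsening W B
  generalize coarsening W B = V at hV hBV
  subst hV
  have hcomp := composite_residueImage hBV
  generalize residueImage B V hBV = B₀ at hcomp
  subst hcomp
  rw [restrict_composite] at hB
  rw [← composite_injective hB] at hmax
  exact surjective_of_isImmediate_composite himm hmax

end AlgebraicallyMaximal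

section Rank

variable {L : Type*} [Field L]

theorem ne_top_of_isDVR (W : ValuationSubring L) [IsDiscreteValuationRing W] : W ≠ ⊤ := by
  rintro rfl
  obtain ⟨ϖ, hϖ⟩ := exists_isUniformizer (⊤ : ValuationSubring L)
  rcases (ValuationSubring.mem_nonunits_iff_or _).1
    ((ValuationSubring.mem_nonunits_iff _).2 hϖ.lt_one) with h | h
  · exact hϖ.ne_zero h
  · exact h (ValuationSubring.mem_top _)

open scoped Classical in
/-- The composite of two discrete valuations has rank `2`. -/
theorem rank_composite_eq_two (W : ValuationSubring L) [IsDiscreteValuationRing W]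
    (A₀ : ValuationSubring (ResidueField W)) [IsDiscreteValuationRing A₀] :
    rank (composite W A₀) = 2 := by
  set A := composite W A₀ with hA
  have hAW : A ≤ W := composite_le W A₀
  have hWtop : W < ⊤ := lt_of_le_of_ne (ValuationSubring.le_top W) (ne_top_of_isDVR W)
  have hlt : A < W := by
    refine lt_of_le_of_ne hAW fun heq => ne_top_of_isDVR A₀ (composite_injective (W := W) ?_)
    rw [← hA, heq]
    ext x
    rw [mem_composite]
    exact ⟨fun h => ⟨h, ValuationSubring.mem_top _⟩, fun ⟨h, _⟩ => h⟩
  have hclass : ∀ S : {S // A ≤ S}, S.1 = A ∨ S.1 = W ∨ S.1 = ⊤ := by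
    rintro ⟨S, hS⟩
    rcases (ValuationSubring.le_total_ideal A).total ⟨S, hS⟩ ⟨W, hAW⟩ with h | h
    · have hSW : S ≤ W := h
      have hle : A₀ ≤ residueImage S W hSW := by
        intro x hx
        obtain ⟨y, rfl⟩ := residue_surjective x
        exact ⟨y, hS (mem_composite.2 ⟨y.2, hx⟩), rfl⟩
      rcases ValuationSubring.eq_self_or_eq_top_of_le hle with h1 | h1
      · left
        have h2 := composite_residueImage hSW
        rw [← h1] at h2
        exact h2.symm
      · right; left
        refine le_antisymm hSW fun x hx => ?_
        have h2 := composite_residueImage hSW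
        rw [h1] at h2
        change x ∈ S
        rw [← h2]
        exact mem_composite.2 ⟨hx, ValuationSubring.mem_top _⟩
    · rcases ValuationSubring.eq_self_or_eq_top_of_le (show W ≤ S from h) with h1 | h1
      · exact Or.inr (Or.inl h1.symm)
      · exact Or.inr (Or.inr h1)
  rw [rank, ringKrullDim, ← Order.krullDim_orderDual,
    Order.krullDim_eq_of_orderIso (ValuationSubring.primeSpectrumOrderEquiv A)]
  refine le_antisymm ?_ ?_
  · refine Order.le_of_lt_succ ?_
    refine lt_of_lt_of_le (Order.krullDim_lt_coe_iff (n := 3) |>.2 fun l => ?_) le_rfl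
    have hinj : Function.Injective fun i => (l i).1 :=
      Subtype.val_injective.comp l.strictMono.injective
    have hcard := Finset.card_le_card_of_injOn (s := Finset.univ)
      (t := ({A, W, ⊤} : Finset (ValuationSubring L))) (fun i => (l i).1)
      (fun i _ => by simpa using hclass (l i)) hinj.injOn
    have := hcard.trans Finset.card_le_three
    rw [Finset.card_univ, Fintype.card_fin] at this
    omega
  · refine (Order.le_krullDim_iff (n := 2)).2 ⟨⟨2, ![⟨A, le_rfl⟩, ⟨W, hAW⟩, ⟨⊤, hAW.trans hWtop.le⟩],
      fun i => ?_⟩, rfl⟩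
    fin_cases i
    · exact hlt
    · exact hWtop

end Rank

end ValuedField

/-! ### Completion at a principal maximal ideal -/

namespace ValuedField

open IsLocalRing

section Completion

universe u

/-- In a ring that is complete with respect to a principal maximal ideal, every nonzero element is
a unit times a power of the generator. -/
theorem exists_eq_pow_mul_of_isAdicComplete {S : Type*} [CommRing S] {ϖ : S}
    [(Ideal.span {ϖ}).IsMaximal] [IsAdicComplete (Ideal.span {ϖ}) S] {x : S} (hx : x ≠ 0) :
    ∃ (n : ℕ) (y : S), IsUnit y ∧ x = ϖ ^ n * y := by
  classical
  have := isLocalRing_of_isAdicComplete_maximal (Ideal.span {ϖ})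
  have hm : maximalIdeal S = Ideal.span {ϖ} := (eq_maximalIdeal inferInstance).symm
  have hex : ∃ n : ℕ, ¬ ϖ ^ n ∣ x := by
    by_contra! hall
    refine hx (IsHausdorff.haus (I := Ideal.span {ϖ}) inferInstance x fun n => ?_)
    rw [SModEq.zero, smul_eq_mul, Ideal.mul_top, Ideal.span_singleton_pow,
      Ideal.mem_span_singleton]
    exact hall n
  obtain ⟨n, hn⟩ : ∃ n, Nat.find hex = n + 1 :=
    Nat.exists_eq_succ_of_ne_zero fun h0 => Nat.find_spec hex (by rw [h0]; simp)
  have h1 : ϖ ^ n ∣ x := by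
    by_contra h
    have := Nat.find_min' hex h
    omega
  obtain ⟨y, rfl⟩ := h1
  refine ⟨n, y, ?_, rfl⟩
  by_contra hy
  have h2 : y ∈ Ideal.span {ϖ} := hm ▸ (mem_maximalIdeal y).2 hy
  obtain ⟨z, rfl⟩ := Ideal.mem_span_singleton.1 h2
  refine Nat.find_spec hex ?_
  rw [hn]
  exact ⟨z, by ring⟩

theorem pow_mul_eq_zero_of_regular {S : Type*} [CommRing S] {ϖ : S}
    (hreg : ∀ x, ϖ * x = 0 → x = 0) (n : ℕ) (x : S) (h : ϖ ^ n * x = 0) : x = 0 := by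
  induction n generalizing x with
  | zero => simpa using h
  | succ n ih => exact hreg _ (ih _ (by rw [← h]; ring))

theorem isDomain_of_isAdicComplete {S : Type*} [CommRing S] {ϖ : S}
    (hreg : ∀ x, ϖ * x = 0 → x = 0)
    [hmax : (Ideal.span {ϖ}).IsMaximal] [IsAdicComplete (Ideal.span {ϖ}) S] : IsDomain S := by
  have := isLocalRing_of_isAdicComplete_maximal (Ideal.span {ϖ})
  have : NoZeroDivisors S := by
    refine ⟨fun {a b} hab => ?_⟩
    by_contra! h
    obtain ⟨n, y, hy, rfl⟩ := exists_eq_pow_mul_of_isAdicComplete (ϖ := ϖ) h.1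
    obtain ⟨m, z, hz, rfl⟩ := exists_eq_pow_mul_of_isAdicComplete (ϖ := ϖ) h.2
    have h0 := pow_mul_eq_zero_of_regular hreg (n + m) (y * z) (by rw [← hab]; ring)
    exact not_isUnit_zero (h0 ▸ hy.mul hz)
  exact NoZeroDivisors.to_isDomain S

/-- A ring that is complete with respect to a principal maximal ideal with a regular generator is
the valuation ring of a complete discrete valuation of its field of fractions. -/
theorem exists_ringEquiv_valuationSubring {S : Type*} [CommRing S] {ϖ : S}
    (hreg : ∀ x, ϖ * x = 0 → x = 0)
    [hmax : (Ideal.span {ϖ}).IsMaximal] [IsAdicComplete (Ideal.span {ϖ}) S]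
    (L : Type*) [Field L] [Algebra S L] [IsFractionRing S L] :
    ∃ (W : ValuationSubring L) (e : S ≃+* W), (∀ x, (e x : L) = algebraMap S L x) ∧
      IsDiscreteValuationRing W ∧ IsAdicComplete (maximalIdeal W) W ∧
        maximalIdeal W = Ideal.span {e ϖ} := by
  have := isLocalRing_of_isAdicComplete_maximal (Ideal.span {ϖ})
  have hm : maximalIdeal S = Ideal.span {ϖ} := (eq_maximalIdeal inferInstance).symm
  have hdom : IsDomain S := isDomain_of_isAdicComplete hreg
  have hϖ0 : ϖ ≠ 0 := fun h0 => one_ne_zero (hreg 1 (by rw [h0, zero_mul]))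
  have hdvr : IsDiscreteValuationRing S :=
    IsDiscreteValuationRing.ofHasUnitMulPowIrreducibleFactorization
      ⟨ϖ, ((Ideal.span_singleton_prime hϖ0).1 hmax.isPrime).irreducible, fun {x} hx => by
        obtain ⟨n, y, hy, rfl⟩ := exists_eq_pow_mul_of_isAdicComplete (ϖ := ϖ) hx
        exact ⟨n, hy.unit, rfl⟩⟩
  let W : ValuationSubring L := ⟨(algebraMap S L).range, ValuationRing.isInteger_or_isInteger S⟩
  have hinj : Function.Injective (algebraMap S L) := IsFractionRing.injective S L
  let e : S ≃+* W := RingEquiv.ofBijective (algebraMap S L).rangeRestrict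
    ⟨fun x y h => hinj (congrArg Subtype.val h), (algebraMap S L).rangeRestrict_surjective⟩
  have hmap : maximalIdeal W = (Ideal.span {ϖ}).map e := by
    rw [← hm]
    exact (map_ringEquiv_maximalIdeal e).symm
  refine ⟨W, e, fun _ => rfl,
    IsDiscreteValuationRing.RingEquivClass.isDiscreteValuationRing e, ?_, ?_⟩
  · rw [hmap]
    exact (IsAdicComplete.congr_ringEquiv (Ideal.span {ϖ}) e).2 inferInstance
  · rw [hmap, Ideal.map_span, Set.image_singleton]

/-- If `φ : R → k` is a surjective homomorphism to a field whose kernel is generated by a regular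
element `ϖ`, then the `ϖ`-adic completion of `R` is the valuation ring of a complete discrete
valuation with uniformizer `ϖ` and residue field `k`. -/
theorem exists_completion {R k : Type u} [CommRing R] [Field k] (φ : R →+* k)
    (hφ : Function.Surjective φ) {ϖ : R} (hker : RingHom.ker φ = Ideal.span {ϖ})
    (hreg : ∀ x, ϖ * x = 0 → x = 0) :
    ∃ (L : Type u) (_ : Field L) (W : ValuationSubring L) (f : R →+* W) (ψ : W →+* k),
      IsDiscreteValuationRing W ∧ IsAdicComplete (maximalIdeal W) W ∧
        maximalIdeal W = Ideal.span {f ϖ} ∧ (∀ r, ψ (f r) = φ r) ∧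
        RingHom.ker ψ = maximalIdeal W := by
  set I := Ideal.span {ϖ} with hI
  have hImax : I.IsMaximal := hker ▸ RingHom.ker_isMaximal_of_surjective φ hφ
  have hfg : I.FG := ⟨{ϖ}, by simp [hI]⟩
  let S := AdicCompletion I R
  let g : R →+* S := algebraMap R S
  have hmapI : I.map g = Ideal.span {g ϖ} := by
    conv_lhs => arg 2; rw [hI]
    rw [Ideal.map_span, Set.image_singleton]
  have hS : IsAdicComplete (Ideal.span {g ϖ}) S := hmapI ▸ AdicCompletion.isAdicComplete_self I hfg
  have hSmax : (Ideal.span {g ϖ}).IsMaximal :=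
    hmapI ▸ AdicCompletion.isMaximal_map_of_le I I le_rfl hfg
  have hregS : ∀ x : S, g ϖ * x = 0 → x = 0 := by
    intro x hx
    -- `x` vanishes modulo `ϖ ^ n` because `ϖ * x` vanishes modulo `ϖ ^ (n + 1)`.
    refine AdicCompletion.ext_evalₐ fun n => ?_
    obtain ⟨r, hr⟩ := Ideal.Quotient.mk_surjective (AdicCompletion.evalₐ I (n + 1) x)
    have h1 := congrArg (AdicCompletion.evalₐ I (n + 1)) hx
    rw [map_mul, map_zero, ← hr, AlgHom.commutes, Ideal.Quotient.algebraMap_eq, ← map_mul,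
      Ideal.Quotient.eq_zero_iff_mem, hI, Ideal.span_singleton_pow, Ideal.mem_span_singleton] at h1
    obtain ⟨c, hc⟩ := h1
    have h2 : r = ϖ ^ n * c := by
      rw [← sub_eq_zero]
      exact hreg _ (by rw [mul_sub, hc]; ring)
    have h3 : AdicCompletion.evalₐ I n x = Ideal.Quotient.factorPow I (Nat.le_succ n)
        (AdicCompletion.evalₐ I (n + 1) x) := by
      obtain ⟨y, rfl⟩ := AdicCompletion.mk_surjective I R x
      rw [AdicCompletion.evalₐ_mk, AdicCompletion.evalₐ_mk]
      change _ = Ideal.Quotient.mk _ _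
      rw [Ideal.Quotient.mk_eq_mk_iff_sub_mem]
      have := y.2 (Nat.le_succ n)
      rw [SModEq.sub_mem] at this
      simpa using this
    rw [h3, ← hr, map_zero, h2]
    change Ideal.Quotient.mk _ _ = 0
    rw [Ideal.Quotient.eq_zero_iff_mem, hI, Ideal.span_singleton_pow, Ideal.mem_span_singleton]
    exact ⟨c, rfl⟩
  have hdom : IsDomain S := isDomain_of_isAdicComplete hregS
  obtain ⟨W, e, -, hW, hWc, hWm⟩ := exists_ringEquiv_valuationSubring hregS (FractionRing S)
  let ψ₀ : R ⧸ I →+* k := Ideal.Quotient.lift I φ fun a ha => by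
    rwa [← hker, RingHom.mem_ker] at ha
  refine ⟨FractionRing S, inferInstance, W, (e : S →+* W).comp g,
    (ψ₀.comp (AdicCompletion.evalOneₐ I : S →+* R ⧸ I)).comp (e.symm : W →+* S),
    hW, hWc, hWm, fun r => ?_, ?_⟩
  · simp [ψ₀, g]
  · have : (RingHom.ker ((ψ₀.comp (AdicCompletion.evalOneₐ I : S →+* R ⧸ I)).comp
        (e.symm : W →+* S))).IsMaximal := by
      have hψ₀ : Function.Surjective ψ₀ := Ideal.Quotient.lift_surjective_of_surjective I _ hφ
      exact RingHom.ker_isMaximal_of_surjective _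
        ((hψ₀.comp (AdicCompletion.evalOneₐ_surjective I)).comp e.symm.surjective)
    exact eq_maximalIdeal this

end Completion

end ValuedField

/-! ### `p`-independence and transcendence -/

namespace ValuedField

open IsLocalRing IntermediateField

section PIndependence

variable {E : Type*} [Field E] {p : ℕ}

/-- The subfield of `E` generated by a subfield `S` and an element `a`. -/
def adjoinElement (S : Subfield E) (a : E) : Subfield E :=
  (IntermediateField.adjoin S {a}).toSubfield

theorem le_adjoinElement (S : Subfield E) (a : E) : S ≤ adjoinElement S a :=
  fun x hx => (IntermediateField.adjoin S {a}).algebraMap_mem ⟨x, hx⟩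

theorem self_mem_adjoinElement (S : Subfield E) (a : E) : a ∈ adjoinElement S a :=
  IntermediateField.mem_adjoin_simple_self S a

theorem adjoinElement_le {S T : Subfield E} {a : E} (hS : S ≤ T) (ha : a ∈ T) :
    adjoinElement S a ≤ T := by
  refine IntermediateField.adjoin_le_subfield _ _ ?_ (by simpa using ha)
  rintro _ ⟨x, rfl⟩
  exact hS x.2

theorem algebraMap_mk {S : Subfield E} {a : E} (ha : a ∈ S) : algebraMap S E ⟨a, ha⟩ = a := rfl

theorem minpoly_eq_X_pow_sub_C [CharP E p] (hp : p.Prime) {S : Subfield E} {a : E}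
    (ha : a ^ p ∈ S) (haS : a ∉ S) :
    minpoly S a = Polynomial.X ^ p - Polynomial.C (⟨a ^ p, ha⟩ : S) := by
  have := Fact.mk hp
  refine (minpoly.eq_of_irreducible_of_monic ?_ ?_ (Polynomial.monic_X_pow_sub_C _ hp.ne_zero)).symm
  · refine X_pow_sub_C_irreducible_of_prime hp fun b hb => haS ?_
    have h1 : (b : E) ^ p = a ^ p := congrArg Subtype.val hb
    have h2 : (b : E) = a := frobenius_inj E p h1
    exact h2 ▸ b.2
  · simp [algebraMap_mk]

theorem finrank_adjoin_eq [CharP E p] (hp : p.Prime) {S : Subfield E} {a : E}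
    (ha : a ^ p ∈ S) (haS : a ∉ S) : Module.finrank S (IntermediateField.adjoin S {a}) = p := by
  have hm := minpoly_eq_X_pow_sub_C hp ha haS
  have hint : IsIntegral S a :=
    ⟨_, Polynomial.monic_X_pow_sub_C (⟨a ^ p, ha⟩ : S) hp.ne_zero, by simp [algebraMap_mk]⟩
  rw [IntermediateField.adjoin.finrank hint, hm, Polynomial.natDegree_X_pow_sub_C]

theorem eq_zero_of_sum_pow [CharP E p] (hp : p.Prime) {S : Subfield E} {a : E}
    (ha : a ^ p ∈ S) (haS : a ∉ S) {c : Fin p → E} (hc : ∀ i, c i ∈ S)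
    (h : ∑ i, c i * a ^ (i : ℕ) = 0) (i : Fin p) : c i = 0 := by
  have hm := minpoly_eq_X_pow_sub_C hp ha haS
  have hli := linearIndependent_pow (K := S) a
  rw [hm, Polynomial.natDegree_X_pow_sub_C, Fintype.linearIndependent_iff] at hli
  have := hli (fun i => ⟨c i, hc i⟩) (by simpa [Subfield.smul_def] using h) i
  exact congrArg Subtype.val this

theorem exists_eq_sum_pow (hp : p.Prime) {S : Subfield E} {a : E}
    (ha : a ^ p ∈ S) {x : E} (hx : x ∈ adjoinElement S a) :
    ∃ c : Fin p → E, (∀ i, c i ∈ S) ∧ x = ∑ i, c i * a ^ (i : ℕ) := by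
  have hmonic := Polynomial.monic_X_pow_sub_C (⟨a ^ p, ha⟩ : S) hp.ne_zero
  have hint : IsIntegral S a := ⟨_, hmonic, by simp [algebraMap_mk]⟩
  have hx' : x ∈ (IntermediateField.adjoin S {a}).toSubalgebra := hx
  rw [IntermediateField.adjoin_simple_toSubalgebra_of_isAlgebraic hint.isAlgebraic,
    Algebra.adjoin_singleton_eq_range_aeval] at hx'
  obtain ⟨f, rfl⟩ := hx'
  refine ⟨fun i => (f %ₘ (Polynomial.X ^ p - Polynomial.C (⟨a ^ p, ha⟩ : S))).coeff i,
    fun i => SetLike.coe_mem _, ?_⟩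
  have h1 := Polynomial.aeval_modByMonic_eq_self_of_root (p := f) (x := a)
    (q := Polynomial.X ^ p - Polynomial.C (⟨a ^ p, ha⟩ : S)) (by simp [algebraMap_mk])
  have h2 := Polynomial.natDegree_modByMonic_lt f hmonic fun h => by
    have := congrArg Polynomial.natDegree h
    rw [Polynomial.natDegree_X_pow_sub_C, Polynomial.natDegree_one] at this
    exact hp.ne_zero this
  rw [Polynomial.natDegree_X_pow_sub_C] at h2
  change (Polynomial.aeval a) f = _
  rw [← h1, Polynomial.aeval_eq_sum_range' h2, Finset.sum_range]
  rfl

/-- The exchange property for purely inseparable extensions of degree `p`. -/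
theorem mem_adjoinElement_exchange [CharP E p] (hp : p.Prime) {S : Subfield E} {a y : E}
    (ha : a ^ p ∈ S) (hy : y ∈ adjoinElement S a) (hyS : y ∉ S) : a ∈ adjoinElement S y := by
  have haS : a ∉ S := fun h => hyS (adjoinElement_le le_rfl h hy)
  have hle : IntermediateField.adjoin S {y} ≤ IntermediateField.adjoin S {a} :=
    IntermediateField.adjoin_simple_le_iff.2 hy
  have hfin := finrank_adjoin_eq hp ha haS
  have : FiniteDimensional S (IntermediateField.adjoin S {a}) :=
    Module.finite_of_finrank_pos (by rw [hfin]; exact hp.pos)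
  have hdvd := IntermediateField.finrank_dvd_of_le_right hle
  rw [hfin] at hdvd
  rcases (Nat.dvd_prime hp).1 hdvd with h | h
  · rw [IntermediateField.finrank_adjoin_simple_eq_one_iff, IntermediateField.mem_bot] at h
    obtain ⟨z, rfl⟩ := h
    exact absurd z.2 hyS
  · have := IntermediateField.eq_of_le_of_finrank_eq hle (h.trans hfin.symm)
    change a ∈ IntermediateField.adjoin S {y}
    rw [this]
    exact IntermediateField.mem_adjoin_simple_self S a

variable [CharP E p]

/-- Subfields `L` of a field `E` of characteristic `p` that are generated over `L ^ p` by two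
elements `t` and `u = r ^ p + t * s ^ p`, where `t` is not a `p`-th power in `E` and `s ^ p` is not
in `L`. -/
structure IsGeneratedPair (p : ℕ) [ExpChar E p] (L : Subfield E) (t u r s : E) : Prop where
  mem_left : t ∈ L
  mem_right : u ∈ L
  le_adjoin : L ≤ adjoinElement (adjoinElement (L.map (frobenius E p)) t) u
  eq_add : u = r ^ p + t * s ^ p
  pow_notMem : s ^ p ∉ L
  not_pow : ∀ x : E, x ^ p ≠ t

variable [hp : Fact p.Prime] {L : Subfield E} {t u r s : E}

theorem map_frobenius_le (L : Subfield E) : L.map (frobenius E p) ≤ L := by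
  rintro _ ⟨x, hx, rfl⟩
  exact L.pow_mem hx p

theorem pow_mem_map_frobenius {x : E} (hx : x ∈ L) : x ^ p ∈ L.map (frobenius E p) :=
  ⟨x, hx, rfl⟩

namespace IsGeneratedPair

/-- The coefficient of `t` in an expansion of `u` in powers of `t` over `E ^ p` is `s ^ p`. -/
theorem pow_eq_of_eq_sum (h : IsGeneratedPair p L t u r s) {c : Fin p → E}
    (hc : ∀ i, c i ∈ (frobenius E p).fieldRange) (hu : u = ∑ i, c i * t ^ (i : ℕ)) :
    c ⟨1, hp.out.one_lt⟩ = s ^ p := by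
  have := eq_zero_of_sum_pow hp.out (S := (frobenius E p).fieldRange) (a := t) ⟨t, rfl⟩
    (fun ⟨x, hx⟩ => h.not_pow x hx)
    (c := fun i => c i - (if (i : ℕ) = 0 then r ^ p else 0) - (if (i : ℕ) = 1 then s ^ p else 0))
    (fun i => ?_) ?_ ⟨1, hp.out.one_lt⟩
  · simpa [sub_eq_zero] using this
  · refine sub_mem (sub_mem (hc i) ?_) ?_
    · split_ifs
      exacts [⟨r, rfl⟩, zero_mem _]
    · split_ifs
      exacts [⟨s, rfl⟩, zero_mem _]
  · simp only [sub_mul, Finset.sum_sub_distrib, ite_mul, zero_mul, ← hu]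
    have h0 : ∀ (k : ℕ) (hk : k < p) (z : E), (∑ i : Fin p, if (i : ℕ) = k then z * t ^ (i : ℕ)
        else 0) = z * t ^ k := by
      intro k hk z
      rw [Finset.sum_eq_single ⟨k, hk⟩ (fun i _ hi => if_neg fun h => hi (Fin.ext h))
        (fun h => absurd (Finset.mem_univ _) h)]
      simp
    rw [h0 0 hp.out.pos, h0 1 hp.out.one_lt, h.eq_add]
    ring

/-- `L` is closed under `p`-th roots in `E`. Otherwise some `x ^ p` lies in `L = L ^ p (t, u)` but not
in `L ^ p (t)`, and by exchange `u` is a polynomial in `t` with coefficients in `L ^ p (x ^ p)`.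
Since `1, t, …, t ^ (p - 1)` are independent over `E ^ p`, comparison with `u = r ^ p + t * s ^ p`
puts `s ^ p` into `L`. -/
theorem mem_of_pow_mem (h : IsGeneratedPair p L t u r s) {x : E} (hx : x ^ p ∈ L) : x ∈ L := by
  set K := L.map (frobenius E p) with hK
  by_contra hxL
  have hKE : K ≤ (frobenius E p).fieldRange := by
    rintro _ ⟨z, -, rfl⟩
    exact ⟨z, rfl⟩
  have hyK : x ^ p ∉ K := by
    rintro ⟨z, hz, hzx⟩
    exact hxL (frobenius_inj E p hzx ▸ hz)
  have htp : t ^ p ∈ K := pow_mem_map_frobenius h.mem_left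
  have htE : t ∉ (frobenius E p).fieldRange := fun ⟨x, hx⟩ => h.not_pow x hx
  have hyt : x ^ p ∉ adjoinElement K t := by
    intro hy
    obtain ⟨c, hc, hcx⟩ := exists_eq_sum_pow hp.out htp hy
    have h0 : x ^ p = c ⟨0, hp.out.pos⟩ := by
      have := eq_zero_of_sum_pow hp.out (S := (frobenius E p).fieldRange) (a := t) ⟨t, rfl⟩ htE
        (c := fun i => c i - if (i : ℕ) = 0 then x ^ p else 0) (fun i => ?_) ?_ ⟨0, hp.out.pos⟩
      · exact (sub_eq_zero.1 (by simpa using this)).symm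
      · refine sub_mem (hKE (hc i)) ?_
        split_ifs
        exacts [⟨x, rfl⟩, zero_mem _]
      · simp only [sub_mul, Finset.sum_sub_distrib, ite_mul, zero_mul, ← hcx]
        rw [Finset.sum_eq_single ⟨0, hp.out.pos⟩ (fun i _ hi => if_neg fun h => hi (Fin.ext h))
          (fun h => absurd (Finset.mem_univ _) h)]
        simp
    exact hyK (h0 ▸ hc _)
  have hup : u ^ p ∈ adjoinElement K t :=
    le_adjoinElement K t (pow_mem_map_frobenius h.mem_right)
  have hu := mem_adjoinElement_exchange hp.out hup (h.le_adjoin hx) hyt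
  have hu' : u ∈ adjoinElement (adjoinElement K (x ^ p)) t :=
    adjoinElement_le (adjoinElement_le
      ((le_adjoinElement K (x ^ p)).trans (le_adjoinElement _ t)) (self_mem_adjoinElement _ t))
      (le_adjoinElement _ t (self_mem_adjoinElement K (x ^ p))) hu
  obtain ⟨c, hc, hcu⟩ := exists_eq_sum_pow hp.out (le_adjoinElement K (x ^ p) htp) hu'
  have hcE : ∀ i, c i ∈ (frobenius E p).fieldRange := fun i =>
    adjoinElement_le hKE ⟨x, rfl⟩ (hc i)
  refine h.pow_notMem ?_
  rw [← h.pow_eq_of_eq_sum hcE hcu]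
  exact adjoinElement_le (map_frobenius_le L) hx (hc _)

/-- The elements `t ^ i * u ^ j` with `i, j < p` are linearly independent over `L ^ p`. -/
theorem eq_zero_of_sum (h : IsGeneratedPair p L t u r s) {c : Fin p × Fin p → E}
    (hc : ∀ i, c i ∈ L) (hsum : ∑ i, c i ^ p * (t ^ (i.1 : ℕ) * u ^ (i.2 : ℕ)) = 0)
    (i : Fin p × Fin p) : c i = 0 := by
  set K := L.map (frobenius E p) with hK
  have hKE : K ≤ (frobenius E p).fieldRange := by
    rintro _ ⟨z, -, rfl⟩
    exact ⟨z, rfl⟩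
  have htp : t ^ p ∈ K := pow_mem_map_frobenius h.mem_left
  have htK : t ∉ K := fun ht => by
    obtain ⟨x, hx⟩ := hKE ht
    exact h.not_pow x hx
  have hup : u ^ p ∈ adjoinElement K t :=
    le_adjoinElement K t (pow_mem_map_frobenius h.mem_right)
  have hut : u ∉ adjoinElement K t := by
    intro hu
    obtain ⟨c, hc, hcu⟩ := exists_eq_sum_pow hp.out htp hu
    refine h.pow_notMem ?_
    rw [← h.pow_eq_of_eq_sum (fun i => hKE (hc i)) hcu]
    exact map_frobenius_le L (hc _)
  have hcK : ∀ i, c i ^ p ∈ K := fun i => pow_mem_map_frobenius (hc i)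
  have h1 := eq_zero_of_sum_pow hp.out hup hut
    (c := fun j => ∑ i, c (i, j) ^ p * t ^ (i : ℕ))
    (fun j => sum_mem fun i _ => mul_mem (le_adjoinElement K t (hcK _))
      (pow_mem (self_mem_adjoinElement K t) _)) (by
      rw [← hsum, Fintype.sum_prod_type_right]
      refine Finset.sum_congr rfl fun j _ => ?_
      rw [Finset.sum_mul]
      exact Finset.sum_congr rfl fun i _ => mul_assoc _ _ _) i.2
  have h2 := eq_zero_of_sum_pow hp.out htp htK (c := fun k => c (k, i.2) ^ p)
    (fun k => hcK _) h1 i.1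
  exact eq_zero_of_pow_eq_zero (n := p) h2

end IsGeneratedPair

end PIndependence

section Transcendence

theorem algebraicIndependent_and_transcendental {R E : Type*} [CommRing R] [Nontrivial R] [Field E]
    [Algebra R E] {t s u : E} (ht : Transcendental R t)
    (hs : Transcendental (Algebra.adjoin R {t}) s)
    (hu : Transcendental (Algebra.adjoin R {t, s}) u) :
    AlgebraicIndependent R ![t, u] ∧ Transcendental (Algebra.adjoin R {t, u}) s := by
  let x₀ : Unit → E := fun _ => t
  let x₁ : Option Unit → E := fun o => o.elim s x₀
  let x₂ : Option (Option Unit) → E := fun o => o.elim u x₁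
  have r₀ : Set.range x₀ = {t} := Set.range_const
  have r₁ : Set.range x₁ = {t, s} := by
    ext z; simp [x₁, x₀, Option.exists, eq_comm, or_comm]
  have h₀ : AlgebraicIndependent R x₀ := algebraicIndependent_unique_type_iff.2 ht
  have h₁ : AlgebraicIndependent R x₁ := (h₀.option_iff_transcendental s).2 (by rwa [r₀])
  have h₂ : AlgebraicIndependent R x₂ := (h₁.option_iff_transcendental u).2 (by rwa [r₁])
  constructor
  · have := h₂.comp ![some (some ()), none] (by decide)
    convert this using 1
    ext i
    fin_cases i <;> rfl
  · have := h₂.transcendental_adjoin (s := {some (some ()), none}) (i := some none) (by simp)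
    rwa [Set.image_pair] at this

theorem countable_adjoin {R E : Type*} [CommRing R] [Countable R] [CommRing E] [Algebra R E]
    {T : Set E} (hT : T.Countable) : Countable (Algebra.adjoin R T) := by
  have := hT.to_subtype
  have hc : Countable (MvPolynomial T R) := by
    rw [← Cardinal.mk_le_aleph0_iff]
    exact (MvPolynomial.cardinalMk_le_max_lift (σ := T) (R := R)).trans (by simp)
  rw [← Subtype.range_coe (s := T), Algebra.adjoin_range_eq_range_aeval]
  exact (MvPolynomial.aeval (R := R) ((↑) : T → E)).rangeRestrict_surjective.countable

theorem exists_transcendental {R E : Type*} [CommRing R] [Countable R] [Field E] [Algebra R E]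
    {T : Set E} (hT : T.Countable) {V : Set E} (hV : ¬ V.Countable) :
    ∃ x ∈ V, Transcendental (Algebra.adjoin R T) x := by
  have := countable_adjoin (R := R) hT
  by_contra! h
  refine hV ((Algebraic.countable (Algebra.adjoin R T) E).mono fun x hx => ?_)
  exact not_not.1 (h x hx)

end Transcendence

end ValuedField

/-! ### The relative separable closure of a rational function field -/

namespace ValuedField

open IsLocalRing
open scoped IntermediateField.algebraAdjoinAdjoin

section Construction

variable {E : Type*} [Field E] {p : ℕ} [hp : Fact p.Prime] [CharP E p] [Algebra (ZMod p) E]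

omit [CharP E p] in
theorem algebraMap_zmod_mem (S : Subring E) (c : ZMod p) : algebraMap (ZMod p) E c ∈ S := by
  rw [← ZMod.natCast_zmod_val c, map_natCast]
  exact natCast_mem S _

omit [CharP E p] in
theorem transcendental_of_valuation_lt_one {A : ValuationSubring E} {t : E} (ht0 : t ≠ 0)
    (ht : A.valuation t < 1) : Transcendental (ZMod p) t := by
  intro halg
  obtain ⟨c, hc0, hc⟩ := exists_valuation_le A ht0 halg
  have h1 := (A.valuation_le_one_iff _).2 (algebraMap_zmod_mem A.toSubring c⁻¹)
  have h2 : A.valuation (algebraMap (ZMod p) E c * algebraMap (ZMod p) E c⁻¹) < 1 := by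
    rw [map_mul]
    exact mul_lt_one_of_nonneg_of_lt_one_left zero_le (hc.trans_lt ht) h1
  rw [← map_mul, mul_inv_cancel₀ hc0, map_one, map_one] at h2
  exact lt_irrefl _ h2

omit [CharP E p] in
/-- In an uncountable valuation ring of characteristic `p`, an element `t` of positive value can be
complemented by an element `u` of the same value that is transcendental over `t` and has the form
`r ^ p + t * s ^ p`, with `s` transcendental over `t` and `u`. -/
theorem exists_complement {A : ValuationSubring E} (hA : Uncountable A) {t : E} (ht0 : t ≠ 0)
    (ht : A.valuation t < 1) :
    ∃ u r s : E, u = r ^ p + t * s ^ p ∧ A.valuation u = A.valuation t ∧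
      AlgebraicIndependent (ZMod p) ![t, u] ∧
      Transcendental (Algebra.adjoin (ZMod p) {t, u}) s := by
  have himg : ∀ f : E → E, Function.Injective f → ¬ (f '' (A : Set E)).Countable := by
    intro f hf h
    have h1 : (A : Set E).Countable := (Set.mapsTo_image f _).countable_of_injOn hf.injOn h
    exact not_countable (α := A) h1.to_subtype
  obtain ⟨s, ⟨s₀, hs₀, rfl⟩, hs⟩ := exists_transcendental (R := ZMod p) (T := {t})
    (Set.countable_singleton t) (himg (fun x => 1 + t * x) fun x y h =>
      mul_left_cancel₀ ht0 (add_left_cancel h))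
  set s := 1 + t * s₀ with hsdef
  obtain ⟨r, ⟨r₀, hr₀, rfl⟩, hr⟩ := exists_transcendental (R := ZMod p) (T := {t, s})
    ((Set.countable_singleton s).insert t) (himg (fun x => t * x) fun x y h =>
      mul_left_cancel₀ ht0 h)
  set r := t * r₀ with hrdef
  have hmem : ∀ x ∈ ({t, s} : Set E), IsAlgebraic (Algebra.adjoin (ZMod p) {t, s}) x := fun x hx =>
    isAlgebraic_algebraMap (⟨x, Algebra.subset_adjoin hx⟩ : Algebra.adjoin (ZMod p) {t, s})
  have hu : Transcendental (Algebra.adjoin (ZMod p) {t, s}) (r ^ p + t * s ^ p) := by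
    intro hu
    refine hr (IsAlgebraic.of_pow hp.out.pos ?_)
    have := hu.sub ((hmem t (by simp)).mul ((hmem s (by simp)).pow p))
    rwa [add_sub_cancel_right] at this
  obtain ⟨h1, h2⟩ := algebraicIndependent_and_transcendental
    (transcendental_of_valuation_lt_one ht0 ht) hs hu
  refine ⟨_, r, s, rfl, ?_, h1, h2⟩
  -- The choice `s ∈ 1 + t A` and `r ∈ t A` makes `t * s ^ p` the dominant term of `u`.
  have hvs : A.valuation s = 1 := by
    rw [hsdef, Valuation.map_add_eq_of_lt_left, map_one]
    rw [map_mul, map_one]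
    exact mul_lt_one_of_nonneg_of_lt_one_left zero_le ht ((A.valuation_le_one_iff _).2 hs₀)
  have hvt : A.valuation (t * s ^ p) = A.valuation t := by
    rw [map_mul, map_pow, hvs, one_pow, mul_one]
  rw [Valuation.map_add_eq_of_lt_right, hvt]
  have hpos : 0 < A.valuation t := zero_lt_iff.2 (by simpa using ht0)
  have hvr : A.valuation r ≤ A.valuation t := by
    rw [hrdef, map_mul]
    exact mul_le_of_le_one_right' ((A.valuation_le_one_iff _).2 hr₀)
  calc A.valuation (r ^ p) = A.valuation r ^ p := map_pow _ _ _
    _ ≤ A.valuation t ^ p := pow_le_pow_left₀ zero_le hvr p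
    _ < A.valuation t := pow_lt_self_of_lt_one₀ hpos ht hp.out.one_lt
    _ = A.valuation (t * s ^ p) := hvt.symm

omit [CharP E p] in
theorem isAlgebraic_adjoin_iff {T : Set E} {x : E} :
    IsAlgebraic (Algebra.adjoin (ZMod p) T) x ↔
      IsAlgebraic (IntermediateField.adjoin (ZMod p) T) x :=
  IsFractionRing.isAlgebraic_iff _ _ _

/-- The relative separable-algebraic closure of `F_p(t, u)` in `E`. -/
noncomputable def separableSubfield (p : ℕ) [Fact p.Prime] [Algebra (ZMod p) E] (t u : E) :
    Subfield E :=
  (separableClosure (IntermediateField.adjoin (ZMod p) {t, u}) E).toSubfield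

omit [CharP E p] in
theorem mem_separableSubfield {t u x : E} :
    x ∈ separableSubfield p t u ↔ IsSeparable (IntermediateField.adjoin (ZMod p) {t, u}) x :=
  mem_separableClosure_iff

omit [CharP E p] in
theorem isAlgebraic_of_mem_separableSubfield {t u x : E} (hx : x ∈ separableSubfield p t u) :
    IsAlgebraic (Algebra.adjoin (ZMod p) {t, u}) x :=
  isAlgebraic_adjoin_iff.2 (mem_separableSubfield.1 hx).isIntegral.isAlgebraic

omit [CharP E p] [Algebra (ZMod p) E] in
theorem not_pow_of_isUniformizer {A : ValuationSubring E} {t : E} (ht : IsUniformizer A t) (x : E) :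
    x ^ p ≠ t := by
  intro h
  have hx : x ≠ 0 := by
    rintro rfl
    rw [zero_pow hp.out.ne_zero] at h
    exact ht.ne_zero h.symm
  obtain ⟨n, hn⟩ := ht.exists_zpow x hx
  have h1 := congrArg A.valuation h
  rw [map_pow, hn, ← zpow_natCast, ← zpow_mul] at h1
  have h2 : n * p = 1 := zpow_right_injective₀ ht.valuation_pos ht.lt_one.ne (by simpa using h1)
  have h3 := Int.isUnit_iff.1 (IsUnit.of_mul_eq_one_right n h2)
  have := hp.out.one_lt
  omega

theorem isGeneratedPair_separableSubfield {A : ValuationSubring E} {t u r s : E}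
    (ht : IsUniformizer A t) (hu : u = r ^ p + t * s ^ p)
    (hs : Transcendental (Algebra.adjoin (ZMod p) {t, u}) s) :
    IsGeneratedPair p (separableSubfield p t u) t u r s where
  mem_left := mem_separableSubfield.2 (isSeparable_algebraMap
    (⟨t, IntermediateField.subset_adjoin _ _ (by simp)⟩ : IntermediateField.adjoin (ZMod p) {t, u}))
  mem_right := mem_separableSubfield.2 (isSeparable_algebraMap
    (⟨u, IntermediateField.subset_adjoin _ _ (by simp)⟩ : IntermediateField.adjoin (ZMod p) {t, u}))
  le_adjoin := by
    intro x hx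
    set T := adjoinElement (adjoinElement ((separableSubfield p t u).map (frobenius E p)) t) u
    have hF : (IntermediateField.adjoin (ZMod p) {t, u}).toSubfield ≤ T := by
      refine IntermediateField.adjoin_le_subfield _ _ ?_ ?_
      · rintro _ ⟨c, rfl⟩
        exact algebraMap_zmod_mem T.toSubring c
      · rintro y (rfl | rfl)
        · exact le_adjoinElement _ _ (self_mem_adjoinElement _ _)
        · exact self_mem_adjoinElement _ _
    have hExp : ExpChar (IntermediateField.adjoin (ZMod p) {t, u}) p :=
      expChar_of_injective_algebraMap (algebraMap (ZMod p) _).injective p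
    have h1 := IntermediateField.adjoin_simple_eq_adjoin_pow_expChar_of_isSeparable _ E
      (mem_separableSubfield.1 hx) p
    have h2 : x ∈ (IntermediateField.adjoin (IntermediateField.adjoin (ZMod p) {t, u})
        {x ^ p}).toSubfield := by
      change x ∈ IntermediateField.adjoin _ {x ^ p}
      rw [← h1]
      exact IntermediateField.mem_adjoin_simple_self _ x
    refine IntermediateField.adjoin_le_subfield _ _ ?_ ?_ h2
    · rintro _ ⟨c, rfl⟩
      exact hF c.2
    · rintro _ rfl
      exact le_adjoinElement _ _ (le_adjoinElement _ _ (pow_mem_map_frobenius hx))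
  eq_add := hu
  pow_notMem h := hs (IsAlgebraic.of_pow hp.out.pos (isAlgebraic_of_mem_separableSubfield h))
  not_pow := not_pow_of_isUniformizer ht

/-- The subfield `F_p(t, u)^sep ∩ E` is relatively algebraically closed in `E`: some `p`-power of an
algebraic element is separable, and `p`-th roots in `E` stay in the subfield. -/
theorem IsGeneratedPair.mem_of_isAlgebraic {t u r s : E}
    (h : IsGeneratedPair p (separableSubfield p t u) t u r s) {x : E}
    (hx : IsAlgebraic (Algebra.adjoin (ZMod p) {t, u}) x) : x ∈ separableSubfield p t u := by
  have hExp : ExpChar (IntermediateField.adjoin (ZMod p) {t, u}) p :=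
    expChar_of_injective_algebraMap (algebraMap (ZMod p) _).injective p
  have hx' : IsAlgebraic (IntermediateField.adjoin (ZMod p) {t, u}) x := isAlgebraic_adjoin_iff.1 hx
  obtain ⟨g, hg, m, hm⟩ := (minpoly.irreducible hx'.isIntegral).hasSeparableContraction p
  have hsep : x ^ p ^ m ∈ separableSubfield p t u := by
    refine mem_separableSubfield.2 (hg.of_dvd (minpoly.dvd _ _ ?_))
    rw [← Polynomial.expand_aeval, hm, minpoly.aeval]
  clear hm
  induction m with
  | zero => simpa using hsep
  | succ m ih =>
    refine ih (h.mem_of_pow_mem ?_)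
    rwa [← pow_mul, ← pow_succ]

end Construction

end ValuedField

/-! ### Relatively algebraically closed subfields of complete fields -/

namespace ValuedField

open IsLocalRing

section Approximation

theorem valuation_aeval_sub_le {κ M : Type*} [Field κ] [Field M] [Algebra κ M]
    (V : ValuationSubring M) {g : Polynomial κ} (hg : ∀ n, algebraMap κ M (g.coeff n) ∈ V)
    {a b : M} (ha : a ∈ V) (hb : b ∈ V) :
    V.valuation (Polynomial.aeval a g - Polynomial.aeval b g) ≤ V.valuation (a - b) := by
  obtain ⟨G, hG⟩ : g.map (algebraMap κ M) ∈ Polynomial.lifts V.subtype := by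
    rw [Polynomial.lifts_iff_coeff_lifts]
    intro n
    rw [Polynomial.coeff_map]
    exact ⟨⟨_, hg n⟩, rfl⟩
  have heval : ∀ y : V, Polynomial.aeval (y : M) g = (G.eval y : V) := by
    intro y
    rw [Polynomial.aeval_def, ← Polynomial.eval_map, ← hG]
    exact Polynomial.eval_map_apply V.subtype y
  obtain ⟨d, hd⟩ := Polynomial.sub_dvd_eval_sub (⟨a, ha⟩ : V) ⟨b, hb⟩ G
  have h1 : Polynomial.aeval a g - Polynomial.aeval b g = (a - b) * d := by
    rw [heval ⟨a, ha⟩, heval ⟨b, hb⟩]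
    exact congrArg Subtype.val hd
  rw [h1, map_mul]
  exact mul_le_of_le_one_right' (V.valuation_le_one d)

universe u

variable {κ : Type u} [Field κ]

/-- In an immediate extension of a discretely valued field, every integral element is a limit of
elements of the base field. -/
theorem exists_approx {N : Type*} [Field N] [Algebra κ N] (B : ValuationSubring N)
    (himm : IsImmediate κ B) {t : κ} (ht : IsUniformizer (restrict κ B) t) {x : N} (hx : x ∈ B)
    (n : ℕ) : ∃ c : κ, B.valuation (x - algebraMap κ N c) ≤ B.valuation (algebraMap κ N t) ^ n := by
  rw [isImmediate_iff] at himm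
  induction n with
  | zero =>
    refine ⟨0, ?_⟩
    rw [map_zero, sub_zero, pow_zero]
    exact (B.valuation_le_one_iff x).2 hx
  | succ n ih =>
    obtain ⟨c, hc⟩ := ih
    rcases eq_or_ne (x - algebraMap κ N c) 0 with h0 | h0
    · exact ⟨c, by rw [h0, map_zero]; exact zero_le⟩
    obtain ⟨d, hd⟩ := himm.1 _ h0
    have hd0 : algebraMap κ N d ≠ 0 := fun h => by
      rw [h, map_zero] at hd
      exact h0 ((map_eq_zero _).1 hd)
    have hdv : B.valuation (algebraMap κ N d) ≠ 0 := by simpa using hd0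
    obtain ⟨e, he⟩ := himm.2 ((x - algebraMap κ N c) / algebraMap κ N d) (by
      rw [← ValuationSubring.valuation_le_one_iff, map_div₀, hd, div_self hdv])
    refine ⟨c + d * e, ?_⟩
    have h1 : x - algebraMap κ N (c + d * e) =
        algebraMap κ N d * ((x - algebraMap κ N c) / algebraMap κ N d - algebraMap κ N e) := by
      rw [mul_sub, mul_div_cancel₀ _ hd0, map_add, map_mul]
      ring
    rcases eq_or_ne (x - algebraMap κ N (c + d * e)) 0 with h2 | h2
    · rw [h2, map_zero]
      exact zero_le
    obtain ⟨f, hf⟩ := himm.1 _ h2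
    have hlt : B.valuation (algebraMap κ N f) < B.valuation (algebraMap κ N d) := by
      rw [← hf, h1, map_mul]
      exact mul_lt_of_lt_one_right (zero_lt_iff.2 hdv) he
    have h3 := ht.le_mul_of_lt (fun h => hd0 (by rw [h, map_zero]))
      ((valuation_restrict_lt_iff B _ _).2 hlt)
    rw [← map_mul, valuation_restrict_le_iff, map_mul, map_mul] at h3
    rw [hf, pow_succ']
    refine h3.trans (mul_le_mul_right ?_ _)
    rwa [← hd]

/-- A subfield of a complete discretely valued field that contains a uniformizer and is relatively
algebraically closed is algebraically maximal: an element of an immediate algebraic extension has a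
limit in the complete field, which is algebraic and hence lies in the subfield. -/
theorem isAlgebraicallyMaximal_of_isAlgebraicallyClosedIn {E : Type*} [Field E] [Algebra κ E]
    (A : ValuationSubring E) [IsAdicComplete (maximalIdeal A) A] {t : κ}
    (ht : IsUniformizer A (algebraMap κ E t)) (ht' : IsUniformizer (restrict κ A) t)
    (hcl : ∀ x : E, IsAlgebraic κ x → ∃ c, algebraMap κ E c = x) :
    IsAlgebraicallyMaximal (restrict κ A) := by
  intro N _ _ B halg hB himm
  have htB : IsUniformizer (restrict κ B) t := hB ▸ ht'
  have htrans : ∀ x y : κ, B.valuation (algebraMap κ N x) ≤ B.valuation (algebraMap κ N y) ↔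
      A.valuation (algebraMap κ E x) ≤ A.valuation (algebraMap κ E y) := fun x y => by
    rw [← valuation_restrict_le_iff, ← valuation_restrict_le_iff, hB]
  have htpow : ∀ (x : κ) (n : ℕ),
      B.valuation (algebraMap κ N x) ≤ B.valuation (algebraMap κ N t) ^ n ↔
        A.valuation (algebraMap κ E x) ≤ A.valuation (algebraMap κ E t) ^ n := fun x n => by
    rw [← map_pow, ← map_pow, ← map_pow, ← map_pow, htrans]
  have hmem : ∀ x : κ, algebraMap κ N x ∈ B ↔ algebraMap κ E x ∈ A := fun x => by
    change x ∈ restrict κ B ↔ x ∈ restrict κ A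
    rw [hB]
  have hint : ∀ x ∈ B, ∃ c, algebraMap κ N c = x := by
    intro x hx
    choose c hc using exists_approx B himm htB hx
    have hcB : ∀ n, algebraMap κ N (c n) ∈ B := fun n => by
      have h1 : x - algebraMap κ N (c n) ∈ B := by
        rw [← ValuationSubring.valuation_le_one_iff]
        refine (hc n).trans (pow_le_one₀ zero_le ?_)
        exact (B.valuation_le_one_iff _).2 htB.mem
      simpa using sub_mem hx h1
    have hcA : ∀ n, algebraMap κ E (c n) ∈ A := fun n => (hmem _).1 (hcB n)
    have hcauchy : ∀ {m n : ℕ}, m ≤ n →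
        (⟨_, hcA m⟩ : A) ≡ ⟨_, hcA n⟩ [SMOD (maximalIdeal A ^ m • ⊤ : Submodule A A)] := by
      intro m n hmn
      rw [SModEq.sub_mem, smul_eq_mul, Ideal.mul_top, ht.mem_maximalIdeal_pow_iff]
      change A.valuation (algebraMap κ E (c m) - algebraMap κ E (c n)) ≤ _
      rw [← map_sub, ← htpow, map_sub,
        show algebraMap κ N (c m) - algebraMap κ N (c n) =
          (x - algebraMap κ N (c n)) - (x - algebraMap κ N (c m)) by ring]
      refine (Valuation.map_sub _ _ _).trans (max_le ((hc n).trans ?_) (hc m))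
      exact pow_right_anti₀ zero_le ((B.valuation_le_one_iff _).2 htB.mem) hmn
    obtain ⟨z, hz⟩ := IsPrecomplete.prec (inferInstance : IsPrecomplete (maximalIdeal A) A) hcauchy
    have hz' : ∀ n, A.valuation (algebraMap κ E (c n) - z) ≤
        A.valuation (algebraMap κ E t) ^ n := fun n => by
      have := hz n
      rwa [SModEq.sub_mem, smul_eq_mul, Ideal.mul_top, ht.mem_maximalIdeal_pow_iff] at this
    have hxint := (halg.isAlgebraic x).isIntegral
    have hf0 := minpoly.ne_zero hxint
    obtain ⟨i₀, -, hi₀, hmax⟩ := exists_max_valuation (restrict κ A) (minpoly κ x).support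
      (minpoly κ x).coeff ⟨_, Polynomial.natDegree_mem_support_of_nonzero hf0, by simpa using hf0⟩
    -- Scale the minimal polynomial of `x` so that its coefficients are integral and pass to the
    -- limit `z` of the approximations `c n` of `x`: the polynomial vanishes at `z` as well.
    set g := Polynomial.C ((minpoly κ x).coeff i₀)⁻¹ * minpoly κ x with hg
    have hg0 : g ≠ 0 := mul_ne_zero (by simpa using hi₀) hf0
    have hgx : Polynomial.aeval x g = 0 := by rw [hg, map_mul, minpoly.aeval, mul_zero]
    have hgA : ∀ n, algebraMap κ E (g.coeff n) ∈ A := fun n => by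
      by_cases hn : n ∈ (minpoly κ x).support
      · have := hmax n hn
        rw [div_eq_inv_mul] at this
        rw [hg, Polynomial.coeff_C_mul]
        exact this
      · rw [Polynomial.notMem_support_iff] at hn
        rw [hg, Polynomial.coeff_C_mul, hn, mul_zero, map_zero]
        exact A.zero_mem
    have hgB : ∀ n, algebraMap κ N (g.coeff n) ∈ B := fun n => (hmem _).2 (hgA n)
    have hgz : Polynomial.aeval (z : E) g = 0 := by
      have hle : ∀ n, A.valuation (Polynomial.aeval (z : E) g) ≤
          A.valuation (algebraMap κ E t) ^ n := by
        intro n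
        have h1 : A.valuation (algebraMap κ E (g.eval (c n))) ≤
            A.valuation (algebraMap κ E t) ^ n := by
          rw [← htpow, ← Polynomial.aeval_algebraMap_apply_eq_algebraMap_eval,
            ← sub_zero (Polynomial.aeval _ g), ← hgx]
          refine (valuation_aeval_sub_le B hgB (hcB n) hx).trans ?_
          rw [Valuation.map_sub_swap]
          exact hc n
        have h2 := (valuation_aeval_sub_le A hgA (hcA n) z.2).trans (hz' n)
        rw [Polynomial.aeval_algebraMap_apply_eq_algebraMap_eval] at h2
        have h3 := Valuation.map_sub A.valuation (algebraMap κ E (g.eval (c n)))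
          (algebraMap κ E (g.eval (c n)) - Polynomial.aeval (z : E) g)
        rw [sub_sub_cancel] at h3
        exact h3.trans (max_le h1 h2)
      by_contra hne
      have hgzA : Polynomial.aeval (z : E) g ∈ A :=
        (A.valuation_le_one_iff _).1 (by simpa using hle 0)
      obtain ⟨k, hk⟩ := ht.exists_pow hgzA hne
      have h1 := hle (k + 1)
      rw [hk] at h1
      exact absurd h1 (not_le.2 (pow_lt_pow_right_of_lt_one₀ ht.valuation_pos ht.lt_one k.lt_succ_self))
    -- Now `z = d` lies in `κ`, and `x - d` has value at most that of every power of `t`.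
    obtain ⟨d, hd⟩ := hcl z ⟨g, hg0, hgz⟩
    refine ⟨d, (sub_eq_zero.1 (eq_zero_of_forall_valuation_le B htB (K := κ)
      ((halg.isAlgebraic x).sub (isAlgebraic_algebraMap d)) fun n => ?_)).symm⟩
    have h1 := hz' n
    rw [← hd, ← map_sub, ← htpow, map_sub] at h1
    have h2 := B.valuation.map_add (x - algebraMap κ N (c n))
      (algebraMap κ N (c n) - algebraMap κ N d)
    rw [sub_add_sub_cancel] at h2
    exact h2.trans (max_le (hc n) h1)
  intro x
  rcases B.mem_or_inv_mem x with hx | hx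
  · exact hint x hx
  · obtain ⟨c, hc⟩ := hint _ hx
    exact ⟨c⁻¹, by rw [map_inv₀, hc, inv_inv]⟩

theorem IsUniformizer.restrict {E : Type*} [Field E] [Algebra κ E] {A : ValuationSubring E} {t : κ}
    (ht : IsUniformizer A (algebraMap κ E t)) : IsUniformizer (restrict κ A) t where
  ne_zero h := ht.ne_zero (by rw [h, map_zero])
  lt_one := (valuation_restrict_lt_one_iff A t).2 ht.lt_one
  exists_zpow x hx := by
    obtain ⟨n, hn⟩ := ht.exists_zpow (algebraMap κ E x) (by simpa using hx)
    refine ⟨n, ?_⟩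
    rw [← map_zpow₀, valuation_restrict_eq_iff, map_zpow₀, map_zpow₀, hn]

theorem IsUniformizerPair.restrict {E : Type*} [Field E] [Algebra κ E] {p : ℕ} [Fact p.Prime]
    [CharP E p] {A : ValuationSubring E} {L : Subfield E} {r s : E} {t u : κ}
    (ht : IsUniformizer A (algebraMap κ E t))
    (hu : A.valuation (algebraMap κ E u) = A.valuation (algebraMap κ E t))
    (hA : ∀ x ∈ A, ∃ n : ℕ, A.valuation (x - n) < 1)
    (hL : IsGeneratedPair p L (algebraMap κ E t) (algebraMap κ E u) r s)
    (hmem : ∀ x : κ, algebraMap κ E x ∈ L) :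
    IsUniformizerPair p (restrict κ A) t u where
  isUniformizer := ht.restrict
  valuation_eq := (valuation_restrict_eq_iff A _ _).2 hu
  exists_natCast x hx := by
    obtain ⟨n, hn⟩ := hA _ hx
    refine ⟨n, (valuation_restrict_lt_one_iff A _).2 ?_⟩
    rwa [map_sub, map_natCast]
  eq_zero_of_sum c hc i := by
    have h1 := congrArg (algebraMap κ E) hc
    simp only [map_sum, map_mul, map_pow, map_zero] at h1
    have := hL.eq_zero_of_sum (fun i => hmem (c i)) h1 i
    simpa using this

end Approximation

end ValuedField

/-! ### Laurent series -/

namespace ValuedField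

open IsLocalRing

section LaurentSeries

open scoped PowerSeries LaurentSeries

instance {F : Type*} [Field F] : (Ideal.span {(PowerSeries.X : F⟦X⟧)}).IsMaximal :=
  PowerSeries.maximalIdeal_eq_span_X (k := F) ▸ inferInstance

theorem uncountable_powerSeries (F : Type*) [Field F] : Uncountable F⟦X⟧ := by
  classical
  have : Uncountable (Set ℕ) :=
    uncountable_iff_forall_not_surjective.2 fun f => Function.cantor_surjective f
  refine Function.Injective.uncountable (α := Set ℕ)
    (f := fun S => PowerSeries.mk fun n => if n ∈ S then (1 : F) else 0) fun S T h => ?_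
  ext n
  have := congrArg (PowerSeries.coeff n) h
  simp only [PowerSeries.coeff_mk] at this
  by_cases h1 : n ∈ S <;> by_cases h2 : n ∈ T <;> simp_all

/-- The valuation ring of power series in the field of Laurent series over `F_p`. -/
theorem exists_powerSeries_valuationSubring (p : ℕ) [hp : Fact p.Prime] :
    ∃ (A : ValuationSubring (ZMod p)⸨X⸩) (t : (ZMod p)⸨X⸩), IsAdicComplete (maximalIdeal A) A ∧
      IsUniformizer A t ∧ Uncountable A ∧ ∀ x ∈ A, ∃ n : ℕ, A.valuation (x - n) < 1 := by
  have hreg : ∀ f : (ZMod p)⟦X⟧, PowerSeries.X * f = 0 → f = 0 := fun f hf =>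
    (mul_eq_zero.1 hf).resolve_left PowerSeries.X_ne_zero
  obtain ⟨A, e, -, hA, hc, hm⟩ := exists_ringEquiv_valuationSubring hreg (ZMod p)⸨X⸩
  refine ⟨A, e PowerSeries.X, hc, isUniformizer_of_irreducible A
    ((IsDiscreteValuationRing.irreducible_iff_uniformizer _).2 hm), ?_, fun x hx => ?_⟩
  · have := uncountable_powerSeries (ZMod p)
    exact e.injective.uncountable
  · obtain ⟨f, hf⟩ := e.surjective ⟨x, hx⟩
    refine ⟨(PowerSeries.constantCoeff f).val, ?_⟩
    have h1 : (PowerSeries.X : (ZMod p)⟦X⟧) ∣ f - ((PowerSeries.constantCoeff f).val : ℕ) := by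
      rw [PowerSeries.X_dvd_iff, map_sub, map_natCast, ZMod.natCast_zmod_val, sub_self]
    have h2 : (⟨x, hx⟩ : A) - ((PowerSeries.constantCoeff f).val : ℕ) ∈ maximalIdeal A := by
      rw [hm, ← hf, ← map_natCast e, ← map_sub, Ideal.mem_span_singleton]
      exact map_dvd e h1
    exact (A.valuation_lt_one_iff _).1 h2

/-- The field of Laurent series over `F_p` is the quotient of a domain of characteristic `0` by
the ideal generated by `p`. -/
theorem exists_ringHom_laurentSeries (p : ℕ) [hp : Fact p.Prime] :
    ∃ φ : ℤ⸨X⸩ →+* (ZMod p)⸨X⸩, Function.Surjective φ ∧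
      RingHom.ker φ = Ideal.span {(p : ℤ⸨X⸩)} := by
  let g : ℤ⟦X⟧ →+* (ZMod p)⸨X⸩ :=
    (algebraMap (ZMod p)⟦X⟧ (ZMod p)⸨X⸩).comp (PowerSeries.map (Int.castRingHom (ZMod p)))
  have hgX : g PowerSeries.X = algebraMap (ZMod p)⟦X⟧ (ZMod p)⸨X⸩ PowerSeries.X := by
    simp [g]
  have hX0 : algebraMap (ZMod p)⟦X⟧ (ZMod p)⸨X⸩ PowerSeries.X ≠ 0 := by
    rw [Ne, map_eq_zero_iff _ (IsFractionRing.injective _ _)]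
    exact PowerSeries.X_ne_zero
  have hg : ∀ y : Submonoid.powers (PowerSeries.X : ℤ⟦X⟧), IsUnit (g y) := by
    rintro ⟨_, n, rfl⟩
    change IsUnit (g (PowerSeries.X ^ n))
    rw [map_pow, hgX]
    exact (IsUnit.mk0 _ hX0).pow n
  let φ : ℤ⸨X⸩ →+* (ZMod p)⸨X⸩ := IsLocalization.lift (M := Submonoid.powers (PowerSeries.X : ℤ⟦X⟧)) hg
  have hφ : ∀ f, φ (algebraMap _ _ f) = g f := IsLocalization.lift_eq hg
  have hsurj₀ : Function.Surjective (PowerSeries.map (Int.castRingHom (ZMod p))) :=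
    PowerSeries.map_surjective _ (ZMod.ringHom_surjective _)
  refine ⟨φ, fun y => ?_, ?_⟩
  · obtain ⟨⟨b, ⟨_, n, rfl⟩⟩, hb⟩ := IsLocalization.surj
      (Submonoid.powers (PowerSeries.X : (ZMod p)⟦X⟧)) y
    obtain ⟨a, rfl⟩ := hsurj₀ b
    refine ⟨IsLocalization.mk' ℤ⸨X⸩ a
      (⟨PowerSeries.X ^ n, n, rfl⟩ : Submonoid.powers (PowerSeries.X : ℤ⟦X⟧)), ?_⟩
    rw [IsLocalization.lift_mk'_spec]
    change g a = g (PowerSeries.X ^ n) * y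
    rw [map_pow, hgX, ← map_pow, mul_comm]
    exact hb.symm
  · ext x
    rw [RingHom.mem_ker, Ideal.mem_span_singleton]
    constructor
    · intro hx
      obtain ⟨⟨a, m⟩, ha⟩ := IsLocalization.surj (Submonoid.powers (PowerSeries.X : ℤ⟦X⟧)) x
      have h1 : g a = 0 := by rw [← hφ, ← ha, map_mul, hx, zero_mul]
      have h2 : PowerSeries.map (Int.castRingHom (ZMod p)) a = 0 :=
        IsFractionRing.injective (ZMod p)⟦X⟧ (ZMod p)⸨X⸩ (h1.trans (map_zero _).symm)
      have h3 : ∀ n, ∃ c : ℤ, PowerSeries.coeff n a = p * c := fun n => by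
        have := congrArg (PowerSeries.coeff n) h2
        rw [PowerSeries.coeff_map, map_zero] at this
        exact (ZMod.intCast_zmod_eq_zero_iff_dvd _ p).1 this
      choose c hc using h3
      have h4 : a = (p : ℤ⟦X⟧) * PowerSeries.mk c := by
        ext n
        rw [← map_natCast (PowerSeries.C (R := ℤ)), PowerSeries.coeff_C_mul, PowerSeries.coeff_mk,
          hc]
      have hunit := IsLocalization.map_units ℤ⸨X⸩ m
      rw [← hunit.dvd_mul_right, ha, h4, map_mul, map_natCast]
      exact Dvd.intro _ rfl
    · rintro ⟨y, rfl⟩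
      rw [map_mul, map_natCast, show ((p : ℕ) : (ZMod p)⸨X⸩) = 0 from ?_, zero_mul]
      rw [← map_natCast (algebraMap (ZMod p) (ZMod p)⸨X⸩), ZMod.natCast_self, map_zero]

end LaurentSeries

end ValuedField

/-! ### Lifts to characteristic zero -/

namespace ValuedField

open IsLocalRing

section Lift

variable {S E : Type*} [CommRing S] [Field E] {p : ℕ} [hp : Fact p.Prime] [Algebra (ZMod p) E]

/-- The homomorphism `ℤ[X₀, X₁] → F_p[t, u]`. -/
noncomputable def reduceAdjoin (t u : E) :
    MvPolynomial (Fin 2) ℤ →+* Algebra.adjoin (ZMod p) {t, u} :=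
  ((MvPolynomial.aeval (R := ZMod p)
    ![⟨t, Algebra.subset_adjoin (by simp)⟩, ⟨u, Algebra.subset_adjoin (by simp)⟩] :
      MvPolynomial (Fin 2) (ZMod p) →ₐ[ZMod p] Algebra.adjoin (ZMod p) {t, u}) :
    MvPolynomial (Fin 2) (ZMod p) →+* Algebra.adjoin (ZMod p) {t, u}).comp
      (MvPolynomial.map (Int.castRingHom (ZMod p)))

theorem coe_reduceAdjoin (t u : E) (f : MvPolynomial (Fin 2) ℤ) :
    (reduceAdjoin (p := p) t u f : E) =
      MvPolynomial.aeval ![t, u] (MvPolynomial.map (Int.castRingHom (ZMod p)) f) := by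
  change (Algebra.adjoin (ZMod p) {t, u}).val (MvPolynomial.aeval _ _) = _
  rw [MvPolynomial.comp_aeval_apply]
  congr 2
  ext i
  fin_cases i <;> rfl

theorem reduceAdjoin_eq_zero_iff {t u : E} (h : AlgebraicIndependent (ZMod p) ![t, u])
    (f : MvPolynomial (Fin 2) ℤ) :
    reduceAdjoin (p := p) t u f = 0 ↔ MvPolynomial.C (p : ℤ) ∣ f := by
  rw [MvPolynomial.C_dvd_iff_map_hom_eq_zero (Int.castRingHom (ZMod p)) (p : ℤ)
    (fun r => ZMod.intCast_zmod_eq_zero_iff_dvd r p), ← Subtype.coe_inj, coe_reduceAdjoin]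
  exact map_eq_zero_iff _ h

variable (ψ : S →+* E) (t₁ u₁ : S)

/-- The subring of the elements of `S` that are algebraic over `ℤ[t₁, u₁]`. -/
noncomputable def algebraicSubring : Subring S :=
  letI := (MvPolynomial.aeval (R := ℤ) ![t₁, u₁]).toRingHom.toAlgebra
  (Subalgebra.algebraicClosure (MvPolynomial (Fin 2) ℤ) S).toSubring

variable {ψ t₁ u₁}

theorem mem_algebraicSubring {x : S} : x ∈ algebraicSubring t₁ u₁ ↔
    ∃ f : Polynomial (MvPolynomial (Fin 2) ℤ), f ≠ 0 ∧
      f.eval₂ (MvPolynomial.aeval (R := ℤ) ![t₁, u₁]).toRingHom x = 0 := Iff.rfl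

theorem map_aeval_eq (f : MvPolynomial (Fin 2) ℤ) :
    ψ (MvPolynomial.aeval (R := ℤ) ![t₁, u₁] f) =
      (reduceAdjoin (p := p) (ψ t₁) (ψ u₁) f : E) := by
  rw [coe_reduceAdjoin]
  have : (ψ.comp (MvPolynomial.aeval (R := ℤ) ![t₁, u₁]).toRingHom) =
      (MvPolynomial.aeval (R := ZMod p) ![ψ t₁, ψ u₁]).toRingHom.comp
        (MvPolynomial.map (Int.castRingHom (ZMod p))) := by
    refine MvPolynomial.ringHom_ext' (RingHom.ext_int _ _) fun i => ?_
    fin_cases i <;> simp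
  exact RingHom.congr_fun this f

/-- The residues of elements that are algebraic over `ℤ[t₁, u₁]` are algebraic over the residues
of `t₁` and `u₁`, provided that these are algebraically independent: a polynomial relation can be
divided by `p` until its reduction is nontrivial. -/
theorem isAlgebraic_map_of_mem [IsDomain S] (h : AlgebraicIndependent (ZMod p) ![ψ t₁, ψ u₁])
    (hp0 : (p : S) ≠ 0) {x : S} (hx : x ∈ algebraicSubring t₁ u₁) :
    IsAlgebraic (Algebra.adjoin (ZMod p) {ψ t₁, ψ u₁}) (ψ x) := by
  obtain ⟨f, hf0, hfx⟩ := mem_algebraicSubring.1 hx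
  have hprime : Prime (Polynomial.C (MvPolynomial.C (p : ℤ)) :
      Polynomial (MvPolynomial (Fin 2) ℤ)) :=
    Polynomial.prime_C_iff.2 ((MvPolynomial.prime_C_iff _).2 (Nat.prime_iff_prime_int.1 hp.out))
  obtain ⟨n, g, hg, rfl⟩ := WfDvdMonoid.max_power_factor hf0 hprime.irreducible
  have hgx : g.eval₂ (MvPolynomial.aeval (R := ℤ) ![t₁, u₁]).toRingHom x = 0 := by
    rw [Polynomial.eval₂_mul, Polynomial.eval₂_pow, Polynomial.eval₂_C] at hfx
    refine (mul_eq_zero.1 hfx).resolve_left (pow_ne_zero n ?_)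
    simpa using hp0
  refine ⟨g.map (reduceAdjoin (p := p) (ψ t₁) (ψ u₁)), fun h0 => hg ?_, ?_⟩
  · rw [Polynomial.C_dvd_iff_dvd_coeff]
    intro i
    rw [← reduceAdjoin_eq_zero_iff h, ← Polynomial.coeff_map, h0, Polynomial.coeff_zero]
  · rw [Polynomial.aeval_def, Polynomial.eval₂_map]
    have := congrArg ψ hgx
    rw [Polynomial.hom_eval₂, map_zero] at this
    rw [← this]
    congr 1
    ext i
    · simp
    · exact (map_aeval_eq (p := p) _).symm

theorem mem_algebraicSubring_of_root [IsDomain S] {f : Polynomial (algebraicSubring t₁ u₁)}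
    (hf : f ≠ 0) {x : S} (hx : f.eval₂ (algebraicSubring t₁ u₁).subtype x = 0) :
    x ∈ algebraicSubring t₁ u₁ := by
  let := (MvPolynomial.aeval (R := ℤ) ![t₁, u₁]).toRingHom.toAlgebra
  have h1 : IsAlgebraic (Subalgebra.algebraicClosure (MvPolynomial (Fin 2) ℤ) S) x := ⟨f, hf, hx⟩
  exact h1.restrictScalars (MvPolynomial (Fin 2) ℤ)

theorem aeval_mem_algebraicSubring (f : MvPolynomial (Fin 2) ℤ) :
    MvPolynomial.aeval (R := ℤ) ![t₁, u₁] f ∈ algebraicSubring t₁ u₁ :=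
  mem_algebraicSubring.2 ⟨Polynomial.X - Polynomial.C f, Polynomial.X_sub_C_ne_zero f, by simp⟩

theorem left_mem_algebraicSubring : t₁ ∈ algebraicSubring t₁ u₁ := by
  simpa using aeval_mem_algebraicSubring (t₁ := t₁) (u₁ := u₁) (MvPolynomial.X 0)

theorem right_mem_algebraicSubring : u₁ ∈ algebraicSubring t₁ u₁ := by
  simpa using aeval_mem_algebraicSubring (t₁ := t₁) (u₁ := u₁) (MvPolynomial.X 1)

theorem mem_algebraicSubring_of_mul_eq [IsDomain S] {x y z : S} (hx : x ∈ algebraicSubring t₁ u₁)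
    (hz : z ∈ algebraicSubring t₁ u₁) (hx0 : x ≠ 0) (h : x * y = z) :
    y ∈ algebraicSubring t₁ u₁ := by
  refine mem_algebraicSubring_of_root (f := Polynomial.C ⟨x, hx⟩ * Polynomial.X -
    Polynomial.C ⟨z, hz⟩) (fun h0 => hx0 ?_) ?_
  · have := congrArg (fun f => Polynomial.coeff f 1) h0
    simpa using this
  · simp [h]

variable [IsDomain S] [IsLocalRing S]

/-- The image in the residue field of the ring of elements that are algebraic over `ℤ[t₁, u₁]`. -/
noncomputable def imageSubfield (ψ : S →+* E) (hψ : RingHom.ker ψ = maximalIdeal S) (t₁ u₁ : S) :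
    Subfield E :=
  { (algebraicSubring t₁ u₁).map ψ with
    inv_mem' := by
      rintro _ ⟨x, hx, rfl⟩
      by_cases h0 : ψ x = 0
      · exact ⟨0, (algebraicSubring t₁ u₁).zero_mem, by rw [h0, map_zero, inv_zero]⟩
      · have hunit : IsUnit x := by
          by_contra hx
          exact h0 (RingHom.mem_ker.1 (hψ ▸ (mem_maximalIdeal x).2 hx))
        obtain ⟨y, hy⟩ := hunit.exists_right_inv
        refine ⟨y, mem_algebraicSubring_of_mul_eq hx (one_mem _) hunit.ne_zero hy, ?_⟩
        refine eq_inv_of_mul_eq_one_right ?_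
        rw [← map_mul, hy, map_one] }

/-- By Hensel's lemma, every element of the residue field that is separable over the residues of
`t₁` and `u₁` lifts to an element that is algebraic over `ℤ[t₁, u₁]`. -/
theorem mem_imageSubfield_of_isSeparable [IsAdicComplete (maximalIdeal S) S]
    (hsurj : Function.Surjective ψ) (hψ : RingHom.ker ψ = maximalIdeal S) {y : E}
    (hy : y ∈ separableSubfield p (ψ t₁) (ψ u₁)) : y ∈ imageSubfield ψ hψ t₁ u₁ := by
  set M := imageSubfield ψ hψ t₁ u₁ with hM
  have hle : (IntermediateField.adjoin (ZMod p) {ψ t₁, ψ u₁}).toSubfield ≤ M := by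
    refine IntermediateField.adjoin_le_subfield _ _ ?_ ?_
    · rintro _ ⟨c, rfl⟩
      exact algebraMap_zmod_mem M.toSubring c
    · rintro z (rfl | rfl)
      · exact ⟨t₁, left_mem_algebraicSubring, rfl⟩
      · exact ⟨u₁, right_mem_algebraicSubring, rfl⟩
  have hsep := mem_separableSubfield.1 hy
  let := (Subfield.inclusion hle).toAlgebra
  have : IsScalarTower (IntermediateField.adjoin (ZMod p) {ψ t₁, ψ u₁}) M E :=
    IsScalarTower.of_algebraMap_eq fun _ => rfl
  have hsep' : IsSeparable M y := hsep.tower_top M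
  have hint : IsIntegral M y := hsep'.isIntegral
  obtain ⟨y₀, rfl⟩ := hsurj y
  let θ : algebraicSubring t₁ u₁ →+* M :=
    (ψ.comp (algebraicSubring t₁ u₁).subtype).codRestrict M.toSubring fun x => ⟨x, x.2, rfl⟩
  have hθ : Function.Surjective θ := by
    rintro ⟨_, x, hx, rfl⟩
    exact ⟨⟨x, hx⟩, rfl⟩
  -- Lift the minimal polynomial of the residue to a monic polynomial and then its simple root.
  obtain ⟨G, hG, -, hGm⟩ := Polynomial.lifts_and_natDegree_eq_and_monic
    (Polynomial.map_surjective θ hθ (minpoly M (ψ y₀))) (minpoly.monic hint)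
  have hGψ : ∀ (H : Polynomial (algebraicSubring t₁ u₁)),
      ψ ((H.map (algebraicSubring t₁ u₁).subtype).eval y₀) = Polynomial.aeval (ψ y₀) (H.map θ) := by
    intro H
    rw [Polynomial.eval_map, Polynomial.hom_eval₂, Polynomial.aeval_def, Polynomial.eval₂_map]
    rfl
  obtain ⟨a, ha, hay⟩ := HenselianRing.is_henselian (I := maximalIdeal S)
    (G.map (algebraicSubring t₁ u₁).subtype) (hGm.map _) y₀
    (by rw [← hψ, RingHom.mem_ker, hGψ, hG, minpoly.aeval]) (by
      refine IsUnit.map _ ?_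
      by_contra h0
      have h1 := RingHom.mem_ker.1 (hψ ▸ (mem_maximalIdeal _).2 h0)
      rw [Polynomial.derivative_map, hGψ, ← Polynomial.derivative_map, hG] at h1
      exact hsep'.aeval_derivative_ne_zero (minpoly.aeval _ _) h1)
  refine ⟨a, mem_algebraicSubring_of_root hGm.ne_zero ?_, ?_⟩
  · rw [← Polynomial.eval_map]
    exact ha
  · rw [← hψ, RingHom.mem_ker, map_sub, sub_eq_zero] at hay
    exact hay

end Lift

section LiftField

universe u

/-- The subfield `F_p(t, u)^sep ∩ E` of the residue field `E` of a complete discrete valuation ring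
with uniformizer `p` is the quotient by `p` of a ring in which `p` is regular. -/
theorem exists_lift {S E : Type u} [CommRing S] [IsDomain S] [IsDiscreteValuationRing S]
    [IsAdicComplete (maximalIdeal S) S] [Field E] {p : ℕ} [hp : Fact p.Prime] [Algebra (ZMod p) E]
    (hm : maximalIdeal S = Ideal.span {(p : S)})
    {ψ : S →+* E} (hsurj : Function.Surjective ψ) (hψ : RingHom.ker ψ = maximalIdeal S)
    {t u : E} (h : AlgebraicIndependent (ZMod p) ![t, u])
    (hcl : ∀ x : E, IsAlgebraic (Algebra.adjoin (ZMod p) {t, u}) x → x ∈ separableSubfield p t u) :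
    ∃ (R : Type u) (_ : CommRing R) (φ : R →+* separableSubfield p t u),
      Function.Surjective φ ∧ RingHom.ker φ = Ideal.span {(p : R)} ∧
        ∀ x : R, (p : R) * x = 0 → x = 0 := by
  have hp0 : (p : S) ≠ 0 := fun h0 => IsDiscreteValuationRing.not_a_field S (by simpa [h0] using hm)
  obtain ⟨t₁, rfl⟩ := hsurj t
  obtain ⟨u₁, rfl⟩ := hsurj u
  refine ⟨algebraicSubring t₁ u₁, inferInstance,
    (ψ.comp (algebraicSubring t₁ u₁).subtype).codRestrict (separableSubfield p (ψ t₁) (ψ u₁)).toSubring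
      fun x => hcl _ (isAlgebraic_map_of_mem h hp0 x.2), ?_, ?_, ?_⟩
  · rintro ⟨y, hy⟩
    obtain ⟨x, hx, hxy⟩ := mem_imageSubfield_of_isSeparable hsurj hψ hy
    exact ⟨⟨x, hx⟩, Subtype.ext hxy⟩
  · ext x
    rw [RingHom.mem_ker, Ideal.mem_span_singleton]
    have h1 : ψ (x : S) = 0 ↔ (p : S) ∣ x := by
      rw [← RingHom.mem_ker, hψ, hm, Ideal.mem_span_singleton]
    rw [Subtype.ext_iff]
    refine h1.trans ⟨?_, ?_⟩
    · rintro ⟨y, hy⟩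
      exact ⟨⟨y, mem_algebraicSubring_of_mul_eq (natCast_mem _ p) x.2 hp0 hy.symm⟩, Subtype.ext hy⟩
    · rintro ⟨y, rfl⟩
      exact ⟨y, rfl⟩
  · intro x hx
    exact Subtype.ext ((mul_eq_zero.1 (congrArg Subtype.val hx)).resolve_left hp0)

end LiftField

end ValuedField

/-! ### The example -/

namespace ValuedField

open IsLocalRing

section Example

theorem isAlgebraicallyClosedIn_separableSubfield {E : Type*} [Field E] {p : ℕ} [Fact p.Prime]
    [CharP E p] [Algebra (ZMod p) E] {t u r s : E}
    (hL : IsGeneratedPair p (separableSubfield p t u) t u r s) {κ : Type*} [Field κ] [Algebra κ E]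
    (hκ : ∀ x : κ, algebraMap κ E x ∈ separableSubfield p t u) {x : E} (hx : IsAlgebraic κ x) :
    x ∈ separableSubfield p t u := by
  refine hL.mem_of_isAlgebraic (isAlgebraic_adjoin_iff.2 ?_)
  set F := IntermediateField.adjoin (ZMod p) {t, u}
  obtain ⟨f, hf0, hfx⟩ := hx
  let j : κ →+* separableClosure F E :=
    (algebraMap κ E).codRestrict (separableClosure F E).toSubalgebra hκ
  have h1 : IsAlgebraic (separableClosure F E) x := by
    refine ⟨f.map j, (Polynomial.map_ne_zero_iff j.injective).2 hf0, ?_⟩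
    rw [Polynomial.aeval_def, Polynomial.eval₂_map]
    exact hfx
  exact h1.restrictScalars F

/-- The residue field of `W` inherits the properties of the subfield `F_p(t, u)^sep ∩ E` of `E`. -/
theorem exists_isUniformizerPair_residueField {E : Type*} [Field E] {p : ℕ} [Fact p.Prime]
    [CharP E p] [Algebra (ZMod p) E] {A : ValuationSubring E} [IsAdicComplete (maximalIdeal A) A]
    (hA : ∀ x ∈ A, ∃ n : ℕ, A.valuation (x - n) < 1)
    {t u r s : E} (ht : IsUniformizer A t) (hu : A.valuation u = A.valuation t)
    (hL : IsGeneratedPair p (separableSubfield p t u) t u r s)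
    {L : Type*} [Field L] (W : ValuationSubring L)
    (ψ : W →+* separableSubfield p t u) (hψ : RingHom.ker ψ = maximalIdeal W)
    (hsurj : Function.Surjective ψ) :
    CharP (ResidueField W) p ∧ ∃ (A₀ : ValuationSubring (ResidueField W)) (t' u' : ResidueField W),
      IsUniformizerPair p A₀ t' u' ∧ IsAlgebraicallyMaximal A₀ := by
  let ι : ResidueField W →+* E := (separableSubfield p t u).subtype.comp
    (Ideal.Quotient.lift (maximalIdeal W) ψ fun a ha => by rwa [← hψ, RingHom.mem_ker] at ha)
  have hι : ∀ x : W, ι (residue W x) = ψ x := fun x => rfl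
  let := ι.toAlgebra
  have hchar : CharP (ResidueField W) p := RingHom.charP ι ι.injective p
  obtain ⟨t₁, ht₁⟩ := hsurj ⟨t, hL.mem_left⟩
  obtain ⟨u₁, hu₁⟩ := hsurj ⟨u, hL.mem_right⟩
  have ht' : algebraMap (ResidueField W) E (residue W t₁) = t := by
    change ι (residue W t₁) = t
    rw [hι, ht₁]
  have hu' : algebraMap (ResidueField W) E (residue W u₁) = u := by
    change ι (residue W u₁) = u
    rw [hι, hu₁]
  have hmem : ∀ x, algebraMap (ResidueField W) E x ∈ separableSubfield p t u := fun x => by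
    obtain ⟨y, rfl⟩ := residue_surjective x
    exact (ψ y).2
  have hunif : IsUniformizer A (algebraMap (ResidueField W) E (residue W t₁)) := ht'.symm ▸ ht
  refine ⟨hchar, restrict (ResidueField W) A, residue W t₁, residue W u₁,
    IsUniformizerPair.restrict (L := separableSubfield p t u) (r := r) (s := s) hunif ?_ hA ?_ hmem,
    isAlgebraicallyMaximal_of_isAlgebraicallyClosedIn A hunif hunif.restrict fun x hx => ?_⟩
  · rw [ht', hu', hu]
  · rw [ht', hu']
    exact hL
  · obtain ⟨y, hy⟩ := hsurj ⟨x, isAlgebraicallyClosedIn_separableSubfield hL hmem hx⟩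
    refine ⟨residue W y, ?_⟩
    change ι (residue W y) = x
    rw [hι, hy]

open scoped LaurentSeries

/-- Complete discrete valuations of characteristic `(q, p)` whose residue field is algebraically
maximal for a discrete valuation with a `p`-independent pair of uniformizers. -/
theorem exists_complete_isUniformizerPair (p : ℕ) (hp : p.Prime) (q : ℕ) (hq : q = p ∨ q = 0) :
    ∃ (L : Type) (_ : Field L) (W : ValuationSubring L), IsDiscreteValuationRing W ∧
      IsAdicComplete (maximalIdeal W) W ∧ CharP L q ∧ CharP (ResidueField W) p ∧
      ∃ (A₀ : ValuationSubring (ResidueField W)) (t u : ResidueField W),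
        IsUniformizerPair p A₀ t u ∧ IsAlgebraicallyMaximal A₀ := by
  have := Fact.mk hp
  obtain ⟨A, t, hAc, ht, hAu, hA⟩ := exists_powerSeries_valuationSubring p
  have hchar : CharP (ZMod p)⸨X⸩ p :=
    charP_of_injective_ringHom (algebraMap (ZMod p) (ZMod p)⸨X⸩).injective p
  obtain ⟨u, r, s, hu, huv, hind, hs⟩ := exists_complement (p := p) hAu ht.ne_zero ht.lt_one
  have hL := isGeneratedPair_separableSubfield ht hu hs
  set κ := separableSubfield p t u with hκ
  obtain ⟨R, hR, ϖ, φ, hφ, hker, hreg, hcharR⟩ : ∃ (R : Type) (_ : CommRing R) (ϖ : R) (φ : R →+* κ),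
      Function.Surjective φ ∧ RingHom.ker φ = Ideal.span {ϖ} ∧ (∀ x, ϖ * x = 0 → x = 0) ∧
        ((p : R) = 0 ∧ q = p ∨ (p : R) = ϖ ∧ q = 0) := by
    -- In characteristic `p` the ring `κ[X]` with `X ↦ 0` will do; in characteristic `0` a ring with
    -- quotient `κ` modulo `p` comes from the `p`-adic completion of `ℤ((X))`, whose residue field is
    -- `F_p((X))`.
    rcases hq with hq | hq
    · refine ⟨Polynomial κ, inferInstance, Polynomial.X, Polynomial.constantCoeff,
        Polynomial.constantCoeff_surjective, Polynomial.ker_constantCoeff, fun x hx =>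
          (mul_eq_zero.1 hx).resolve_left Polynomial.X_ne_zero, Or.inl ⟨?_, hq⟩⟩
      have : CharP κ p := RingHom.charP κ.subtype κ.subtype.injective p
      exact CharP.cast_eq_zero _ p
    · obtain ⟨φ₁, hφ₁, hker₁⟩ := exists_ringHom_laurentSeries p
      have hreg₁ : ∀ x : ℤ⸨X⸩, (p : ℤ⸨X⸩) * x = 0 → x = 0 := by
        intro x hx
        ext n
        have h1 : (p • x).coeff n = 0 := by rw [nsmul_eq_mul, hx, HahnSeries.coeff_zero]
        rw [HahnSeries.coeff_nsmul, Pi.smul_apply] at h1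
        simpa [hp.ne_zero] using h1
      obtain ⟨L₁, _, W₁, f₁, ψ₁, _, _, hm₁, hf₁, hψ₁⟩ := exists_completion φ₁ hφ₁ hker₁ hreg₁
      rw [map_natCast] at hm₁
      obtain ⟨R, hR, φ, hφ, hker, hreg⟩ := exists_lift hm₁
        (fun y => by
          obtain ⟨x, rfl⟩ := hφ₁ y
          exact ⟨f₁ x, hf₁ x⟩) hψ₁ hind fun x hx => hL.mem_of_isAlgebraic hx
      exact ⟨R, hR, p, φ, hφ, hker, hreg, Or.inr ⟨rfl, hq⟩⟩
  obtain ⟨L, _, W, f, ψ, hW, hWc, hWm, hf, hψ⟩ := exists_completion φ hφ hker hreg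
  have hψs : Function.Surjective ψ := fun y => by
    obtain ⟨x, rfl⟩ := hφ y
    exact ⟨f x, hf x⟩
  refine ⟨L, inferInstance, W, hW, hWc, ?_,
    exists_isUniformizerPair_residueField hA ht huv hL W ψ hψ hψs⟩
  have hϖ : f ϖ ≠ 0 := fun h0 => IsDiscreteValuationRing.not_a_field W (by simpa [h0] using hWm)
  rcases hcharR with ⟨hpR, rfl⟩ | ⟨hpR, rfl⟩
  · rw [CharP.charP_iff_prime_eq_zero hp, ← map_natCast W.subtype, ← map_natCast f, hpR, map_zero,
      map_zero]
  · have hpL : (p : L) ≠ 0 := by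
      rw [← map_natCast W.subtype, ← map_natCast f, hpR]
      exact fun h0 => hϖ (Subtype.ext h0)
    obtain ⟨c, hc⟩ := CharP.exists L
    have hcκ : (c : κ) = 0 := by
      have h1 : (c : W) = 0 := Subtype.ext (by simp)
      rw [← map_natCast ψ, h1, map_zero]
    have : CharP κ p := RingHom.charP κ.subtype κ.subtype.injective p
    have hpc : p ∣ c := (CharP.cast_eq_zero_iff κ p c).1 hcκ
    rcases CharP.char_is_prime_or_zero L c with h | h
    · rw [← (Nat.prime_dvd_prime_iff_eq hp h).1 hpc] at hc
      exact absurd (CharP.cast_eq_zero L p) hpL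
    · exact h ▸ hc

end Example

end ValuedField

open ValuedField IsLocalRing in
theorem theorem1p2 (p : ℕ) (hp : p.Prime) :
    -- for `q = p` and for `q = 0` there is an example of characteristic `(q, p)`
    (∀ q : ℕ, q = p ∨ q = 0 →
      ∃ (L : Type) (_ : Field L) (W : ValuationSubring L)
        (A₀ : ValuationSubring (ResidueField W)),
        -- `w` is a henselian defectless discrete valuation
        IsDiscretelyValued W ∧ IsHenselian W ∧ IsDefectless W ∧
        -- its residue field `L₀ = Lw` with the valuation `v₀`
        CharP (ResidueField W) p ∧ IsDiscretelyValued A₀ ∧ IsAlgebraicallyMaximal A₀ ∧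
        ¬ IsInseparablyDefectless A₀ ∧
        (∃ (E : Type) (_ : Field E) (_ : Algebra (ResidueField W) E) (C : ValuationSubring E),
          IsPurelyInseparable (ResidueField W) E ∧ Module.finrank (ResidueField W) E = p ∧
          restrict (ResidueField W) C = A₀ ∧ ¬ IsAlgebraicallyMaximal C) ∧
        -- the composite `v = w ∘ v₀` on `L`
        CharP L q ∧ CharP (ResidueField (composite W A₀)) p ∧
        rank (composite W A₀) = 2 ∧
        IsAlgebraicallyMaximal (composite W A₀) ∧
        ¬ IsSeparablyDefectless (composite W A₀) ∧
        -- the extension `M = L(a, b)`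
        ∃ (M : Type) (_ : Field M) (_ : Algebra L M) (B : ValuationSubring M) (a b : M),
          restrict L B = composite W A₀ ∧
          IntermediateField.adjoin L {a, b} = ⊤ ∧
          Algebra.IsSeparable L M ∧ Module.finrank L M = p ^ 2 ∧ HasDefect L B p ∧
          Module.finrank L (IntermediateField.adjoin L {a}) = p ∧
          Module.finrank L (IntermediateField.adjoin L {b}) = p ∧
          ¬ IsAlgebraicallyMaximal (restrict (IntermediateField.adjoin L {a}) B) ∧
          ¬ IsAlgebraicallyMaximal (restrict (IntermediateField.adjoin L {b}) B)) ∧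
    -- "algebraically maximal" does not imply "separably defectless"
    (¬ ∀ (K : Type) [Field K] (A : ValuationSubring K),
        IsAlgebraicallyMaximal A → IsSeparablyDefectless A) ∧
    -- "algebraically maximal" is not preserved under finite separable extensions
    (¬ ∀ (K K' : Type) [Field K] [Field K'] [Algebra K K'] (A' : ValuationSubring K'),
        FiniteDimensional K K' → Algebra.IsSeparable K K' →
        IsAlgebraicallyMaximal (restrict K A') → IsAlgebraicallyMaximal A') := by
  refine (and_iff_left_of_imp fun h => ?_).2 fun q hq => ?_
  · obtain ⟨L, _, W, A₀, -, -, -, -, -, -, -, -, -, -, -, hmax, hsep, M, _, _, B, a, b, hB, -, hMs,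
      hMf, hd, -, -, ha, -⟩ := h p (Or.inl rfl)
    refine ⟨fun hall => hsep (hall L _ hmax), fun hall => ha ?_⟩
    have := hd.1
    refine hall L (IntermediateField.adjoin L {a}) _ inferInstance inferInstance ?_
    exact hB.symm ▸ hmax
  · obtain ⟨L, _, W, hW, hWc, hq, hchar, A₀, t, u, hpair, hmax⟩ :=
      exists_complete_isUniformizerPair p hp q hq
    have hA₀ := hpair.isUniformizer.isDiscreteValuationRing
    obtain ⟨hE, hins⟩ := hpair.exists_purelyInseparable hp
    obtain ⟨M, _, _, B, a, b, hB, htop, hsep, hfin, hdef, hrest⟩ :=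
      exists_separable_defect_extension hp W hpair
    refine ⟨L, inferInstance, W, A₀, hW, isHenselian_of_isAdicComplete W,
      isDefectless_of_isAdicComplete W, hchar, hA₀, hmax, hins, hE, hq,
      charP_residueField_composite hp W A₀, rank_composite_eq_two W A₀,
      isAlgebraicallyMaximal_composite W hmax, fun hall => ?_,
      M, inferInstance, inferInstance, B, a, b, hB, htop, hsep, hfin, hdef, hrest⟩
    -- the defect is determined by the degree, the ramification index and the inertia degree
    have h1 := (hall M B hdef.1 hsep hB (hB ▸ hdef.2.1)).2.2.2
    have h2 := hdef.2.2.2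
    rw [one_mul] at h1
    rw [mul_assoc, ← h1, hfin] at h2
    have h3 : 0 < p ^ 2 := pow_pos hp.pos 2
    have h4 : 1 * p ^ 2 = p * p ^ 2 := by rwa [one_mul]
    exact hp.one_lt.ne (Nat.eq_of_mul_eq_mul_right h3 h4)
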